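/- Let $p\in(0,1]$ and $s\in(0,2)$. Consider the directed random graph on $\mathbb Z$ in which each edge $(i,j)$, $i<j$, is present independently with probability $p$, and attach to the edges i.i.d. weights $v_{i,j}>0$, independent of the graph, with distribution function $F$. For $i\le j$ let $w_{i,j}$ be the maximum, over all increasing paths from $i$ to $j$ that use only present edges, of the sum of the weights along the path, with $w_{i,j}=-\infty$ if there is no such path. Suppose that $F$ has a regularly varying tail with index $s$: $$\frac{1-F(tx)}{1-F(x)}\to t^{-s}\quad\text{as }x\to\infty,\ \text{for every }t>0,$$ and put $b_n=F^{(-1)}\left(1-1/\binom{n+1}{2}\right)$, where $F^{(-1)}(u)=\inf\{x: F(x)\ge u\}$. Let $W_1,W_2,\dots$ be exponential random variables with mean $1$ and $U_1,V_1,U_2,V_2,\dots$ uniform random variables on $[0,1]$, all independent. Put $M_k=(W_1+\dots+W_k)^{-1/s}$ and $Y_k=(\min(U_k,V_k),\max(U_k,V_k))$. Call $(a,b)$ and $(a',b')$ compatible if $b\le a'$ or $b'\le a$, and let $$w=\sup_{A}\sum_{i\in A}M_i,$$ where the supremum is over all sets $A\subset\{1,2,\dots\}$ such that $Y_i$ and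 $Y_j$ are compatible for all distinct $i,j\in A$. Then $w$ is almost surely finite, and $$\frac{p^{-1/s}\,w_{0,n}}{b_n}\to w\quad\text{in distribution as }n\to\infty$$ (as random variables with values in $[-\infty,\infty]$). -/

import Mathlib

open MeasureTheory ProbabilityTheory Filter Topology
open scoped ENNReal

namespace LongRangeLPP

/-- The directed edges `(i, j)` with `i < j` on the vertex set `ℤ`. -/
abbrev Edge : Type := {e : ℤ × ℤ // e.1 < e.2}

/-- `IsPath i j π`: the list of edges `π = [(i₀, i₁), …, (i_{l-1}, i_l)]` is an increasing path
from `i = i₀` to `j = i_l`, for some `l ≥ 0`. -/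
def IsPath : ℤ → ℤ → List Edge → Prop
  | i, j, [] => i = j
  | i, j, e :: π => e.1.1 = i ∧ IsPath e.1.2 j π

/-- The random directed graph with i.i.d. weights: independently over all edges `e`, the edge `e`
is present (`α e = true`) with probability `p` and carries a weight `v e` with law `μ`,
independent of its presence. -/
structure IsWeightedRandomGraph {Ω : Type*} [MeasurableSpace Ω] (P : Measure Ω) (p : ℝ)
    (μ : Measure ℝ) (α : Edge → Ω → Bool) (v : Edge → Ω → ℝ) : Prop where
  measurable_present : ∀ e, Measurable (α e)
  prob_present : ∀ e, P {ω | α e ω = true} = ENNReal.ofReal p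
  law_weight : ∀ e, HasLaw (v e) μ P
  indep_present_weight : ∀ e, IndepFun (α e) (v e) P
  indep_edges : iIndepFun (fun e ω => (α e ω, v e ω)) P

/-- The last-passage time `w_{i,j}`: the maximal weight of an increasing path from `i` to `j` all of
whose edges are present, and `-∞` if there is no such path. -/
noncomputable def passageTime {Ω : Type*} (α : Edge → Ω → Bool) (v : Edge → Ω → ℝ) (i j : ℤ)
    (ω : Ω) : EReal :=
  ⨆ (π : List Edge) (_ : IsPath i j π) (_ : ∀ e ∈ π, α e ω = true),
    (((π.map fun e => v e ω).sum : ℝ) : EReal)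

/-- The tail `1 - F` of the distribution function `F` of `μ` is regularly varying with index `s`:
`(1 - F (t x)) / (1 - F x) → t ^ (-s)` as `x → ∞`, for every `t > 0`. -/
def RegularlyVaryingTail (μ : Measure ℝ) (s : ℝ) : Prop :=
  ∀ t : ℝ, 0 < t →
    Tendsto (fun x : ℝ => (1 - cdf μ (t * x)) / (1 - cdf μ x)) atTop (𝓝 (t ^ (-s)))

/-- The generalized inverse `F^{(-1)}(u) = inf {x | u ≤ F x}` of the distribution function `F`
of `μ`. -/
noncomputable def cdfInv (μ : Measure ℝ) (u : ℝ) : ℝ :=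
  sInf {x : ℝ | u ≤ cdf μ x}

/-- The scaling constants `b_n = F^{(-1)}(1 - 1 / binom(n+1, 2))`. -/
noncomputable def scaling (μ : Measure ℝ) (n : ℕ) : ℝ :=
  cdfInv μ (1 - 1 / ((n + 1).choose 2 : ℝ))

/-- The variables driving the continuous model: `W k` exponential with mean one, `U k` and `V k`
uniform on `[0, 1]`, all of them independent. -/
structure IsContinuousModel {Ω : Type*} [MeasurableSpace Ω] (P : Measure Ω)
    (W U V : ℕ → Ω → ℝ) : Prop where
  law_W : ∀ k, HasLaw (W k) (expMeasure 1) P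
  law_U : ∀ k, HasLaw (U k) (volume.restrict (Set.Icc 0 1)) P
  law_V : ∀ k, HasLaw (V k) (volume.restrict (Set.Icc 0 1)) P
  indep : iIndepFun (Sum.elim W (Sum.elim U V)) P

/-- The weights `(W_1 + ⋯ + W_k) ^ (-1/s)`, with the index shifted to start at `k = 0`. -/
noncomputable def contWeight {Ω : Type*} (s : ℝ) (W : ℕ → Ω → ℝ) (k : ℕ) (ω : Ω) : ℝ :=
  (∑ i ∈ Finset.range (k + 1), W i ω) ^ (-(1 / s))

/-- The edge `(min (U_k, V_k), max (U_k, V_k))` of the continuous model. -/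
noncomputable def contEdge {Ω : Type*} (U V : ℕ → Ω → ℝ) (k : ℕ) (ω : Ω) : ℝ × ℝ :=
  (min (U k ω) (V k ω), max (U k ω) (V k ω))

/-- Two edges `(i, j)` and `(i', j')` are compatible if `j ≤ i'` or `j' ≤ i`. -/
def Compatible (x y : ℝ × ℝ) : Prop := x.2 ≤ y.1 ∨ y.2 ≤ x.1

/-- The admissible paths of the continuous model: the sets of indices of edges which are pairwise
compatible. -/
def admissible {Ω : Type*} (U V : ℕ → Ω → ℝ) (ω : Ω) : Set (Set ℕ) :=
  {A | A.Pairwise fun i j => Compatible (contEdge U V i ω) (contEdge U V j ω)}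

/-- The last-passage time `w` of the continuous model, with values in `[0, ∞]`. -/
noncomputable def contPassageTime {Ω : Type*} (s : ℝ) (W U V : ℕ → Ω → ℝ) (ω : Ω) : ℝ≥0∞ :=
  ⨆ A ∈ admissible U V ω, ∑' i : A, ENNReal.ofReal (contWeight s W i ω)

end LongRangeLPP

/-! The points `(min (U k) (V k), max (U k) (V k))`, arriving at the times `W 0 + ⋯ + W k`, form a
Poisson process, and this drives all the discrete models at once. Cut the unit interval into `n + 1`
equal pieces. The edge `(i, j)` of `{0, …, n}` owns a cell that each point hits with probability `2
/ (n + 1) ^ 2`. Hence the first hitting times `t_e` of these cells are independent exponentials of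
that rate, the numbers `exp (-2 t_e / (n + 1) ^ 2)` are independent uniforms, and a quantile
function turns them into i.i.d. weights of any given law (`measure_forall_notMem_killed`,
`map_coupledWeight`). The law used is that of a weight set to zero when its edge is absent
(`thinnedLaw`). By regular variation, a fixed arrival time `t` yields a weight asymptotic to `t ^
(-1 / s)` times `p ^ (1 / s) * b_n` (`tendsto_quantile`).

Lower bound: a finite compatible set of continuous edges becomes, for large `n`, a chain of discrete
edges with gaps proportional to `n` (`exists_separatedChain`). With high probability any two
vertices that far apart are joined by a two-step path of present edges, so the chain extends to a
path from `0` to `n` (`measureReal_not_isConnectedAtScale_le`, `exists_path`).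

Upper bound: a path is a chain of edges. Its large weights come from boundedly many points, whose
compatibility survives in the limit (`exists_compatible_of_chain`). Its small weights are negligible
uniformly in `n`: if an edge is long relative to its weight, it is controlled because lengths along
a chain add up to at most `n`; the remaining short edges have small total expectation
(`sum_small_le`, `lintegral_shortWeight_le`). This is where `s < 2` enters. The same estimate with
Fatou's lemma shows that `w` is finite. -/

namespace LongRangeLPP

/-! ### Tails and quantiles -/

/-- The tail `1 - F` of the distribution function of `μ`. -/
noncomputable def tail (μ : Measure ℝ) (x : ℝ) : ℝ := 1 - cdf μ x

lemma tail_antitone (μ : Measure ℝ) : Antitone (tail μ) := fun _ _ h =>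
  sub_le_sub_left (monotone_cdf μ h) 1

lemma tail_nonneg (μ : Measure ℝ) (x : ℝ) : 0 ≤ tail μ x := sub_nonneg.2 (cdf_le_one μ x)

lemma tail_le_one (μ : Measure ℝ) (x : ℝ) : tail μ x ≤ 1 := by
  have := cdf_nonneg μ x
  unfold tail
  linarith

lemma tail_eq_measureReal (μ : Measure ℝ) [IsProbabilityMeasure μ] (x : ℝ) :
    tail μ x = μ.real (Set.Ioi x) := by
  rw [tail, cdf_eq_real, ← probReal_compl_eq_one_sub measurableSet_Iic, Set.compl_Iic]

/-- The bounds `0 < u < 1` make the set bounded below and nonempty, so its `sInf` is a genuine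
infimum; right continuity of the distribution function shows that the infimum satisfies the
inequality. -/
lemma cdfInv_le_iff (μ : Measure ℝ) [IsProbabilityMeasure μ] {u x : ℝ} (h0 : 0 < u) (h1 : u < 1) :
    cdfInv μ u ≤ x ↔ u ≤ cdf μ x := by
  have hne : {x | u ≤ cdf μ x}.Nonempty :=
    ((tendsto_cdf_atTop μ).eventually (eventually_ge_nhds h1)).exists
  have hbdd : BddBelow {x | u ≤ cdf μ x} := by
    obtain ⟨y, hy⟩ := ((tendsto_cdf_atBot μ).eventually (eventually_lt_nhds h0)).exists
    exact ⟨y, fun z hz => le_of_not_gt fun hzy =>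
      absurd (hz.trans (monotone_cdf μ hzy.le)) (not_le.2 hy)⟩
  refine ⟨fun h => ?_, fun h => csInf_le hbdd h⟩
  have hc : Tendsto (cdf μ) (𝓝[>] x) (𝓝 (cdf μ x)) :=
    ((cdf μ).right_continuous x).mono_left (nhdsWithin_mono _ Set.Ioi_subset_Ici_self)
  refine ge_of_tendsto hc ?_
  filter_upwards [self_mem_nhdsWithin] with y hy
  obtain ⟨z, hz, hzy⟩ := exists_lt_of_csInf_lt hne (lt_of_le_of_lt h hy)
  exact le_trans hz (monotone_cdf μ hzy.le)

/-- The generalized inverse of the distribution function, set to `0` outside `(0, 1)`. -/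
noncomputable def quantile (μ : Measure ℝ) (u : ℝ) : ℝ :=
  open Classical in if u ∈ Set.Ioo 0 1 then cdfInv μ u else 0

lemma quantile_le_iff (μ : Measure ℝ) [IsProbabilityMeasure μ] {u x : ℝ} (h : u ∈ Set.Ioo 0 1) :
    quantile μ u ≤ x ↔ u ≤ cdf μ x := by
  rw [quantile, if_pos h, cdfInv_le_iff μ h.1 h.2]

lemma lt_quantile_iff (μ : Measure ℝ) [IsProbabilityMeasure μ] {u x : ℝ} (h : u ∈ Set.Ioo 0 1) :
    x < quantile μ u ↔ cdf μ x < u := by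
  simpa using (quantile_le_iff μ h (x := x)).not

lemma quantile_monotoneOn (μ : Measure ℝ) [IsProbabilityMeasure μ] :
    MonotoneOn (quantile μ) (Set.Ioo 0 1) := fun _ hu _ hv huv =>
  (quantile_le_iff μ hu).2 (huv.trans ((quantile_le_iff μ hv).1 le_rfl))

lemma measurable_quantile (μ : Measure ℝ) [IsProbabilityMeasure μ] : Measurable (quantile μ) := by
  refine measurable_of_Iic fun x => ?_
  have : quantile μ ⁻¹' Set.Iic x =
      (Set.Ioo 0 1 ∩ Set.Iic (cdf μ x)) ∪ ((Set.Ioo 0 1)ᶜ ∩ {_u | (0 : ℝ) ≤ x}) := by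
    ext u
    by_cases h : u ∈ Set.Ioo (0 : ℝ) 1
    · simp only [Set.mem_preimage, Set.mem_Iic, quantile_le_iff μ h, Set.mem_union, Set.mem_inter_iff,
        h, Set.mem_compl_iff, not_true_eq_false, false_and, or_false, true_and]
    · have hq : quantile μ u = 0 := if_neg h
      simp only [Set.mem_preimage, Set.mem_Iic, hq, Set.mem_union, Set.mem_inter_iff, h,
        Set.mem_compl_iff, not_false_eq_true, false_and, false_or, true_and, Set.mem_ofPred_eq]
  rw [this]
  exact (measurableSet_Ioo.inter measurableSet_Iic).union
    (measurableSet_Ioo.compl.inter (MeasurableSet.const _))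

/-- The default value `0` makes this true for every `u`, so the coupled weights below are
nonnegative everywhere and not just almost surely. -/
lemma quantile_nonneg {μ : Measure ℝ} [IsProbabilityMeasure μ] (h : μ (Set.Iio 0) = 0) (u : ℝ) :
    0 ≤ quantile μ u := by
  by_cases hu : u ∈ Set.Ioo (0 : ℝ) 1
  · by_contra hlt
    obtain ⟨x, hx1, hx2⟩ := exists_between (not_le.1 hlt)
    have h1 := (quantile_le_iff μ hu).1 hx1.le
    rw [cdf_eq_real, measureReal_def,
      measure_mono_null (Set.Iic_subset_Iio.2 hx2) h] at h1
    simp only [ENNReal.toReal_zero] at h1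
    exact absurd hu.1 (not_lt.2 h1)
  · rw [quantile, if_neg hu]

/-! ### Regularly varying tails and the scaling constants -/

section RegularVariation

variable {μ : Measure ℝ} {s : ℝ}

lemma RegularlyVaryingTail.tendsto_tail (hF : RegularlyVaryingTail μ s) {t : ℝ} (ht : 0 < t) :
    Tendsto (fun x => tail μ (t * x) / tail μ x) atTop (𝓝 (t ^ (-s))) := hF t ht

/-- If the tail vanished at `x` it would vanish beyond, and the ratio for `t = 1` would be `0 / 0 =
0` instead of tending to `1`. -/
lemma RegularlyVaryingTail.tail_pos (hF : RegularlyVaryingTail μ s) (x : ℝ) : 0 < tail μ x := by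
  refine (tail_nonneg μ x).lt_of_ne fun h => ?_
  have h0 : ∀ᶠ y in atTop, tail μ (1 * y) / tail μ y = 0 := by
    filter_upwards [eventually_ge_atTop x] with y hy
    rw [le_antisymm ((tail_antitone μ hy).trans h.ge) (tail_nonneg μ y), div_zero]
  have h1 := (hF.tendsto_tail one_pos).congr' h0
  simp at h1

lemma tendsto_choose_two : Tendsto (fun n : ℕ => ((n + 1).choose 2 : ℝ)) atTop atTop := by
  refine tendsto_atTop_mono' _ ?_ tendsto_natCast_atTop_atTop
  filter_upwards [eventually_ge_atTop 1] with n hn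
  have hn' : (1 : ℝ) ≤ n := by exact_mod_cast hn
  rw [Nat.cast_choose_two]
  push_cast
  nlinarith

lemma scaling_le_iff [IsProbabilityMeasure μ] {n : ℕ} (hn : 1 < ((n + 1).choose 2 : ℝ)) {x : ℝ} :
    scaling μ n ≤ x ↔ ((n + 1).choose 2 : ℝ) * tail μ x ≤ 1 := by
  have h0 : 1 / ((n + 1).choose 2 : ℝ) < 1 := (div_lt_one (by linarith)).2 hn
  have h1 : 0 < 1 / ((n + 1).choose 2 : ℝ) := by positivity
  rw [scaling, cdfInv_le_iff μ (by linarith) (by linarith), tail, mul_comm,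
    ← le_div_iff₀ (by linarith)]
  constructor <;> intro h <;> linarith

lemma RegularlyVaryingTail.tendsto_scaling [IsProbabilityMeasure μ]
    (hF : RegularlyVaryingTail μ s) : Tendsto (scaling μ) atTop atTop := by
  refine tendsto_atTop.2 fun K => ?_
  have h1 := tendsto_choose_two.atTop_mul_const (hF.tail_pos K)
  filter_upwards [h1.eventually_gt_atTop 1, tendsto_choose_two.eventually_gt_atTop 1] with n h h'
  exact (not_le.1 fun hle => absurd ((scaling_le_iff h').1 hle) (not_le.2 h)).le

/-- Since `F` may jump at `b_n`, the definition of `b_n` only gives the upper bound. For the lower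
one, the product exceeds `1` at `t * b_n` for every `t < 1`, and passing from `t * b_n` to `b_n`
costs a factor tending to `t ^ s`, which is close to `1`. -/
lemma RegularlyVaryingTail.tendsto_choose_mul_tail_scaling [IsProbabilityMeasure μ]
    (hF : RegularlyVaryingTail μ s) :
    Tendsto (fun n : ℕ => ((n + 1).choose 2 : ℝ) * tail μ (scaling μ n)) atTop (𝓝 1) := by
  have hlt : ∀ᶠ n : ℕ in atTop, 1 < ((n + 1).choose 2 : ℝ) :=
    tendsto_choose_two.eventually_gt_atTop 1
  refine tendsto_order.2 ⟨fun a ha => ?_, fun a ha => ?_⟩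
  · have hc : Tendsto (fun t : ℝ => (t ^ (-s))⁻¹) (𝓝[<] 1) (𝓝 1) := by
      have : ContinuousAt (fun t : ℝ => (t ^ (-s))⁻¹) 1 :=
        (Real.continuousAt_rpow_const 1 (-s) (Or.inl one_ne_zero)).inv₀ (by simp)
      have h := this.tendsto.mono_left (nhdsWithin_le_nhds (s := Set.Iio 1))
      simpa using h
    obtain ⟨t, ⟨hta, ht0⟩, ht1⟩ := ((hc.eventually (eventually_gt_nhds ha)).and
      (mem_of_superset (Ioo_mem_nhdsLT (zero_lt_one (α := ℝ))) fun x hx => hx.1)).and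
      self_mem_nhdsWithin |>.exists
    have hlim := ((hF.tendsto_tail ht0).comp hF.tendsto_scaling).inv₀
      (Real.rpow_pos_of_pos ht0 _).ne'
    filter_upwards [hlim.eventually (eventually_gt_nhds hta), hlt,
      hF.tendsto_scaling.eventually_gt_atTop 0] with n h1 h2 h3
    have h4 : 1 < ((n + 1).choose 2 : ℝ) * tail μ (t * scaling μ n) := by
      refine not_le.1 fun hle => ?_
      have := (scaling_le_iff h2).2 hle
      have ht1' : t < 1 := ht1
      nlinarith
    simp only [Function.comp_apply, inv_div] at h1
    have hp := hF.tail_pos (t * scaling μ n)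
    rw [lt_div_iff₀ hp] at h1
    refine lt_of_mul_lt_mul_right ?_ hp.le
    have := mul_le_mul_of_nonneg_left h4.le (tail_nonneg μ (scaling μ n))
    nlinarith
  · filter_upwards [hlt] with n h2
    exact ((scaling_le_iff h2).1 le_rfl).trans_lt ha

lemma RegularlyVaryingTail.tendsto_choose_mul_tail [IsProbabilityMeasure μ]
    (hF : RegularlyVaryingTail μ s) {x : ℝ} (hx : 0 < x) :
    Tendsto (fun n : ℕ => ((n + 1).choose 2 : ℝ) * tail μ (x * scaling μ n)) atTop
      (𝓝 (x ^ (-s))) := by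
  have h := hF.tendsto_choose_mul_tail_scaling.mul ((hF.tendsto_tail hx).comp hF.tendsto_scaling)
  rw [one_mul] at h
  refine h.congr fun n => ?_
  have := (hF.tail_pos (scaling μ n)).ne'
  simp only [Function.comp_apply]
  field_simp

/-- **Potter's bound** for a regularly varying tail. -/
lemma RegularlyVaryingTail.exists_potter (hF : RegularlyVaryingTail μ s) {s' : ℝ} (hs : s < s')
    (hs0 : 0 < s) :
    ∃ x₀ > 0, ∀ x y, x₀ ≤ x → x ≤ y → tail μ x ≤ 2 ^ s' * (y / x) ^ s' * tail μ y := by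
  -- Beyond some `x₀` each doubling of the argument costs at most a factor `2 ^ s'`. Iterating along
  -- powers of two gives the bound; the extra `2 ^ s'` pays for rounding `y / x` up to a power of
  -- two.
  have h2 : (2 : ℝ) ^ (-s') < 2 ^ (-s) := Real.rpow_lt_rpow_of_exponent_lt one_lt_two (by linarith)
  obtain ⟨x₀, hx₀⟩ := eventually_atTop.1
    ((hF.tendsto_tail two_pos).eventually (eventually_gt_nhds h2))
  have hstep : ∀ x, x₀ ≤ x → tail μ x ≤ 2 ^ s' * tail μ (2 * x) := by
    intro x hx
    have h := hx₀ x hx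
    rw [lt_div_iff₀ (hF.tail_pos x), Real.rpow_neg two_pos.le,
      inv_mul_lt_iff₀ (Real.rpow_pos_of_pos two_pos _)] at h
    exact h.le
  refine ⟨max x₀ 1, by positivity, fun x y hx hxy => ?_⟩
  have hx1 : 1 ≤ x := (le_max_right _ _).trans hx
  have hxx : x₀ ≤ x := (le_max_left _ _).trans hx
  have hiter : ∀ k : ℕ, tail μ x ≤ (2 ^ s') ^ k * tail μ (2 ^ k * x) := by
    intro k
    induction k with
    | zero => simp
    | succ k ih =>
      refine ih.trans ?_
      have hk : x₀ ≤ 2 ^ k * x := hxx.trans (le_mul_of_one_le_left (by linarith)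
        (one_le_pow₀ one_le_two))
      have := mul_le_mul_of_nonneg_left (hstep _ hk)
        (pow_nonneg (Real.rpow_nonneg two_pos.le s') k)
      refine this.trans_eq ?_
      rw [pow_succ, pow_succ, mul_assoc]
      congr 3
      ring
  obtain ⟨k, hk1, hk2⟩ := exists_nat_pow_near ((one_le_div (by linarith)).2 hxy) one_lt_two
  have hy : y ≤ 2 ^ (k + 1) * x := ((div_lt_iff₀ (by linarith)).1 hk2).le
  refine (hiter (k + 1)).trans (mul_le_mul ?_ (tail_antitone μ hy) (tail_nonneg _ _) ?_)
  swap
  · have : 0 ≤ y / x := div_nonneg (by linarith) (by linarith)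
    positivity
  rw [pow_succ, mul_comm]
  refine mul_le_mul_of_nonneg_left ?_ (by positivity)
  rw [← Real.rpow_natCast, ← Real.rpow_mul two_pos.le, mul_comm s', Real.rpow_mul two_pos.le,
    Real.rpow_natCast]
  exact Real.rpow_le_rpow (by positivity) hk1 (by linarith)

end RegularVariation

/-! ### Thinned weights and asymptotics of their quantiles -/

/-- The law of a weight which is set to zero with probability `1 - p`. -/
noncomputable def thinnedLaw (p : ℝ) (μ : Measure ℝ) : Measure ℝ :=
  ENNReal.ofReal p • μ + ENNReal.ofReal (1 - p) • Measure.dirac 0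

lemma isProbabilityMeasure_thinnedLaw {p : ℝ} (hp0 : 0 ≤ p) (hp1 : p ≤ 1) (μ : Measure ℝ)
    [IsProbabilityMeasure μ] : IsProbabilityMeasure (thinnedLaw p μ) := by
  constructor
  simp only [thinnedLaw, Measure.coe_add, Measure.coe_smul, Pi.add_apply, Pi.smul_apply,
    measure_univ, smul_eq_mul, mul_one]
  rw [← ENNReal.ofReal_add hp0 (by linarith)]
  simp

lemma tail_thinnedLaw {p : ℝ} (hp0 : 0 ≤ p) (hp1 : p ≤ 1) (μ : Measure ℝ)
    [IsProbabilityMeasure μ] {x : ℝ} (hx : 0 ≤ x) : tail (thinnedLaw p μ) x = p * tail μ x := by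
  have := isProbabilityMeasure_thinnedLaw hp0 hp1 μ
  rw [tail_eq_measureReal, tail_eq_measureReal, measureReal_def, measureReal_def]
  simp [thinnedLaw, hp0, hx]

/-- A law on `[0, ∞)` and scaling constants `b n` for which `n ^ 2` times the rescaled tail
converges to `2 * x ^ (-s)`, with Potter bounds. -/
structure IsTailScaling (ρ : Measure ℝ) (b : ℕ → ℝ) (s : ℝ) : Prop where
  neg_null : ρ (Set.Iio 0) = 0
  tendsto_atTop : Tendsto b atTop atTop
  tendsto_tail : ∀ x, 0 < x →
    Tendsto (fun n : ℕ => (n : ℝ) ^ 2 * tail ρ (x * b n)) atTop (𝓝 (2 * x ^ (-s)))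
  potter : ∀ s', s < s' → ∃ C, 0 ≤ C ∧ ∀ᶠ n : ℕ in atTop, ∀ x, 0 < x → x ≤ 1 →
    (n : ℝ) ^ 2 * tail ρ (x * b n) ≤ C * x ^ (-s')

lemma tendsto_sq_div_choose_two :
    Tendsto (fun n : ℕ => (n : ℝ) ^ 2 / ((n + 1).choose 2 : ℝ)) atTop (𝓝 2) := by
  have h := (tendsto_natCast_div_add_atTop (1 : ℝ)).const_mul 2
  rw [mul_one] at h
  refine h.congr' ?_
  filter_upwards [eventually_ge_atTop 1] with n hn
  have hn' : (0 : ℝ) < n := by exact_mod_cast hn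
  rw [Nat.cast_choose_two]
  push_cast
  rw [add_sub_cancel_right]
  field_simp

/-- Thinning multiplies the tail by `p`, and rescaling by `p ^ (1 / s)` cancels this because `(p ^
(1 / s)) ^ (-s) = p⁻¹`. This is the source of the factor `p ^ (-1 / s)` in the theorem. -/
lemma isTailScaling_thinnedLaw {p s : ℝ} (hp0 : 0 < p) (hp1 : p ≤ 1) (hs0 : 0 < s)
    (μ : Measure ℝ) [IsProbabilityMeasure μ] (hμpos : ∀ᵐ x ∂μ, 0 < x)
    (hF : RegularlyVaryingTail μ s) :
    IsTailScaling (thinnedLaw p μ) (fun n => p ^ (1 / s) * scaling μ n) s := by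
  have hq : 0 < p ^ (1 / s) := Real.rpow_pos_of_pos hp0 _
  have hb : Tendsto (fun n => p ^ (1 / s) * scaling μ n) atTop atTop :=
    hF.tendsto_scaling.const_mul_atTop hq
  have hlim : ∀ x, 0 < x → Tendsto (fun n : ℕ => (n : ℝ) ^ 2 *
      tail (thinnedLaw p μ) (x * (p ^ (1 / s) * scaling μ n))) atTop (𝓝 (2 * x ^ (-s))) := by
    intro x hx
    have h := (tendsto_sq_div_choose_two.mul
      (hF.tendsto_choose_mul_tail (mul_pos hx hq))).const_mul p
    have e : p * (2 * (x * p ^ (1 / s)) ^ (-s)) = 2 * x ^ (-s) := by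
      rw [Real.mul_rpow hx.le hq.le, ← Real.rpow_mul hp0.le]
      have : 1 / s * -s = -1 := by field_simp
      rw [this, Real.rpow_neg_one]
      field_simp
    rw [e] at h
    refine h.congr' ?_
    filter_upwards [hF.tendsto_scaling.eventually_ge_atTop 0,
      tendsto_choose_two.eventually_gt_atTop 0] with n hn hn'
    rw [tail_thinnedLaw hp0.le hp1 μ (by positivity), mul_assoc x]
    field_simp
  refine ⟨?_, hb, hlim, fun s' hs' => ?_⟩
  · have : μ (Set.Iio 0) = 0 := by
      refine measure_mono_null (fun x hx => ?_) hμpos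
      exact not_lt.2 (Set.mem_Iio.1 hx).le
    simp [thinnedLaw, this]
  · obtain ⟨x₀, hx₀, hP⟩ := hF.exists_potter hs' hs0
    have hs'0 : 0 < s' := hs0.trans hs'
    have hG : 0 < p * tail μ x₀ := mul_pos hp0 (hF.tail_pos x₀)
    have hG1 : p * tail μ x₀ ≤ 1 := mul_le_one₀ hp1 (tail_nonneg _ _) (tail_le_one _ _)
    -- The `3` bounds `n ^ 2` times the tail at `b n`, whose limit is `2`; the `2 ^ s'` is Potter's
    -- constant.
    set D : ℝ := 3 * 2 ^ s' with hD
    have hD0 : 0 < D := by positivity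
    refine ⟨D / (p * tail μ x₀), by positivity, ?_⟩
    have h1 := hlim 1 one_pos
    simp only [one_mul, Real.one_rpow, mul_one] at h1
    filter_upwards [h1.eventually (eventually_le_nhds (by norm_num : (2 : ℝ) < 3)),
      hb.eventually_ge_atTop x₀] with n hn hbn x hx0 hx1
    set b := p ^ (1 / s) * scaling μ n with hbdef
    have hb0 : 0 < b := hx₀.trans_le hbn
    rw [tail_thinnedLaw hp0.le hp1 μ hb0.le] at hn
    have key : ∀ y, x₀ ≤ y * b → 0 < y → y ≤ 1 →
        (n : ℝ) ^ 2 * (p * tail μ (y * b)) ≤ D * y ^ (-s') := by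
      intro y hy hy0 hy1
      have h := hP (y * b) b hy (mul_le_of_le_one_left hb0.le hy1)
      have e : b / (y * b) = y⁻¹ := by field_simp
      rw [e, Real.inv_rpow hy0.le, ← Real.rpow_neg hy0.le] at h
      have hy' : 0 ≤ y ^ (-s') := Real.rpow_nonneg hy0.le _
      calc (n : ℝ) ^ 2 * (p * tail μ (y * b))
          ≤ (n : ℝ) ^ 2 * (p * (2 ^ s' * y ^ (-s') * tail μ b)) := by gcongr
        _ = (n : ℝ) ^ 2 * (p * tail μ b) * (2 ^ s' * y ^ (-s')) := by ring
        _ ≤ 3 * (2 ^ s' * y ^ (-s')) := by gcongr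
        _ = D * y ^ (-s') := by rw [hD]; ring
    rw [tail_thinnedLaw hp0.le hp1 μ (by positivity)]
    have hDle : D ≤ D / (p * tail μ x₀) := le_div_self hD0.le hG hG1
    have hxs : 0 ≤ x ^ (-s') := Real.rpow_nonneg hx0.le _
    rcases le_or_gt x₀ (x * b) with hxb | hxb
    · exact (key x hxb hx0 hx1).trans (mul_le_mul_of_nonneg_right hDle hxs)
    -- Below `x₀` Potter's bound is not available. There the tail is bounded by `1`, and the bound
    -- at `x₀ / b`, divided by the tail at `x₀`, shows that `n ^ 2` is already small enough.
    · have hy := key (x₀ / b) (by rw [div_mul_cancel₀ _ hb0.ne']) (by positivity)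
        ((div_le_one hb0).2 hbn)
      rw [div_mul_cancel₀ _ hb0.ne'] at hy
      have hmono : (x₀ / b) ^ (-s') ≤ x ^ (-s') :=
        Real.rpow_le_rpow_of_nonpos hx0 ((lt_div_iff₀ hb0).2 hxb).le (by linarith)
      have h3 : (n : ℝ) ^ 2 ≤ D / (p * tail μ x₀) * (x₀ / b) ^ (-s') := by
        rw [div_mul_eq_mul_div, le_div_iff₀ hG]
        exact hy
      calc (n : ℝ) ^ 2 * (p * tail μ (x * b)) ≤ (n : ℝ) ^ 2 * 1 := by
            gcongr
            exact mul_le_one₀ hp1 (tail_nonneg _ _) (tail_le_one _ _)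
        _ ≤ D / (p * tail μ x₀) * (x₀ / b) ^ (-s') := by rw [mul_one]; exact h3
        _ ≤ _ := by gcongr

/-- The quantile at level `exp (-2 t / (n + 1) ^ 2)` is asymptotically `t ^ (-1 / s) * b n`. -/
lemma IsTailScaling.tendsto_quantile {ρ : Measure ℝ} [IsProbabilityMeasure ρ] {b : ℕ → ℝ} {s : ℝ}
    (h : IsTailScaling ρ b s) (hs : 0 < s) {t : ℝ} (ht : 0 < t) :
    Tendsto (fun n : ℕ => quantile ρ (Real.exp (-(2 / ((n : ℝ) + 1) ^ 2 * t))) / b n) atTop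
      (𝓝 (t ^ (-(1 / s)))) := by
  have hz : Tendsto (fun n : ℕ => -(2 / ((n : ℝ) + 1) ^ 2 * t)) atTop (𝓝[≠] 0) := by
    refine tendsto_nhdsWithin_iff.2 ⟨?_, Eventually.of_forall fun n => ?_⟩
    · have h1 : Tendsto (fun n : ℕ => (1 : ℝ) / ((n : ℝ) + 1)) atTop (𝓝 0) :=
        tendsto_one_div_add_atTop_nhds_zero_nat
      have h2 := ((h1.pow 2).const_mul (-(2 * t)))
      simp only [ne_eq, OfNat.ofNat_ne_zero, not_false_eq_true, zero_pow, mul_zero] at h2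
      refine h2.congr fun n => ?_
      field_simp
    · simp only [Set.mem_compl_iff, Set.mem_singleton_iff]
      have : (0 : ℝ) < 2 / ((n : ℝ) + 1) ^ 2 * t := by positivity
      linarith
  have hexp : Tendsto (fun n : ℕ => (n : ℝ) ^ 2 *
      (1 - Real.exp (-(2 / ((n : ℝ) + 1) ^ 2 * t)))) atTop (𝓝 (2 * t)) := by
    have hd := (Real.hasDerivAt_exp 0).tendsto_slope
    have h1 := hd.comp hz
    rw [Real.exp_zero] at h1
    have h2 := (((tendsto_natCast_div_add_atTop (1 : ℝ)).pow 2).mul h1).const_mul (2 * t)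
    simp only [one_pow, mul_one] at h2
    refine h2.congr fun n => ?_
    simp only [Function.comp_apply, slope_def_field, Real.exp_zero]
    have : (n : ℝ) + 1 ≠ 0 := by positivity
    field_simp
    ring
  have hmem : ∀ n : ℕ, Real.exp (-(2 / ((n : ℝ) + 1) ^ 2 * t)) ∈ Set.Ioo (0 : ℝ) 1 := fun n =>
    ⟨Real.exp_pos _, by
      rw [Real.exp_lt_one_iff]
      have : (0 : ℝ) < 2 / ((n : ℝ) + 1) ^ 2 * t := by positivity
      linarith⟩
  have hpow : (t ^ (-(1 / s))) ^ (-s) = t := by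
    rw [← Real.rpow_mul ht.le]
    have : -(1 / s) * -s = 1 := by field_simp
    rw [this, Real.rpow_one]
  have htp : 0 < t ^ (-(1 / s)) := Real.rpow_pos_of_pos ht _
  -- Whether the quantile exceeds `x * b n` is decided by the sign of this difference. Its rescaled
  -- limit `2 * x ^ (-s) - 2 * t` changes sign exactly at `x = t ^ (-(1 / s))`.
  have hmain : ∀ x, 0 < x → Tendsto (fun n : ℕ => (n : ℝ) ^ 2 * (tail ρ (x * b n) -
      (1 - Real.exp (-(2 / ((n : ℝ) + 1) ^ 2 * t))))) atTop (𝓝 (2 * x ^ (-s) - 2 * t)) := by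
    intro x hx
    refine ((h.tendsto_tail x hx).sub hexp).congr fun n => ?_
    ring
  refine tendsto_order.2 ⟨fun a ha => ?_, fun a ha => ?_⟩
  · obtain ⟨x, hx1, hx2⟩ := exists_between (max_lt ha htp)
    have hx0 : 0 < x := (le_max_right _ _).trans_lt hx1
    have hlt : t < x ^ (-s) := by
      rw [← hpow]
      exact Real.rpow_lt_rpow_of_neg hx0 hx2 (by linarith)
    filter_upwards [(hmain x hx0).eventually (eventually_gt_nhds (b := 0) (by linarith)),
      h.tendsto_atTop.eventually_gt_atTop 0] with n hn hb
    have h1 := pos_of_mul_pos_right hn (sq_nonneg _)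
    have h2 : x * b n < quantile ρ (Real.exp (-(2 / ((n : ℝ) + 1) ^ 2 * t))) := by
      rw [lt_quantile_iff ρ (hmem n)]
      unfold tail at h1
      linarith
    exact ((le_max_left _ _).trans_lt hx1).trans ((lt_div_iff₀ hb).2 h2)
  · obtain ⟨x, hx1, hx2⟩ := exists_between ha
    have hx0 : 0 < x := htp.trans hx1
    have hlt : x ^ (-s) < t := by
      rw [← hpow]
      exact Real.rpow_lt_rpow_of_neg htp hx1 (by linarith)
    filter_upwards [(hmain x hx0).eventually (eventually_lt_nhds (b := 0) (by linarith)),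
      h.tendsto_atTop.eventually_gt_atTop 0] with n hn hb
    have h1 : tail ρ (x * b n) - (1 - Real.exp (-(2 / ((n : ℝ) + 1) ^ 2 * t))) < 0 := by
      by_contra hcon
      exact absurd hn (not_lt.2 (mul_nonneg (sq_nonneg _) (not_lt.1 hcon)))
    have h2 : quantile ρ (Real.exp (-(2 / ((n : ℝ) + 1) ^ 2 * t))) ≤ x * b n := by
      rw [quantile_le_iff ρ (hmem n)]
      unfold tail at h1
      linarith
    exact ((div_le_iff₀ hb).2 h2).trans_lt hx2

/-! ### Criteria for limits of probabilities and for convergence in distribution -/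

section Limits

variable {Ω : Type*} [MeasurableSpace Ω] {P : Measure Ω} [IsProbabilityMeasure P]

/-- The index `j` depends on `ω`, but monotonicity in `j` allows a single one outside probability
`ε`: use `m` both as index and as starting time, and the sets `T m` increase to a set that contains
`C` almost surely. Continuity from below needs no measurability here. -/
lemma exists_eventually_measureReal_ge {C : Set Ω} {E : ℕ → ℕ → Set Ω}
    (hmono : ∀ n, Monotone fun j => E j n)
    (hE : ∀ᵐ ω ∂P, ω ∈ C → ∃ j, ∀ᶠ n in atTop, ω ∈ E j n) {ε : ℝ} (hε : 0 < ε) :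
    ∃ j, ∀ᶠ n in atTop, P.real C - ε ≤ P.real (E j n) := by
  let T : ℕ → Set Ω := fun m => ⋂ n, ⋂ (_ : m ≤ n), E m n
  have hT : Monotone T := fun m m' hm ω hω => by
    simp only [T, Set.mem_iInter] at hω ⊢
    exact fun n hn => hmono n hm (hω n (hm.trans hn))
  have hC : P C ≤ P (⋃ m, T m) := by
    refine measure_mono_ae ?_
    filter_upwards [hE] with ω hω hωC
    obtain ⟨j, hj⟩ := hω hωC
    obtain ⟨m, hm⟩ := eventually_atTop.1 hj
    refine Set.mem_iUnion.2 ⟨max j m, ?_⟩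
    simp only [T, Set.mem_iInter]
    exact fun n hn => hmono n (le_max_left _ _) (hm n ((le_max_right _ _).trans hn))
  have hlim : Tendsto (fun m => P.real (T m)) atTop (𝓝 (P.real (⋃ m, T m))) :=
    (ENNReal.tendsto_toReal (measure_ne_top _ _)).comp (tendsto_measure_iUnion_atTop hT)
  have hC' : P.real C ≤ P.real (⋃ m, T m) := ENNReal.toReal_mono (measure_ne_top _ _) hC
  obtain ⟨j, hj⟩ := (hlim.eventually (eventually_gt_nhds
    (show P.real (⋃ m, T m) - ε < P.real (⋃ m, T m) by linarith))).exists
  refine ⟨j, ?_⟩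
  filter_upwards [eventually_ge_atTop j] with n hn
  have : P.real (T j) ≤ P.real (E j n) := measureReal_mono (Set.iInter₂_subset n hn)
  linarith

/-- This is the previous lemma for complements, with events that do not depend on `j`. -/
lemma eventually_measureReal_le {C : Set Ω} {D : ℕ → Set Ω}
    (hD : ∀ n, NullMeasurableSet (D n) P)
    (h : ∀ᵐ ω ∂P, (∃ᶠ n in atTop, ω ∈ D n) → ω ∈ C) {ε : ℝ} (hε : 0 < ε) :
    ∀ᶠ n in atTop, P.real (D n) ≤ P.real C + ε := by
  obtain ⟨_, hj⟩ := exists_eventually_measureReal_ge (P := P) (C := Cᶜ) (E := fun _ n => (D n)ᶜ)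
    (fun n => monotone_const) (by
      filter_upwards [h] with ω hω hωC
      exact ⟨0, by
        have := mt hω hωC
        rwa [not_frequently] at this⟩) hε
  filter_upwards [hj] with n hn
  have h1 : P.real (D n)ᶜ = 1 - P.real (D n) := probReal_compl_eq_one_sub₀ (hD n)
  have h2 : 1 ≤ P.real C + P.real Cᶜ := by
    rw [← probReal_univ (μ := P), ← Set.union_compl_self C]
    exact measureReal_union_le _ _
  linarith

end Limits

/-- At a real point that is not an atom of the limit the two bounds pinch the probabilities of both
rays. Atoms are countably many, so the intervals and rays with non-atomic end points still form a
π-system containing small neighbourhoods of every point, including `⊥` and `⊤`. -/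
lemma tendsto_probabilityMeasure_ereal {ν : ℕ → ProbabilityMeasure EReal}
    {ν' : ProbabilityMeasure EReal}
    (hlow : ∀ (x : ℝ) (ε : ℝ), 0 < ε → ∀ᶠ n in atTop, (ν' : Measure EReal).real (Set.Ioi (x : EReal)) - ε
      ≤ (ν n : Measure EReal).real (Set.Ioi (x : EReal)))
    (hup : ∀ (x : ℝ) (ε : ℝ), 0 < ε → ∀ᶠ n in atTop, (ν n : Measure EReal).real (Set.Ici (x : EReal))
      ≤ (ν' : Measure EReal).real (Set.Ici (x : EReal)) + ε) :
    Tendsto ν atTop (𝓝 ν') := by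
  set m : ℕ → Measure EReal := fun n => (ν n : Measure EReal) with hm
  set m' : Measure EReal := (ν' : Measure EReal) with hm'
  let D : Set ℝ := {x | m' {(x : EReal)} = 0}
  have hDc : Dᶜ.Countable := by
    have := Measure.countable_meas_level_set_pos (μ := m') (measurable_id (α := EReal))
    refine (this.preimage EReal.coe_injective).mono fun x hx => ?_
    simp only [Set.mem_preimage]
    exact pos_iff_ne_zero.2 hx
  have hdense : Dense D := by
    have := hDc.dense_compl ℝ
    rwa [compl_compl] at this
  have hatom : ∀ x ∈ D, m'.real (Set.Ici (x : EReal)) = m'.real (Set.Ioi (x : EReal)) := by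
    intro x hx
    have : Set.Ici (x : EReal) = {(x : EReal)} ∪ Set.Ioi (x : EReal) := by
      rw [Set.union_comm, Set.Ioi_union_left]
    refine le_antisymm ?_ (measureReal_mono Set.Ioi_subset_Ici_self)
    rw [this]
    refine (measureReal_union_le _ _).trans ?_
    rw [measureReal_def, show m' {(x : EReal)} = 0 from hx]
    simp
  have hIoi : ∀ x ∈ D, Tendsto (fun n => (m n).real (Set.Ioi (x : EReal))) atTop
      (𝓝 (m'.real (Set.Ioi (x : EReal)))) := by
    intro x hx
    refine tendsto_order.2 ⟨fun a ha => ?_, fun a ha => ?_⟩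
    · filter_upwards [hlow x ((m'.real (Set.Ioi (x : EReal)) - a) / 2) (by linarith)] with n hn
      linarith
    · filter_upwards [hup x ((a - m'.real (Set.Ioi (x : EReal))) / 2) (by linarith)] with n hn
      rw [hatom x hx] at hn
      have : (m n).real (Set.Ioi (x : EReal)) ≤ (m n).real (Set.Ici (x : EReal)) :=
        measureReal_mono Set.Ioi_subset_Ici_self
      linarith
  have hIio : ∀ x ∈ D, Tendsto (fun n => (m n).real (Set.Iio (x : EReal))) atTop
      (𝓝 (m'.real (Set.Iio (x : EReal)))) := by
    intro x hx
    have hc : ∀ κ : Measure EReal, IsProbabilityMeasure κ →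
        κ.real (Set.Iio (x : EReal)) = 1 - κ.real (Set.Ici (x : EReal)) := fun κ _ => by
      rw [← probReal_compl_eq_one_sub measurableSet_Ici, Set.compl_Ici]
    have hIci : Tendsto (fun n => (m n).real (Set.Ici (x : EReal))) atTop
        (𝓝 (m'.real (Set.Ici (x : EReal)))) := by
      rw [hatom x hx]
      refine tendsto_order.2 ⟨fun a ha => ?_, fun a ha => ?_⟩
      · filter_upwards [hlow x ((m'.real (Set.Ioi (x : EReal)) - a) / 2) (by linarith)] with n hn
        have : (m n).real (Set.Ioi (x : EReal)) ≤ (m n).real (Set.Ici (x : EReal)) :=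
          measureReal_mono Set.Ioi_subset_Ici_self
        linarith
      · filter_upwards [hup x ((a - m'.real (Set.Ioi (x : EReal))) / 2) (by linarith)] with n hn
        rw [hatom x hx] at hn
        linarith
    rw [hc m' inferInstance]
    refine (hIci.const_sub 1).congr fun n => (hc (m n) inferInstance).symm
  let 𝓛 : Set (Set EReal) := insert Set.univ ((fun x : ℝ => Set.Ioi (x : EReal)) '' D)
  let 𝓤 : Set (Set EReal) := insert Set.univ ((fun x : ℝ => Set.Iio (x : EReal)) '' D)
  let S : Set (Set EReal) := {s | ∃ L ∈ 𝓛, ∃ U ∈ 𝓤, s = L ∩ U}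
  have hLlim : ∀ L ∈ 𝓛, MeasurableSet L ∧
      Tendsto (fun n => (m n).real L) atTop (𝓝 (m'.real L)) := by
    rintro L (rfl | ⟨x, hx, rfl⟩)
    · simp [hm, hm']
    · exact ⟨measurableSet_Ioi, hIoi x hx⟩
  have hUlim : ∀ U ∈ 𝓤, MeasurableSet U ∧
      Tendsto (fun n => (m n).real U) atTop (𝓝 (m'.real U)) := by
    rintro L (rfl | ⟨x, hx, rfl⟩)
    · simp [hm, hm']
    · exact ⟨measurableSet_Iio, hIio x hx⟩
  have hLinter : ∀ L ∈ 𝓛, ∀ L' ∈ 𝓛, L ∩ L' ∈ 𝓛 := by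
    rintro L (rfl | ⟨x, hx, rfl⟩) L' (rfl | ⟨y, hy, rfl⟩)
    · simp [𝓛]
    · rw [Set.univ_inter]; exact Or.inr ⟨y, hy, rfl⟩
    · rw [Set.inter_univ]; exact Or.inr ⟨x, hx, rfl⟩
    · refine Or.inr ⟨max x y, by rcases max_choice x y with h | h <;> rwa [h], ?_⟩
      simp only [Set.Ioi_inter_Ioi]
      rw [EReal.coe_strictMono.monotone.map_max]
  have hUinter : ∀ L ∈ 𝓤, ∀ L' ∈ 𝓤, L ∩ L' ∈ 𝓤 := by
    rintro L (rfl | ⟨x, hx, rfl⟩) L' (rfl | ⟨y, hy, rfl⟩)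
    · simp [𝓤]
    · rw [Set.univ_inter]; exact Or.inr ⟨y, hy, rfl⟩
    · rw [Set.inter_univ]; exact Or.inr ⟨x, hx, rfl⟩
    · refine Or.inr ⟨min x y, by rcases min_choice x y with h | h <;> rwa [h], ?_⟩
      simp only [Set.Iio_inter_Iio]
      rw [EReal.coe_strictMono.monotone.map_min]
  -- Thanks to this dichotomy the measure of `L ∩ U` is either zero or given by inclusion–exclusion
  -- from those of `L` and `U`.
  have hdich : ∀ L ∈ 𝓛, ∀ U ∈ 𝓤, L ∩ U = ∅ ∨ L ∪ U = Set.univ := by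
    rintro L (rfl | ⟨x, hx, rfl⟩) U (rfl | ⟨y, hy, rfl⟩)
    · simp
    · simp
    · simp
    · rcases lt_or_ge x y with h | h
      · right
        rw [Set.union_comm]
        exact Set.Iio_union_Ioi_of_lt (EReal.coe_lt_coe_iff.2 h)
      · left
        ext z
        simp only [Set.mem_inter_iff, Set.mem_Ioi, Set.mem_Iio, Set.mem_empty_iff_false, iff_false,
          not_and, not_lt]
        exact fun hz => (EReal.coe_le_coe_iff.2 h).trans hz.le
  have hSpi : IsPiSystem S := by
    rintro _ ⟨L, hL, U, hU, rfl⟩ _ ⟨L', hL', U', hU', rfl⟩ -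
    exact ⟨L ∩ L', hLinter L hL L' hL', U ∩ U', hUinter U hU U' hU', Set.inter_inter_inter_comm _ _ _ _⟩
  refine hSpi.tendsto_probabilityMeasure_of_tendsto_of_mem ?_ ?_ ?_
  · rintro _ ⟨L, hL, U, hU, rfl⟩
    exact (hLlim L hL).1.inter (hUlim U hU).1
  · intro u hu y hy
    have hlow' : ∀ a : EReal, a < y → ∃ x ∈ D, a < (x : EReal) ∧ (x : EReal) < y := by
      intro a ha
      obtain ⟨r, hr1, hr2⟩ := EReal.lt_iff_exists_real_btwn.1 ha
      obtain ⟨r', hr1', hr2'⟩ := EReal.lt_iff_exists_real_btwn.1 hr2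
      obtain ⟨x, hx, h1, h2⟩ := hdense.exists_between (EReal.coe_lt_coe_iff.1 hr1')
      exact ⟨x, hx, hr1.trans (EReal.coe_lt_coe_iff.2 h1), (EReal.coe_lt_coe_iff.2 h2).trans hr2'⟩
    have hup' : ∀ a : EReal, y < a → ∃ x ∈ D, y < (x : EReal) ∧ (x : EReal) < a := by
      intro a ha
      obtain ⟨r, hr1, hr2⟩ := EReal.lt_iff_exists_real_btwn.1 ha
      obtain ⟨r', hr1', hr2'⟩ := EReal.lt_iff_exists_real_btwn.1 hr2
      obtain ⟨x, hx, h1, h2⟩ := hdense.exists_between (EReal.coe_lt_coe_iff.1 hr1')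
      exact ⟨x, hx, hr1.trans (EReal.coe_lt_coe_iff.2 h1), (EReal.coe_lt_coe_iff.2 h2).trans hr2'⟩
    have hmem := hu.mem_nhds hy
    have hL : ∃ L ∈ 𝓛, L ∈ 𝓝 y ∧ ∃ U ∈ 𝓤, U ∈ 𝓝 y ∧ L ∩ U ⊆ u := by
      rcases eq_or_ne y ⊥ with rfl | hbot
      · obtain ⟨z, hz⟩ := EReal.mem_nhds_bot_iff.1 hmem
        obtain ⟨x, hx, h1, h2⟩ := hup' z (EReal.bot_lt_coe z)
        exact ⟨Set.univ, Or.inl rfl, univ_mem, Set.Iio x, Or.inr ⟨x, hx, rfl⟩, Iio_mem_nhds h1,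
          fun t ht => hz (lt_trans ht.2 h2)⟩
      · rcases eq_or_ne y ⊤ with rfl | htop
        · obtain ⟨z, hz⟩ := EReal.mem_nhds_top_iff.1 hmem
          obtain ⟨x, hx, h1, h2⟩ := hlow' z (EReal.coe_lt_top z)
          exact ⟨Set.Ioi x, Or.inr ⟨x, hx, rfl⟩, Ioi_mem_nhds h2, Set.univ, Or.inl rfl, univ_mem,
            fun t ht => hz (lt_trans h1 ht.1)⟩
        · obtain ⟨l, r, ⟨hl, hr⟩, hlr⟩ := (mem_nhds_iff_exists_Ioo_subset'
            ⟨⊥, bot_lt_iff_ne_bot.2 hbot⟩ ⟨⊤, lt_top_iff_ne_top.2 htop⟩).1 hmem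
          obtain ⟨x, hx, h1, h2⟩ := hlow' l hl
          obtain ⟨x', hx', h1', h2'⟩ := hup' r hr
          exact ⟨Set.Ioi x, Or.inr ⟨x, hx, rfl⟩, Ioi_mem_nhds h2, Set.Iio x', Or.inr ⟨x', hx', rfl⟩,
            Iio_mem_nhds h1', fun t ht => hlr ⟨lt_trans h1 ht.1, lt_trans ht.2 h2'⟩⟩
    obtain ⟨L, hL, hLy, U, hU, hUy, hsub⟩ := hL
    exact ⟨L ∩ U, ⟨L, hL, U, hU, rfl⟩, inter_mem hLy hUy, hsub⟩
  · rintro _ ⟨L, hL, U, hU, rfl⟩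
    have hreal : Tendsto (fun n => (m n).real (L ∩ U)) atTop (𝓝 (m'.real (L ∩ U))) := by
      rcases hdich L hL U hU with h | h
      · simp [h]
      · have hc : ∀ κ : Measure EReal, IsProbabilityMeasure κ →
            κ.real (L ∩ U) = κ.real L + κ.real U - 1 := fun κ _ => by
          have := measureReal_union_add_inter (μ := κ) (s := L) (hUlim U hU).1
          rw [h, probReal_univ] at this
          linarith
        rw [hc m' inferInstance]
        exact (((hLlim L hL).2.add (hUlim U hU).2).sub_const 1).congr
          fun n => (hc (m n) inferInstance).symm
    exact NNReal.tendsto_coe.1 hreal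

/-- Functions of disjoint finite sets of coordinates of an independent family are independent. -/
lemma indepFun_of_disjoint_coordinates {Ω ι κ β γ : Type*} [MeasurableSpace Ω] {P : Measure Ω}
    [MeasurableSpace κ] [Inhabited κ] [MeasurableSpace β] [MeasurableSpace γ] {f : ι → Ω → κ} (hf : iIndepFun f P)
    (hm : ∀ i, Measurable (f i)) (S T : Finset ι) (hST : Disjoint S T)
    {Ψ : (ι → κ) → β} {Θ : (ι → κ) → γ} (hΨ : Measurable Ψ) (hΘ : Measurable Θ)
    (hΨS : ∀ x y, (∀ i ∈ S, x i = y i) → Ψ x = Ψ y)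
    (hΘT : ∀ x y, (∀ i ∈ T, x i = y i) → Θ x = Θ y) :
    IndepFun (fun ω => Ψ fun i => f i ω) (fun ω => Θ fun i => f i ω) P := by
  classical
  let ext : (S : Finset ι) → (S → κ) → ι → κ := fun S x i =>
    if h : i ∈ S then x ⟨i, h⟩ else default
  have hext : ∀ S, Measurable (ext S) := fun S => by
    refine measurable_pi_lambda _ fun i => ?_
    by_cases h : i ∈ S
    · simpa [ext, h] using measurable_pi_apply (⟨i, h⟩ : S)
    · simp [ext, h]
  have h := (hf.indepFun_finset S T hST hm).comp (hΨ.comp (hext S)) (hΘ.comp (hext T))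
  have h1 : (fun ω => Ψ fun i => f i ω) = (Ψ ∘ ext S) ∘ fun ω (i : S) => f i ω := by
    ext1 ω
    exact hΨS _ _ fun i hi => by simp [ext, hi]
  have h2 : (fun ω => Θ fun i => f i ω) = (Θ ∘ ext T) ∘ fun ω (i : T) => f i ω := by
    ext1 ω
    exact hΘT _ _ fun i hi => by simp [ext, hi]
  rw [h1, h2]
  exact h

/-! ### The renewal equation of a killed Poisson process -/

section Survival

variable {ι : Type*} (s : Finset ι) (c : ℝ) (t : ι → ℝ)

/-- `c` times the number of thresholds `t e` above `γ`. -/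
noncomputable def hazard (γ : ℝ) : ℝ := ∑ e ∈ s, if γ < t e then c else 0

/-- The exponential of minus the integral of `hazard` over `(γ, ∞)`. -/
noncomputable def survival (γ : ℝ) : ℝ := Real.exp (-(c * ∑ e ∈ s, max (t e - γ) 0))

lemma measurable_hazard : Measurable (hazard s c t) :=
  Finset.measurable_sum _ fun _ _ =>
    Measurable.ite (measurableSet_lt measurable_id measurable_const) measurable_const
      measurable_const

lemma continuous_survival : Continuous (survival s c t) := by
  unfold survival
  fun_prop

lemma hasDerivAt_survival {γ : ℝ} (h : ∀ e ∈ s, t e ≠ γ) :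
    HasDerivAt (survival s c t) (survival s c t γ * hazard s c t γ) γ := by
  have hsum : HasDerivAt (fun γ => ∑ e ∈ s, max (t e - γ) 0)
      (∑ e ∈ s, if γ < t e then -1 else 0) γ := by
    refine HasDerivAt.fun_sum fun e he => ?_
    rcases lt_or_gt_of_ne (h e he) with hlt | hgt
    · rw [if_neg (not_lt.2 hlt.le)]
      refine (hasDerivAt_const γ (0 : ℝ)).congr_of_eventuallyEq ?_
      filter_upwards [eventually_gt_nhds hlt] with x hx
      exact max_eq_right (by linarith)
    · rw [if_pos hgt]
      refine ((hasDerivAt_id γ).const_sub (t e)).congr_of_eventuallyEq ?_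
      filter_upwards [eventually_lt_nhds hgt] with x hx
      exact max_eq_left (by linarith)
  have hexp : HasDerivAt (survival s c t)
      (survival s c t γ * -(c * ∑ e ∈ s, if γ < t e then -1 else 0)) γ :=
    ((hsum.const_mul c).neg).exp
  convert! hexp using 2
  rw [hazard, Finset.mul_sum, ← Finset.sum_neg_distrib]
  refine Finset.sum_congr rfl fun e _ => ?_
  split_ifs <;> simp

variable {c}

lemma survival_pos (γ : ℝ) : 0 < survival s c t γ := Real.exp_pos _

lemma survival_le_one (hc : 0 ≤ c) (γ : ℝ) : survival s c t γ ≤ 1 := by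
  rw [survival, Real.exp_le_one_iff, neg_nonpos]
  exact mul_nonneg hc (Finset.sum_nonneg fun _ _ => le_max_right _ _)

lemma hazard_nonneg (hc : 0 ≤ c) (γ : ℝ) : 0 ≤ hazard s c t γ :=
  Finset.sum_nonneg fun _ _ => by split_ifs <;> simp [hc]

lemma survival_eq_one {γ : ℝ} (h : ∀ e ∈ s, t e ≤ γ) : survival s c t γ = 1 := by
  rw [survival, Finset.sum_eq_zero fun e he => max_eq_right (by linarith [h e he])]
  simp

lemma tendsto_survival : Tendsto (survival s c t) atTop (𝓝 1) := by
  refine tendsto_const_nhds.congr' ?_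
  have : ∀ᶠ γ in atTop, ∀ e ∈ s, t e ≤ γ :=
    (Filter.eventually_all_finset s).2 fun e _ => eventually_ge_atTop (t e)
  filter_upwards [this] with γ hγ
  exact (survival_eq_one s t hγ).symm

lemma lintegral_expMeasure_one (f : ℝ → ℝ≥0∞) (hf : Measurable f) :
    ∫⁻ w, f w ∂(expMeasure 1) = ∫⁻ w in Set.Ioi 0, ENNReal.ofReal (Real.exp (-w)) * f w := by
  have hpdf : Measurable (gammaPDF 1 1) := (measurable_gammaPDFReal 1 1).ennreal_ofReal
  rw [expMeasure, gammaMeasure, lintegral_withDensity_eq_lintegral_mul _ hpdf hf,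
    ← lintegral_indicator measurableSet_Ioi]
  refine lintegral_congr_ae ?_
  filter_upwards [compl_mem_ae_iff.2 (measure_singleton (μ := volume) (0 : ℝ))] with w hw
  have hw' : w ≠ 0 := hw
  rcases lt_or_gt_of_ne hw' with h | h
  · rw [Set.indicator_of_notMem (by simpa using h.le), Pi.mul_apply, gammaPDF_of_neg h, zero_mul]
  · rw [Set.indicator_of_mem (by simpa using h), Pi.mul_apply, gammaPDF_of_nonneg h.le]
    simp

/-- The survival function solves the renewal equation of a unit rate Poisson process that is
killed at rate `hazard`. -/
lemma lintegral_survival (hc : 0 ≤ c) (hq : ∀ γ, hazard s c t γ ≤ 1) (γ : ℝ) :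
    ∫⁻ w, ENNReal.ofReal (survival s c t (γ + w)) * (1 - ENNReal.ofReal (hazard s c t (γ + w)))
      ∂(expMeasure 1) = ENNReal.ofReal (survival s c t γ) := by
  have hmS : Measurable fun w => survival s c t (γ + w) :=
    (continuous_survival s c t).measurable.comp (measurable_const.add measurable_id)
  have hmH : Measurable fun w => hazard s c t (γ + w) :=
    (measurable_hazard s c t).comp (measurable_const.add measurable_id)
  rw [lintegral_expMeasure_one (fun w => ENNReal.ofReal (survival s c t (γ + w)) *
      (1 - ENNReal.ofReal (hazard s c t (γ + w))))
    (hmS.ennreal_ofReal.mul (measurable_const.sub hmH.ennreal_ofReal))]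
  set f : ℝ → ℝ := fun w => Real.exp (-w) * (survival s c t (γ + w) * (1 - hazard s c t (γ + w)))
    with hf
  have hf0 : ∀ w, 0 ≤ f w := fun w => mul_nonneg (Real.exp_pos _).le
    (mul_nonneg (survival_pos s t _).le (sub_nonneg.2 (hq _)))
  have hfm : Measurable f :=
    (Real.measurable_exp.comp measurable_neg).mul (hmS.mul (measurable_const.sub hmH))
  have hfle : ∀ w, f w ≤ Real.exp (-w) := fun w => by
    refine mul_le_of_le_one_right (Real.exp_pos _).le (mul_le_one₀ (survival_le_one s t hc _)
      (sub_nonneg.2 (hq _)) ?_)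
    linarith [hazard_nonneg s t hc (γ + w)]
  have hint : IntegrableOn f (Set.Ioi 0) := by
    have hexp : IntegrableOn (fun w : ℝ => Real.exp (-w)) (Set.Ioi 0) := by
      simpa using exp_neg_integrableOn_Ioi 0 one_pos
    refine Integrable.mono' hexp
      hfm.aestronglyMeasurable (ae_of_all _ fun w => ?_)
    rw [Real.norm_of_nonneg (hf0 w)]
    exact hfle w
  have heq : ∀ w, ENNReal.ofReal (Real.exp (-w)) * (ENNReal.ofReal (survival s c t (γ + w)) *
      (1 - ENNReal.ofReal (hazard s c t (γ + w)))) = ENNReal.ofReal (f w) := fun w => by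
    rw [hf, ENNReal.ofReal_mul (Real.exp_pos _).le, ENNReal.ofReal_mul (survival_pos s t _).le,
      ENNReal.ofReal_sub _ (hazard_nonneg s t hc _), ENNReal.ofReal_one]
  simp_rw [heq]
  rw [← ofReal_integral_eq_lintegral_ofReal hint (ae_of_all _ hf0)]
  congr 1
  -- The derivative of the survival function is itself times the hazard, so `-(exp (-w) * survival
  -- (γ + w))` is an antiderivative of `f`. It fails to be differentiable only at the finitely many
  -- thresholds, which the fundamental theorem tolerates.
  have hR : ∀ R : ℝ, ∫ w in (0 : ℝ)..R, f w =
      survival s c t γ - Real.exp (-R) * survival s c t (γ + R) := by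
    intro R
    have hcount : ((fun e => t e - γ) '' (s : Set ι)).Countable :=
      (s.finite_toSet.image _).countable
    have h := integral_eq_of_hasDerivAt_off_countable (a := 0) (b := R)
      (fun w => -(Real.exp (-w) * survival s c t (γ + w))) f hcount
      (by
        have := continuous_survival s c t
        fun_prop) (fun w hw => ?_) ?_
    · rw [h]
      simp
      ring
    · have hne : ∀ e ∈ s, t e ≠ γ + w := fun e he h =>
        hw.2 ⟨e, he, by simp only [h]; ring⟩
      have h1 : HasDerivAt (fun w => survival s c t (γ + w))
          (survival s c t (γ + w) * hazard s c t (γ + w)) w :=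
        HasDerivAt.comp_const_add γ w (hasDerivAt_survival s c t hne)
      have h2 : HasDerivAt (fun w : ℝ => Real.exp (-w)) (-Real.exp (-w)) w := by
        simpa using (hasDerivAt_neg w).exp
      convert! (h2.mul h1).neg using 1
      simp only [hf]
      ring
    · have hexp : IntervalIntegrable (fun w : ℝ => Real.exp (-w)) volume 0 R :=
        (Real.continuous_exp.comp continuous_neg).intervalIntegrable 0 R
      refine hexp.mono_fun hfm.aestronglyMeasurable (ae_of_all _ fun w => ?_)
      simp only [Real.norm_of_nonneg (hf0 w), Real.norm_of_nonneg (Real.exp_pos _).le]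
      exact hfle w
  have hl1 := intervalIntegral_tendsto_integral_Ioi 0 hint tendsto_id
  simp only [id, hR] at hl1
  refine tendsto_nhds_unique hl1 ?_
  have h2 := ((Real.tendsto_exp_neg_atTop_nhds_zero).mul
    ((tendsto_survival s t (c := c)).comp (tendsto_atTop_add_const_left atTop γ tendsto_id)))
  simpa using h2.const_sub (survival s c t γ)

end Survival

/-! ### Grid cells of the edges and their probabilities -/

/-- The edges of the complete graph on `{0, …, n}`. -/
noncomputable def boxEdges (n : ℕ) : Finset Edge :=
  (Finset.Icc ((0 : ℤ), (0 : ℤ)) ((n : ℤ), (n : ℤ))).subtype fun e => e.1 < e.2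

lemma mem_boxEdges {n : ℕ} {e : Edge} : e ∈ boxEdges n ↔ 0 ≤ e.1.1 ∧ e.1.2 ≤ n := by
  have := e.2
  simp only [boxEdges, Finset.mem_subtype, Finset.mem_Icc, Prod.le_def]
  omega

/-- The cell of the grid of mesh `1 / (n + 1)` that contains `(min u v, max u v)`. -/
noncomputable def cellOf (n : ℕ) (u v : ℝ) : ℤ × ℤ :=
  (⌊((n : ℝ) + 1) * min u v⌋, ⌊((n : ℝ) + 1) * max u v⌋)

lemma measurable_cellOf (n : ℕ) : Measurable fun z : ℝ × ℝ => cellOf n z.1 z.2 := by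
  unfold cellOf
  fun_prop

/-- The uniform distribution on `[0, 1]`. -/
noncomputable abbrev unif : Measure ℝ := volume.restrict (Set.Icc 0 1)

instance : IsProbabilityMeasure unif := ⟨by simp⟩

lemma unif_floor {n : ℕ} {i : ℤ} (h0 : 0 ≤ i) (hn : i ≤ n) :
    unif {u | ⌊((n : ℝ) + 1) * u⌋ = i} = ENNReal.ofReal (1 / (n + 1)) := by
  have hN : (0 : ℝ) < n + 1 := by positivity
  have h0' : (0 : ℝ) ≤ i := by exact_mod_cast h0
  have hn' : (i : ℝ) ≤ n := by exact_mod_cast hn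
  have hset : {u : ℝ | ⌊((n : ℝ) + 1) * u⌋ = i} = Set.Ico ((i : ℝ) / (n + 1)) (((i : ℝ) + 1) / (n + 1)) := by
    ext u
    simp only [Set.mem_ofPred_eq, Int.floor_eq_iff, Set.mem_Ico, div_le_iff₀ hN, lt_div_iff₀ hN,
      mul_comm u]
  rw [hset, Measure.restrict_apply measurableSet_Ico, Set.inter_eq_left.2, Real.volume_Ico]
  · congr 1
    field_simp
    ring
  · intro u hu
    refine ⟨(div_nonneg h0' hN.le).trans hu.1, hu.2.le.trans ((div_le_one hN).2 (by linarith))⟩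

lemma cellOf_eq_iff {n : ℕ} {u v : ℝ} {e : Edge} : cellOf n u v = e.1 ↔
    (⌊((n : ℝ) + 1) * u⌋ = e.1.1 ∧ ⌊((n : ℝ) + 1) * v⌋ = e.1.2) ∨
      (⌊((n : ℝ) + 1) * u⌋ = e.1.2 ∧ ⌊((n : ℝ) + 1) * v⌋ = e.1.1) := by
  have hN : (0 : ℝ) ≤ n + 1 := by positivity
  have he := e.2
  rcases le_total u v with h | h
  · have hf : ⌊((n : ℝ) + 1) * u⌋ ≤ ⌊((n : ℝ) + 1) * v⌋ :=
      Int.floor_le_floor (mul_le_mul_of_nonneg_left h hN)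
    rw [cellOf, min_eq_left h, max_eq_right h, Prod.ext_iff]
    constructor
    · exact Or.inl
    · rintro (h | ⟨h1, h2⟩)
      · exact h
      · omega
  · have hf : ⌊((n : ℝ) + 1) * v⌋ ≤ ⌊((n : ℝ) + 1) * u⌋ :=
      Int.floor_le_floor (mul_le_mul_of_nonneg_left h hN)
    rw [cellOf, min_eq_right h, max_eq_left h, Prod.ext_iff]
    constructor
    · exact fun h => Or.inr h.symm
    · rintro (⟨h1, h2⟩ | h)
      · omega
      · exact h.symm

/-- The ordered pair reaches an off-diagonal cell in two ways, `u` left of `v` or `v` left of `u`,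
each of probability `1 / (n + 1) ^ 2`. Diagonal cells belong to no edge. -/
lemma unif_prod_cell {n : ℕ} {e : Edge} (he : e ∈ boxEdges n) :
    (unif.prod unif) {z | cellOf n z.1 z.2 = e.1} = ENNReal.ofReal (2 / ((n : ℝ) + 1) ^ 2) := by
  have hlt := e.2
  obtain ⟨h0, hn⟩ := mem_boxEdges.1 he
  have hm : ∀ i : ℤ, MeasurableSet {u : ℝ | ⌊((n : ℝ) + 1) * u⌋ = i} := fun i =>
    (Int.measurable_floor.comp (measurable_const.mul measurable_id)) (measurableSet_singleton i)
  have hset : {z : ℝ × ℝ | cellOf n z.1 z.2 = e.1} =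
      ({u : ℝ | ⌊((n : ℝ) + 1) * u⌋ = e.1.1} ×ˢ {u : ℝ | ⌊((n : ℝ) + 1) * u⌋ = e.1.2}) ∪
      ({u : ℝ | ⌊((n : ℝ) + 1) * u⌋ = e.1.2} ×ˢ {u : ℝ | ⌊((n : ℝ) + 1) * u⌋ = e.1.1}) := by
    ext z
    exact cellOf_eq_iff
  rw [hset, measure_union _ ((hm _).prod (hm _)), Measure.prod_prod, Measure.prod_prod,
    unif_floor h0 (by omega), unif_floor (by omega) hn, ← ENNReal.ofReal_mul (by positivity),
    ← ENNReal.ofReal_add (by positivity) (by positivity)]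
  · congr 1
    field_simp
    norm_num
  · rw [Set.disjoint_left]
    rintro z ⟨h1, -⟩ ⟨h2, -⟩
    have h1' : ⌊((n : ℝ) + 1) * z.1⌋ = e.1.1 := h1
    have h2' : ⌊((n : ℝ) + 1) * z.1⌋ = e.1.2 := h2
    omega

/-- The pairs of positions which at time `γ` hit the cell of an edge with threshold above `γ`. -/
def killed (n : ℕ) (t : Edge → ℝ) (γ : ℝ) : Set (ℝ × ℝ) :=
  {z | ∃ e ∈ boxEdges n, cellOf n z.1 z.2 = e.1 ∧ γ < t e}

lemma measurableSet_killed (n : ℕ) (t : Edge → ℝ) :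
    MeasurableSet {z : ℝ × (ℝ × ℝ) | z.2 ∈ killed n t z.1} := by
  have : {z : ℝ × (ℝ × ℝ) | z.2 ∈ killed n t z.1} =
      ⋃ e ∈ boxEdges n, {z : ℝ × (ℝ × ℝ) | cellOf n z.2.1 z.2.2 = e.1} ∩ {z | z.1 < t e} := by
    ext z
    simp only [killed, Set.mem_ofPred_eq, Set.mem_iUnion, Set.mem_inter_iff, exists_prop]
  rw [this]
  refine Finset.measurableSet_biUnion _ fun e _ => MeasurableSet.inter ?_
    (measurableSet_lt measurable_fst measurable_const)
  exact ((measurable_cellOf n).comp measurable_snd) (measurableSet_singleton e.1)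

lemma unif_prod_killed (n : ℕ) (t : Edge → ℝ) (γ : ℝ) :
    (unif.prod unif) (killed n t γ) =
      ENNReal.ofReal (hazard (boxEdges n) (2 / ((n : ℝ) + 1) ^ 2) t γ) := by
  classical
  have hset : killed n t γ =
      ⋃ e ∈ (boxEdges n).filter fun e => γ < t e, {z : ℝ × ℝ | cellOf n z.1 z.2 = e.1} := by
    ext z
    simp only [killed, Set.mem_ofPred_eq, Set.mem_iUnion, Finset.mem_filter, exists_prop]
    constructor
    · rintro ⟨e, h1, h2, h3⟩
      exact ⟨e, ⟨h1, h3⟩, h2⟩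
    · rintro ⟨e, ⟨h1, h3⟩, h2⟩
      exact ⟨e, h1, h2, h3⟩
  rw [hset, measure_biUnion_finset]
  · rw [Finset.sum_congr rfl fun e he => unif_prod_cell (Finset.mem_filter.1 he).1, hazard,
      ← Finset.sum_filter, ENNReal.ofReal_sum_of_nonneg fun _ _ => by positivity]
  · intro e _ e' _ hne
    rw [Function.onFun, Set.disjoint_left]
    intro z h1 h2
    exact hne (Subtype.ext (Eq.trans (Eq.symm h1) h2))
  · exact fun e _ => (measurable_cellOf n) (measurableSet_singleton e.1)

/-- The hazard is the probability that a point arriving at time `γ` is killed. -/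
lemma hazard_boxEdges_le_one (n : ℕ) (t : Edge → ℝ) (γ : ℝ) :
    hazard (boxEdges n) (2 / ((n : ℝ) + 1) ^ 2) t γ ≤ 1 := by
  have h := prob_le_one (μ := unif.prod unif) (s := killed n t γ)
  rwa [unif_prod_killed, ENNReal.ofReal_le_one] at h

/-! ### The continuous model as a Poisson process -/

/-- The continuous model with measurable driving variables in the ranges `(0, ∞)` and `(0, 1)`. -/
structure IsRegularModel {Ω : Type*} [MeasurableSpace Ω] (P : Measure Ω) (W U V : ℕ → Ω → ℝ) : Prop
    extends IsContinuousModel P W U V where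
  measurable_W : ∀ k, Measurable (W k)
  measurable_U : ∀ k, Measurable (U k)
  measurable_V : ∀ k, Measurable (V k)
  W_pos : ∀ k ω, 0 < W k ω
  U_mem : ∀ k ω, U k ω ∈ Set.Ioo (0 : ℝ) 1
  V_mem : ∀ k ω, V k ω ∈ Set.Ioo (0 : ℝ) 1

/-- The arrival times `W_0 + ⋯ + W_k`. -/
noncomputable def arrival {Ω : Type*} (W : ℕ → Ω → ℝ) (k : ℕ) (ω : Ω) : ℝ :=
  ∑ i ∈ Finset.range (k + 1), W i ω

namespace IsRegularModel

variable {Ω : Type*} [MeasurableSpace Ω] {P : Measure Ω} {W U V : ℕ → Ω → ℝ}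

lemma isProbabilityMeasure (h : IsRegularModel P W U V) : IsProbabilityMeasure P :=
  h.indep.isProbabilityMeasure

lemma measurable_arrival (h : IsRegularModel P W U V) (k : ℕ) : Measurable (arrival W k) :=
  Finset.measurable_sum _ fun i _ => h.measurable_W i

lemma arrival_strictMono (h : IsRegularModel P W U V) (ω : Ω) :
    StrictMono fun k => arrival W k ω :=
  strictMono_nat_of_lt_succ fun k => by
    simp only [arrival, Finset.sum_range_succ _ (k + 1)]
    linarith [h.W_pos (k + 1) ω]

lemma arrival_pos (h : IsRegularModel P W U V) (k : ℕ) (ω : Ω) : 0 < arrival W k ω :=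
  Finset.sum_pos (fun i _ => h.W_pos i ω) (by simp)

lemma measurable_elim (h : IsRegularModel P W U V) :
    ∀ i, Measurable (Sum.elim W (Sum.elim U V) i) := by
  rintro (i | i | i)
  exacts [h.measurable_W i, h.measurable_U i, h.measurable_V i]

lemma tendsto_arrival (h : IsRegularModel P W U V) :
    ∀ᵐ ω ∂P, Tendsto (fun k => arrival W k ω) atTop atTop := by
  have := h.isProbabilityMeasure
  -- Truncation makes integrability trivial, and the strong law for the truncated variables already
  -- forces divergence.
  let X : ℕ → Ω → ℝ := fun k ω => min (W k ω) 1
  have hφ : Measurable fun x : ℝ => min x 1 := measurable_id.min measurable_const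
  have hXm : ∀ k, Measurable (X k) := fun k => hφ.comp (h.measurable_W k)
  have hXpos : ∀ k ω, 0 < X k ω := fun k ω => lt_min (h.W_pos k ω) one_pos
  have hint : Integrable (X 0) P := by
    refine Integrable.of_bound (hXm 0).aestronglyMeasurable 1 (ae_of_all _ fun ω => ?_)
    rw [Real.norm_of_nonneg (hXpos 0 ω).le]
    exact min_le_right _ _
  have hlaw := strong_law_ae_real X hint (fun i j hij => by
    have hi := (h.indep.precomp (g := Sum.inl) Sum.inl_injective).indepFun hij
    exact hi.comp hφ hφ) (fun i => by
    have : IdentDistrib (W i) (W 0) P P :=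
      ⟨(h.measurable_W i).aemeasurable, (h.measurable_W 0).aemeasurable, by
        rw [(h.law_W i).map_eq, (h.law_W 0).map_eq]⟩
    exact this.comp hφ)
  have hEpos : 0 < ∫ ω, X 0 ω ∂P := by
    rw [integral_pos_iff_support_of_nonneg (fun ω => (hXpos 0 ω).le) hint]
    have : Function.support (X 0) = Set.univ := by
      ext ω
      simp [(hXpos 0 ω).ne']
    simp [this]
  filter_upwards [hlaw] with ω hω
  have h1 : Tendsto (fun n : ℕ => (∑ i ∈ Finset.range n, X i ω)) atTop atTop := by
    have h2 := hω.pos_mul_atTop hEpos (tendsto_natCast_atTop_atTop (R := ℝ))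
    refine h2.congr' ?_
    filter_upwards [eventually_gt_atTop 0] with n hn
    have : (n : ℝ) ≠ 0 := by positivity
    field_simp
  refine tendsto_atTop_mono (fun k => ?_) (h1.comp (tendsto_add_atTop_nat 1))
  exact Finset.sum_le_sum fun i _ => min_le_left _ _

lemma map_triple (h : IsRegularModel P W U V) (m : ℕ) :
    P.map (fun ω => (W m ω, (U m ω, V m ω))) = (expMeasure 1).prod (unif.prod unif) := by
  have := h.isProbabilityMeasure
  have h1 : IndepFun (U m) (V m) P := h.indep.indepFun (i := Sum.inr (Sum.inl m))
    (j := Sum.inr (Sum.inr m)) (by simp)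
  have h2 : IndepFun (W m) (fun ω => (U m ω, V m ω)) P :=
    (h.indep.indepFun_prodMk h.measurable_elim (Sum.inr (Sum.inl m)) (Sum.inr (Sum.inr m))
      (Sum.inl m) (by simp) (by simp)).symm
  rw [(indepFun_iff_map_prod_eq_prod_map_map (h.measurable_W m).aemeasurable
    ((h.measurable_U m).prodMk (h.measurable_V m)).aemeasurable).1 h2,
    (indepFun_iff_map_prod_eq_prod_map_map (h.measurable_U m).aemeasurable
    (h.measurable_V m).aemeasurable).1 h1, (h.law_W m).map_eq, (h.law_U m).map_eq,
    (h.law_V m).map_eq]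

open Classical in
/-- The probability that the first `m` points are not killed, weighted by the survival function at
the time of the last of these points. -/
noncomputable def survivalMean (P : Measure Ω) (W U V : ℕ → Ω → ℝ) (n : ℕ) (t : Edge → ℝ) (m : ℕ) :
    ℝ≥0∞ :=
  ∫⁻ ω, (if ∀ i < m, (U i ω, V i ω) ∉ killed n t (arrival W i ω) then 1 else 0) *
    ENNReal.ofReal (survival (boxEdges n) (2 / ((n : ℝ) + 1) ^ 2) t (∑ i ∈ Finset.range m, W i ω)) ∂P

/-- A martingale property: conditionally on the first `m` points, the next one is an independent
exponential waiting time with an independent uniform position, and averaging over it is exactly the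
renewal equation `lintegral_survival`. -/
lemma survivalMean_succ (h : IsRegularModel P W U V) (n : ℕ) (t : Edge → ℝ) (m : ℕ) :
    survivalMean P W U V n t (m + 1) = survivalMean P W U V n t m := by
  classical
  have := h.isProbabilityMeasure
  set c : ℝ := 2 / ((n : ℝ) + 1) ^ 2 with hc
  have hc0 : 0 ≤ c := by positivity
  have hexp : IsProbabilityMeasure (expMeasure 1) := isProbabilityMeasure_expMeasure one_pos
  -- `Ψ` keeps all that is needed of the past, namely survival so far and the current time; `Θ` is
  -- the new point. They use disjoint coordinates.
  let Ψ : (ℕ ⊕ ℕ ⊕ ℕ → ℝ) → ℝ≥0∞ × ℝ := fun x =>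
    (if ∀ i < m, (x (.inr (.inl i)), x (.inr (.inr i))) ∉
      killed n t (∑ j ∈ Finset.range (i + 1), x (.inl j)) then 1 else 0,
      ∑ j ∈ Finset.range m, x (.inl j))
  let Θ : (ℕ ⊕ ℕ ⊕ ℕ → ℝ) → ℝ × (ℝ × ℝ) := fun x =>
    (x (.inl m), (x (.inr (.inl m)), x (.inr (.inr m))))
  have hΨ : Measurable Ψ := by
    refine Measurable.prodMk (Measurable.ite ?_ measurable_const measurable_const)
      (Finset.measurable_sum _ fun j _ => measurable_pi_apply _)
    have : {x : ℕ ⊕ ℕ ⊕ ℕ → ℝ | ∀ i < m, (x (.inr (.inl i)), x (.inr (.inr i))) ∉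
        killed n t (∑ j ∈ Finset.range (i + 1), x (.inl j))} =
        ⋂ i, ⋂ (_ : i < m), {x | (x (.inr (.inl i)), x (.inr (.inr i))) ∈
        killed n t (∑ j ∈ Finset.range (i + 1), x (.inl j))}ᶜ := by
      ext x
      simp
    rw [this]
    refine MeasurableSet.iInter fun i => MeasurableSet.iInter fun _ => MeasurableSet.compl ?_
    have hm : Measurable fun x : ℕ ⊕ ℕ ⊕ ℕ → ℝ => (∑ j ∈ Finset.range (i + 1), x (.inl j),
        (x (.inr (.inl i)), x (.inr (.inr i)))) := by
      fun_prop
    exact hm (measurableSet_killed n t)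
  have hΘ : Measurable Θ := by fun_prop
  have hind := indepFun_of_disjoint_coordinates h.indep h.measurable_elim
    ((Finset.range m).disjSum ((Finset.range m).disjSum (Finset.range m)))
    (({m} : Finset ℕ).disjSum (({m} : Finset ℕ).disjSum {m})) (by
      rw [Finset.disjoint_left]
      rintro (i | i | i) hi hi' <;> simp at hi hi' <;> omega) hΨ hΘ
    (fun x y hxy => by
      have h1 : ∀ j < m, x (.inl j) = y (.inl j) := fun j hj => hxy _ (by simpa using hj)
      have h2 : ∀ j < m, x (.inr (.inl j)) = y (.inr (.inl j)) := fun j hj =>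
        hxy _ (by simpa using hj)
      have h3 : ∀ j < m, x (.inr (.inr j)) = y (.inr (.inr j)) := fun j hj =>
        hxy _ (by simpa using hj)
      have h4 : ∀ k ≤ m, ∑ j ∈ Finset.range k, x (.inl j) = ∑ j ∈ Finset.range k, y (.inl j) :=
        fun k hk => Finset.sum_congr rfl fun j hj => h1 j ((Finset.mem_range.1 hj).trans_le hk)
      have h5 : (∀ i < m, (x (.inr (.inl i)), x (.inr (.inr i))) ∉
          killed n t (∑ j ∈ Finset.range (i + 1), x (.inl j))) ↔
          (∀ i < m, (y (.inr (.inl i)), y (.inr (.inr i))) ∉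
          killed n t (∑ j ∈ Finset.range (i + 1), y (.inl j))) :=
        forall₂_congr fun i hi => by rw [h2 i hi, h3 i hi, h4 (i + 1) hi]
      simp only [Ψ, h4 m le_rfl, h5])
    (fun x y hxy => by
      have h1 := hxy (.inl m) (by simp)
      have h2 := hxy (.inr (.inl m)) (by simp)
      have h3 := hxy (.inr (.inr m)) (by simp)
      simp only [Θ, h1, h2, h3])
  have hall : Measurable fun ω i => Sum.elim W (Sum.elim U V) i ω :=
    measurable_pi_lambda _ h.measurable_elim
  have hmap := (indepFun_iff_map_prod_eq_prod_map_map (hΨ.comp hall).aemeasurable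
    (hΘ.comp hall).aemeasurable).1 hind
  have hmapΘ : P.map (Θ ∘ fun ω i => Sum.elim W (Sum.elim U V) i ω) =
      (expMeasure 1).prod (unif.prod unif) := h.map_triple m
  rw [hmapΘ] at hmap
  let F : (ℝ≥0∞ × ℝ) × (ℝ × (ℝ × ℝ)) → ℝ≥0∞ := fun z =>
    z.1.1 * (ENNReal.ofReal (survival (boxEdges n) c t (z.1.2 + z.2.1)) *
      if z.2.2 ∈ killed n t (z.1.2 + z.2.1) then 0 else 1)
  have hSm : Measurable (survival (boxEdges n) c t) := (continuous_survival _ _ _).measurable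
  have hkm : MeasurableSet {z : (ℝ≥0∞ × ℝ) × (ℝ × (ℝ × ℝ)) |
      z.2.2 ∈ killed n t (z.1.2 + z.2.1)} := by
    have hm : Measurable fun z : (ℝ≥0∞ × ℝ) × (ℝ × (ℝ × ℝ)) => (z.1.2 + z.2.1, z.2.2) := by
      fun_prop
    exact hm (measurableSet_killed n t)
  have hF : Measurable F := by
    refine (measurable_fst.comp measurable_fst).mul (Measurable.mul ?_
      (Measurable.ite hkm measurable_const measurable_const))
    exact (hSm.comp ((measurable_snd.comp measurable_fst).add
      (measurable_fst.comp measurable_snd))).ennreal_ofReal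
  have h1 : survivalMean P W U V n t (m + 1) = ∫⁻ ω, F (Ψ (fun i => Sum.elim W (Sum.elim U V) i ω),
      Θ (fun i => Sum.elim W (Sum.elim U V) i ω)) ∂P := by
    refine lintegral_congr fun ω => ?_
    simp only [F, Ψ, Θ, Sum.elim_inl, Sum.elim_inr, Finset.sum_range_succ _ m, ← hc]
    have e1 : (∀ i < m + 1, (U i ω, V i ω) ∉ killed n t (arrival W i ω)) ↔
        (∀ i < m, (U i ω, V i ω) ∉ killed n t (arrival W i ω)) ∧
          (U m ω, V m ω) ∉ killed n t (∑ j ∈ Finset.range m, W j ω + W m ω) := by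
      rw [← Finset.sum_range_succ]
      exact Nat.forall_lt_succ_right
    simp only [e1]
    change _ = (if ∀ i < m, (U i ω, V i ω) ∉ killed n t (arrival W i ω) then 1 else 0) * _
    by_cases ha : ∀ i < m, (U i ω, V i ω) ∉ killed n t (arrival W i ω) <;>
    by_cases hb : (U m ω, V m ω) ∈ killed n t (∑ j ∈ Finset.range m, W j ω + W m ω) <;>
    simp only [ha, hb, not_true_eq_false, not_false_eq_true, and_true, and_false, if_true, if_false,
      mul_zero, zero_mul, mul_one]
  have h2 : ∀ a : ℝ≥0∞ × ℝ, ∫⁻ z, F (a, z) ∂((expMeasure 1).prod (unif.prod unif)) =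
      a.1 * ENNReal.ofReal (survival (boxEdges n) c t a.2) := by
    intro a
    have hFa : Measurable fun z => F (a, z) := hF.comp measurable_prodMk_left
    rw [lintegral_prod _ hFa.aemeasurable,
      ← lintegral_survival (boxEdges n) t hc0 (hazard_boxEdges_le_one n t) a.2]
    rw [← lintegral_const_mul]
    swap
    · have := (measurable_hazard (boxEdges n) c t)
      fun_prop
    refine lintegral_congr fun w => ?_
    have hmk : MeasurableSet (killed n t (a.2 + w)) := by
      have hm : Measurable fun z : ℝ × ℝ => (a.2 + w, z) := by fun_prop
      exact hm (measurableSet_killed n t)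
    simp only [F]
    have hite : Measurable fun z : ℝ × ℝ => if z ∈ killed n t (a.2 + w) then (0 : ℝ≥0∞) else 1 :=
      Measurable.ite hmk measurable_const measurable_const
    rw [lintegral_const_mul _ (hite.const_mul _), lintegral_const_mul _ hite]
    congr 2
    have : (fun z : ℝ × ℝ => if z ∈ killed n t (a.2 + w) then (0 : ℝ≥0∞) else 1) =
        (killed n t (a.2 + w))ᶜ.indicator 1 := by
      ext z
      by_cases hz : z ∈ killed n t (a.2 + w) <;> simp [hz]
    rw [this, lintegral_indicator_one hmk.compl, prob_compl_eq_one_sub hmk, unif_prod_killed]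
  have h3 : survivalMean P W U V n t m = ∫⁻ ω, (Ψ (fun i => Sum.elim W (Sum.elim U V) i ω)).1 *
      ENNReal.ofReal (survival (boxEdges n) c t
        (Ψ (fun i => Sum.elim W (Sum.elim U V) i ω)).2) ∂P := rfl
  rw [h1, h3]
  have h4 : Measurable fun ω => (Ψ (fun i => Sum.elim W (Sum.elim U V) i ω),
      Θ (fun i => Sum.elim W (Sum.elim U V) i ω)) := (hΨ.comp hall).prodMk (hΘ.comp hall)
  rw [← lintegral_map (f := F) hF h4]
  have hmap' : P.map (fun ω => (Ψ (fun i => Sum.elim W (Sum.elim U V) i ω),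
      Θ (fun i => Sum.elim W (Sum.elim U V) i ω))) =
      (P.map (Ψ ∘ fun ω i => Sum.elim W (Sum.elim U V) i ω)).prod
        ((expMeasure 1).prod (unif.prod unif)) := hmap
  rw [hmap', lintegral_prod _ hF.aemeasurable]
  simp_rw [h2]
  rw [lintegral_map _ (hΨ.comp hall)]
  · rfl
  · fun_prop

/-- The points of the continuous model are a Poisson process: the probability that for every edge
`e` no point falls into the cell of `e` before time `t e`. -/
lemma measure_forall_notMem_killed (h : IsRegularModel P W U V) (n : ℕ) (t : Edge → ℝ)
    (ht : ∀ e, 0 ≤ t e) :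
    P {ω | ∀ i, (U i ω, V i ω) ∉ killed n t (arrival W i ω)} =
      ENNReal.ofReal (Real.exp (-(2 / ((n : ℝ) + 1) ^ 2 * ∑ e ∈ boxEdges n, t e))) := by
  classical
  have := h.isProbabilityMeasure
  set c : ℝ := 2 / ((n : ℝ) + 1) ^ 2 with hc
  have hc0 : 0 ≤ c := by positivity
  -- The mean is constant in `m`. At `m = 0` it is the claimed exponential, the thresholds being
  -- nonnegative; as `m → ∞` the arrival times diverge, the survival factor tends to `1`, and the
  -- probability of never being killed remains.
  have hconst : ∀ m, survivalMean P W U V n t m = ENNReal.ofReal (Real.exp (-(c *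
      ∑ e ∈ boxEdges n, t e))) := by
    intro m
    induction m with
    | zero =>
      simp only [survivalMean, Finset.range_zero, Finset.sum_empty, not_lt_zero, IsEmpty.forall_iff,
        implies_true, if_true, one_mul, lintegral_const, measure_univ, mul_one, survival, sub_zero,
        max_eq_left (ht _), ← hc]
    | succ m ih => rw [h.survivalMean_succ, ih]
  have hk : ∀ i, MeasurableSet {ω | (U i ω, V i ω) ∈ killed n t (arrival W i ω)} := fun i =>
    ((h.measurable_arrival i).prodMk ((h.measurable_U i).prodMk (h.measurable_V i)))
      (measurableSet_killed n t)
  have hgood : MeasurableSet {ω | ∀ i, (U i ω, V i ω) ∉ killed n t (arrival W i ω)} := by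
    have : {ω | ∀ i, (U i ω, V i ω) ∉ killed n t (arrival W i ω)} =
        ⋂ i, {ω | (U i ω, V i ω) ∈ killed n t (arrival W i ω)}ᶜ := by
      ext ω
      simp
    rw [this]
    exact MeasurableSet.iInter fun i => (hk i).compl
  have hlim : Tendsto (survivalMean P W U V n t) atTop
      (𝓝 (∫⁻ ω, {ω | ∀ i, (U i ω, V i ω) ∉ killed n t (arrival W i ω)}.indicator 1 ω ∂P)) := by
    refine tendsto_lintegral_of_dominated_convergence (fun _ => 1) (fun m => ?_) (fun m => ?_)
      (by simp) ?_
    · refine Measurable.mul (Measurable.ite ?_ measurable_const measurable_const) ?_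
      · have : {ω | ∀ i < m, (U i ω, V i ω) ∉ killed n t (arrival W i ω)} =
            ⋂ i, ⋂ (_ : i < m), {ω | (U i ω, V i ω) ∈ killed n t (arrival W i ω)}ᶜ := by
          ext ω
          simp
        rw [this]
        exact MeasurableSet.iInter fun i => MeasurableSet.iInter fun _ => (hk i).compl
      · exact ((continuous_survival _ _ _).measurable.comp
          (Finset.measurable_sum _ fun i _ => h.measurable_W i)).ennreal_ofReal
    · refine ae_of_all _ fun ω => mul_le_one' (by split_ifs <;> simp) ?_
      rw [ENNReal.ofReal_le_one]
      exact survival_le_one _ _ hc0 _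
    · filter_upwards [h.tendsto_arrival] with ω hω
      have hS : Tendsto (fun m => ENNReal.ofReal (survival (boxEdges n) c t
          (∑ i ∈ Finset.range m, W i ω))) atTop (𝓝 1) := by
        have h1 : Tendsto (fun m => ∑ i ∈ Finset.range m, W i ω) atTop atTop :=
          (tendsto_add_atTop_iff_nat 1).1 hω
        have := ENNReal.tendsto_ofReal ((tendsto_survival (boxEdges n) t (c := c)).comp h1)
        rwa [ENNReal.ofReal_one] at this
      by_cases hall : ∀ i, (U i ω, V i ω) ∉ killed n t (arrival W i ω)
      · rw [Set.indicator_of_mem (by exact hall)]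
        refine hS.congr fun m => ?_
        rw [if_pos fun i _ => hall i, one_mul]
      · rw [Set.indicator_of_notMem (by exact hall)]
        obtain ⟨i, hi⟩ := not_forall.1 hall
        refine tendsto_const_nhds.congr' ?_
        filter_upwards [eventually_gt_atTop i] with m hm
        rw [if_neg fun hcon => hi (hcon i hm), zero_mul]
  rw [lintegral_indicator_one hgood] at hlim
  refine tendsto_nhds_unique hlim ?_
  simp only [funext hconst, tendsto_const_nhds]

end IsRegularModel

/-! ### The coupling: i.i.d. edge weights built from the Poisson points -/

open Classical in
/-- The uniform mark of the edge `e`: the value of `exp (-2 t / (n + 1) ^ 2)` at the time `t` of the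
first point of the continuous model in the cell of `e`. -/
noncomputable def mark {Ω : Type*} (W U V : ℕ → Ω → ℝ) (n : ℕ) (e : Edge) (ω : Ω) : ℝ :=
  ⨆ i, if cellOf n (U i ω) (V i ω) = e.1 then
    Real.exp (-(2 / ((n : ℝ) + 1) ^ 2 * arrival W i ω)) else 0

/-- Weights on the edges of the box with law `ρ`, driven by the continuous model. -/
noncomputable def coupledWeight {Ω : Type*} (ρ : Measure ℝ) (W U V : ℕ → Ω → ℝ) (n : ℕ) (e : Edge)
    (ω : Ω) : ℝ :=
  quantile ρ (mark W U V n e ω)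

lemma mark_nonneg {Ω : Type*} (W U V : ℕ → Ω → ℝ) (n : ℕ) (e : Edge) (ω : Ω) :
    0 ≤ mark W U V n e ω :=
  Real.iSup_nonneg fun i => by split_ifs <;> positivity

namespace IsRegularModel

variable {Ω : Type*} [MeasurableSpace Ω] {P : Measure Ω} {W U V : ℕ → Ω → ℝ}

lemma exp_arrival_mem (h : IsRegularModel P W U V) (n k : ℕ) (ω : Ω) :
    Real.exp (-(2 / ((n : ℝ) + 1) ^ 2 * arrival W k ω)) ∈ Set.Ioo (0 : ℝ) 1 := by
  refine ⟨Real.exp_pos _, ?_⟩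
  have := h.arrival_pos k ω
  rw [Real.exp_lt_one_iff, neg_lt_zero]
  positivity

lemma exp_arrival_antitone (h : IsRegularModel P W U V) (n : ℕ) (ω : Ω) :
    Antitone fun k => Real.exp (-(2 / ((n : ℝ) + 1) ^ 2 * arrival W k ω)) := fun i j hij => by
  have := (h.arrival_strictMono ω).monotone hij
  refine Real.exp_le_exp.2 (neg_le_neg ?_)
  exact mul_le_mul_of_nonneg_left this (by positivity)

lemma bddAbove_mark (h : IsRegularModel P W U V) (n : ℕ) (e : Edge) (ω : Ω) :
    open Classical in
    BddAbove (Set.range fun i => if cellOf n (U i ω) (V i ω) = e.1 then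
      Real.exp (-(2 / ((n : ℝ) + 1) ^ 2 * arrival W i ω)) else 0) := by
  refine ⟨1, ?_⟩
  rintro _ ⟨i, rfl⟩
  dsimp only
  split_ifs
  exacts [(h.exp_arrival_mem n i ω).2.le, zero_le_one]

lemma mark_le_iff (h : IsRegularModel P W U V) {n : ℕ} {e : Edge} {ω : Ω} {u : ℝ} (hu : 0 ≤ u) :
    mark W U V n e ω ≤ u ↔ ∀ i, cellOf n (U i ω) (V i ω) = e.1 →
      Real.exp (-(2 / ((n : ℝ) + 1) ^ 2 * arrival W i ω)) ≤ u := by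
  rw [mark, ciSup_le_iff (h.bddAbove_mark n e ω)]
  refine forall_congr' fun i => ?_
  split_ifs with hi <;> simp [hi, hu]

lemma le_mark (h : IsRegularModel P W U V) {n : ℕ} {e : Edge} {ω : Ω} {i : ℕ}
    (hi : cellOf n (U i ω) (V i ω) = e.1) :
    Real.exp (-(2 / ((n : ℝ) + 1) ^ 2 * arrival W i ω)) ≤ mark W U V n e ω :=
  (h.mark_le_iff (mark_nonneg W U V n e ω)).1 le_rfl i hi

lemma mark_lt_one (h : IsRegularModel P W U V) (n : ℕ) (e : Edge) (ω : Ω) :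
    mark W U V n e ω < 1 :=
  ((h.mark_le_iff (h.exp_arrival_mem n 0 ω).1.le).2 fun i _ =>
    h.exp_arrival_antitone n ω i.zero_le).trans_lt (h.exp_arrival_mem n 0 ω).2

/-- The supremum is attained by the first point in the cell, as the exponentials decrease in the
index. -/
lemma exists_mark_eq (h : IsRegularModel P W U V) {n : ℕ} {e : Edge} {ω : Ω}
    (hpos : 0 < mark W U V n e ω) : ∃ i, cellOf n (U i ω) (V i ω) = e.1 ∧
      mark W U V n e ω = Real.exp (-(2 / ((n : ℝ) + 1) ^ 2 * arrival W i ω)) := by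
  classical
  have hex : ∃ i, cellOf n (U i ω) (V i ω) = e.1 := by
    by_contra hcon
    push Not at hcon
    exact absurd hpos (not_lt.2 ((h.mark_le_iff le_rfl).2 fun i hi => absurd hi (hcon i)))
  refine ⟨Nat.find hex, Nat.find_spec hex, le_antisymm ?_ (h.le_mark (Nat.find_spec hex))⟩
  exact (h.mark_le_iff (Real.exp_pos _).le).2 fun i hi =>
    h.exp_arrival_antitone n ω (Nat.find_min' hex hi)

lemma measurable_mark (h : IsRegularModel P W U V) (n : ℕ) (e : Edge) :
    Measurable (mark W U V n e) := by
  refine Measurable.iSup fun i => Measurable.ite ?_ ?_ measurable_const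
  · exact ((measurable_cellOf n).comp ((h.measurable_U i).prodMk (h.measurable_V i)))
      (measurableSet_singleton e.1)
  · have := h.measurable_arrival i
    fun_prop

lemma measurable_coupledWeight (h : IsRegularModel P W U V) (ρ : Measure ℝ)
    [IsProbabilityMeasure ρ] (n : ℕ) (e : Edge) : Measurable (coupledWeight ρ W U V n e) :=
  (measurable_quantile ρ).comp (h.measurable_mark n e)

/-- The joint distribution function of the marks is a product: they are independent uniforms. The
event says that no point falls in the cell of `e` before the time at which the exponential equals `u
e`, that is `-log (u e) / c`. -/
lemma measure_forall_mark_le (h : IsRegularModel P W U V) (n : ℕ) (u : Edge → ℝ)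
    (hu : ∀ e, u e ∈ Set.Ioc (0 : ℝ) 1) :
    P {ω | ∀ e ∈ boxEdges n, mark W U V n e ω ≤ u e} =
      ∏ e ∈ boxEdges n, ENNReal.ofReal (u e) := by
  set c : ℝ := 2 / ((n : ℝ) + 1) ^ 2 with hc
  have hc0 : 0 < c := by positivity
  have hexp : ∀ e, Real.exp (-(c * (-Real.log (u e) / c))) = u e := fun e => by
    rw [mul_div_cancel₀ _ hc0.ne', neg_neg, Real.exp_log (hu e).1]
  have hmain := h.measure_forall_notMem_killed n (fun e => -Real.log (u e) / c) fun e =>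
    div_nonneg (neg_nonneg.2 (Real.log_nonpos (hu e).1.le (hu e).2)) hc0.le
  rw [← hc, Finset.mul_sum, ← Finset.sum_neg_distrib, Real.exp_sum,
    ENNReal.ofReal_prod_of_nonneg fun _ _ => (Real.exp_pos _).le] at hmain
  simp_rw [hexp] at hmain
  rw [← hmain]
  congr 1
  ext ω
  simp only [Set.mem_ofPred_eq, killed, not_exists, not_and, not_lt]
  constructor
  · intro hω i e he hcell
    have h1 := (h.mark_le_iff (hu e).1.le).1 (hω e he) i hcell
    rw [← hexp e, Real.exp_le_exp, neg_le_neg_iff] at h1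
    exact le_of_mul_le_mul_left h1 hc0
  · intro hω e he
    refine (h.mark_le_iff (hu e).1.le).2 fun i hcell => ?_
    rw [← hexp e, Real.exp_le_exp, neg_le_neg_iff]
    exact mul_le_mul_of_nonneg_left (hω i e he hcell) hc0.le

lemma ae_mark_pos (h : IsRegularModel P W U V) (n : ℕ) :
    ∀ᵐ ω ∂P, ∀ e ∈ boxEdges n, 0 < mark W U V n e ω := by
  classical
  refine (Filter.eventually_all_finset (boxEdges n)).2 fun e he => ?_
  rw [ae_iff]
  have hle : ∀ ε ∈ Set.Ioc (0 : ℝ) 1, P {ω | ¬0 < mark W U V n e ω} ≤ ENNReal.ofReal ε := by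
    intro ε hε
    -- The level is `ε` at `e` and `1`, which is no constraint, at the other edges. Level `0` is not
    -- allowed because of the logarithm, whence the detour through `ε`.
    have h1 := h.measure_forall_mark_le n (fun e' => if e' = e then ε else 1) fun e' => by
      by_cases he' : e' = e <;> simp [he', hε.1, hε.2]
    have h2 : ∏ e' ∈ boxEdges n, ENNReal.ofReal (if e' = e then ε else 1) = ENNReal.ofReal ε := by
      rw [Finset.prod_eq_single e]
      · simp
      · intro e' _ hne
        simp [hne]
      · exact fun hcon => absurd he hcon
    rw [h2] at h1
    rw [← h1]
    refine measure_mono fun ω hω e' _ => ?_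
    have hω' : mark W U V n e ω ≤ 0 := not_lt.1 hω
    split_ifs with hee
    · rw [hee]
      exact hω'.trans hε.1.le
    · exact (h.mark_lt_one n e' ω).le
  refine le_antisymm (ENNReal.le_of_forall_pos_le_add fun ε hε _ => ?_) bot_le
  rw [zero_add]
  have hε' : (0 : ℝ) < ε := hε
  refine (hle (min ε 1) ⟨lt_min hε' one_pos, min_le_right _ _⟩).trans ?_
  refine (ENNReal.ofReal_le_ofReal (min_le_left _ _)).trans_eq ?_
  exact ENNReal.ofReal_coe_nnreal

/-- Lower rays suffice, and there `quantile_le_iff` turns a bound on a weight into a bound on its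
mark. -/
lemma map_coupledWeight (h : IsRegularModel P W U V) (ρ : Measure ℝ) [IsProbabilityMeasure ρ]
    (n : ℕ) :
    P.map (fun ω (e : boxEdges n) => coupledWeight ρ W U V n e ω) = Measure.pi fun _ => ρ := by
  classical
  have := h.isProbabilityMeasure
  symm
  refine Measure.pi_eq_generateFrom (C := fun _ => Set.range Set.Iic)
    (fun _ => (borel_eq_generateFrom_Iic ℝ).symm.trans (BorelSpace.measurable_eq (α := ℝ)).symm)
    (fun _ => isPiSystem_Iic)
    (fun _ => ⟨fun k => Set.Iic (k : ℝ), fun k => ⟨k, rfl⟩, fun k => measure_lt_top _ _, by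
      ext x
      simpa using exists_nat_ge x⟩) fun s hs => ?_
  choose x hx using hs
  have hm : Measurable fun ω (e : boxEdges n) => coupledWeight ρ W U V n e ω :=
    measurable_pi_lambda _ fun e => h.measurable_coupledWeight ρ n e
  rw [Measure.map_apply hm (MeasurableSet.univ_pi fun e => hx e ▸ measurableSet_Iic)]
  have hprod : ∏ e, ρ (s e) = ∏ e : boxEdges n, ENNReal.ofReal (cdf ρ (x e)) :=
    Finset.prod_congr rfl fun e _ => by rw [← hx e, ofReal_cdf]
  rw [hprod]
  have hset : P ((fun ω (e : boxEdges n) => coupledWeight ρ W U V n e ω) ⁻¹' Set.pi Set.univ s) =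
      P {ω | ∀ e : boxEdges n, mark W U V n e ω ≤ cdf ρ (x e)} := by
    refine measure_congr ?_
    filter_upwards [h.ae_mark_pos n] with ω hω
    refine propext ?_
    change (∀ e ∈ Set.univ, coupledWeight ρ W U V n e ω ∈ s e) ↔
      ∀ e : boxEdges n, mark W U V n e ω ≤ cdf ρ (x e)
    simp only [Set.mem_univ, true_implies]
    refine forall_congr' fun e => ?_
    rw [← hx e, Set.mem_Iic, coupledWeight, quantile_le_iff ρ ⟨hω e e.2, h.mark_lt_one n e ω⟩]
  rw [hset]
  by_cases hpos : ∀ e : boxEdges n, 0 < cdf ρ (x e)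
  · let u : Edge → ℝ := fun e => if he : e ∈ boxEdges n then cdf ρ (x ⟨e, he⟩) else 1
    have hu : ∀ e : boxEdges n, u e = cdf ρ (x e) := fun e => by simp [u]
    have h1 := h.measure_forall_mark_le n u fun e => by
      by_cases he : e ∈ boxEdges n
      · simp only [u, he, dif_pos]
        exact ⟨hpos _, cdf_le_one ρ _⟩
      · simp [u, he]
    rw [← Finset.prod_coe_sort] at h1
    simp_rw [hu] at h1
    rw [← h1]
    congr 1
    ext ω
    simp only [Set.mem_ofPred_eq]
    exact ⟨fun hω e he => hu ⟨e, he⟩ ▸ hω ⟨e, he⟩, fun hω e => hu e ▸ hω e e.2⟩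
  -- A level `cdf ρ (x e) = 0` is outside the range of `measure_forall_mark_le`; both sides vanish
  -- since marks are almost surely positive.
  · obtain ⟨e, he⟩ := not_forall.1 hpos
    rw [Finset.prod_eq_zero (Finset.mem_univ e) (ENNReal.ofReal_eq_zero.2 (not_lt.1 he))]
    refine measure_mono_null (fun ω hω => ?_) (ae_iff.1 (h.ae_mark_pos n))
    simp only [Set.mem_ofPred_eq, not_forall]
    exact ⟨e, e.2, not_lt.2 ((hω e).trans (not_lt.1 he))⟩

end IsRegularModel

/-! ### Chains of edges and increasing paths -/

/-- A finite set of edges which are pairwise compatible. -/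
def IsEdgeChain (A : Finset Edge) : Prop :=
  (A : Set Edge).Pairwise fun e f => e.1.2 ≤ f.1.1 ∨ f.1.2 ≤ e.1.1

/-- A finite set of edges in `[0, n]` with gaps of length at least `g` before, between and after
the edges. -/
def IsSeparatedChain (n g : ℕ) (A : Finset Edge) : Prop :=
  (∀ e ∈ A, (g : ℤ) ≤ e.1.1 ∧ e.1.2 + g ≤ n) ∧
    (A : Set Edge).Pairwise fun e f => e.1.2 + g ≤ f.1.1 ∨ f.1.2 + g ≤ e.1.1

lemma IsSeparatedChain.mono {n g g' : ℕ} {A : Finset Edge} (h : IsSeparatedChain n g A)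
    (hg : g' ≤ g) : IsSeparatedChain n g' A := by
  have hg' : (g' : ℤ) ≤ g := by exact_mod_cast hg
  refine ⟨fun e he => ?_, h.2.imp fun e f hef => ?_⟩
  · have := h.1 e he
    omega
  · omega

lemma IsSeparatedChain.subset {n g : ℕ} {A B : Finset Edge} (h : IsSeparatedChain n g A)
    (hB : B ⊆ A) : IsSeparatedChain n g B :=
  ⟨fun e he => h.1 e (hB he), h.2.mono (Finset.coe_subset.2 hB)⟩

lemma IsSeparatedChain.subset_boxEdges {n g : ℕ} {A : Finset Edge} (h : IsSeparatedChain n g A) :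
    A ⊆ boxEdges n := fun e he => by
  have := h.1 e he
  rw [mem_boxEdges]
  omega

/-- The half-open intervals spanned by the edges are disjoint subsets of `(0, n]`. -/
lemma IsEdgeChain.sum_length_le {n : ℕ} {A : Finset Edge} (h : IsEdgeChain A)
    (hA : A ⊆ boxEdges n) : ∑ e ∈ A, (e.1.2 - e.1.1) ≤ n := by
  classical
  have hdisj : (A : Set Edge).PairwiseDisjoint fun e => Finset.Ioc e.1.1 e.1.2 := by
    intro e he f hf hne
    rw [Function.onFun, Finset.disjoint_left]
    intro x hx hx'
    rw [Finset.mem_Ioc] at hx hx'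
    have := h he hf hne
    omega
  have hcard := Finset.card_biUnion hdisj
  have hsub : A.biUnion (fun e => Finset.Ioc e.1.1 e.1.2) ⊆ Finset.Ioc (0 : ℤ) n := by
    intro x hx
    obtain ⟨e, he, hx⟩ := Finset.mem_biUnion.1 hx
    have := mem_boxEdges.1 (hA he)
    rw [Finset.mem_Ioc] at hx ⊢
    omega
  have hle := Finset.card_le_card hsub
  rw [hcard, Int.card_Ioc] at hle
  simp only [Int.card_Ioc] at hle
  have hsum : ∑ e ∈ A, (e.1.2 - e.1.1) = ((∑ e ∈ A, (e.1.2 - e.1.1).toNat : ℕ) : ℤ) := by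
    push_cast
    refine Finset.sum_congr rfl fun e _ => ?_
    have := e.2
    omega
  rw [hsum]
  omega

lemma IsPath.append {i j k : ℤ} {π π' : List Edge} (h : IsPath i j π) (h' : IsPath j k π') :
    IsPath i k (π ++ π') := by
  induction π generalizing i with
  | nil =>
    have : i = j := h
    rwa [this]
  | cons e π ih => exact ⟨h.1, ih h.2⟩

lemma IsPath.ordered {i j : ℤ} {π : List Edge} (h : IsPath i j π) :
    i ≤ j ∧ (∀ e ∈ π, i ≤ e.1.1 ∧ e.1.2 ≤ j) ∧ π.Pairwise fun e f => e.1.2 ≤ f.1.1 := by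
  induction π generalizing i with
  | nil =>
    have : i = j := h
    simp [this]
  | cons e π ih =>
    obtain ⟨h1, h2⟩ := h
    obtain ⟨h3, h4, h5⟩ := ih h2
    have he := e.2
    refine ⟨by omega, ?_, List.pairwise_cons.2 ⟨fun f hf => (h4 f hf).1, h5⟩⟩
    intro f hf
    rcases List.mem_cons.1 hf with rfl | hf
    · omega
    · have := h4 f hf
      omega

lemma IsPath.exists_chain {n : ℕ} {π : List Edge} (h : IsPath 0 n π) (x : Edge → ℝ) :
    ∃ A ⊆ boxEdges n, IsEdgeChain A ∧ (∀ e ∈ A, e ∈ π) ∧ (π.map x).sum = ∑ e ∈ A, x e := by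
  classical
  obtain ⟨-, h2, h3⟩ := h.ordered
  have hnd : π.Nodup := h3.imp fun {e f} hef hne => by
    have := e.2
    rw [hne] at hef
    have := f.2
    omega
  refine ⟨π.toFinset, fun e he => ?_, ?_, fun e he => List.mem_toFinset.1 he, ?_⟩
  · exact mem_boxEdges.2 (h2 e (List.mem_toFinset.1 he))
  · intro e he f hf hne
    have hsymm : π.Pairwise fun e f => e.1.2 ≤ f.1.1 ∨ f.1.2 ≤ e.1.1 := h3.imp fun h => Or.inl h
    have : Std.Symm fun e f : Edge => e.1.2 ≤ f.1.1 ∨ f.1.2 ≤ e.1.1 := ⟨fun _ _ => Or.symm⟩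
    exact hsymm.forall (List.mem_toFinset.1 he) (List.mem_toFinset.1 hf) hne
  · rw [List.sum_toFinset _ hnd]

/-- Any two vertices of `{0, …, n}` at distance at least `g` are connected by a path of present
edges. -/
def IsConnectedAtScale (n g : ℕ) (a : Edge → Bool) : Prop :=
  ∀ i j : ℤ, 0 ≤ i → j ≤ n → i + g ≤ j → ∃ π, IsPath i j π ∧ ∀ e ∈ π, a e = true

/-- Peel off the leftmost edge, reach it by a connecting path, and continue from its right end. The
connecting paths only add weight because weights are nonnegative. -/
lemma IsConnectedAtScale.exists_path {n g : ℕ} {a : Edge → Bool} (h : IsConnectedAtScale n g a)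
    (x : Edge → ℝ) (hx : ∀ e, 0 ≤ x e) (A : Finset Edge) (hA : IsSeparatedChain n g A)
    (hpres : ∀ e ∈ A, a e = true) (i : ℤ) (hi : 0 ≤ i) (hin : i + g ≤ n)
    (hiA : ∀ e ∈ A, i + g ≤ e.1.1) :
    ∃ π, IsPath i n π ∧ (∀ e ∈ π, a e = true) ∧ ∑ e ∈ A, x e ≤ (π.map x).sum := by
  classical
  have hsum : ∀ π : List Edge, 0 ≤ (π.map x).sum := fun π => List.sum_nonneg fun y hy => by
    obtain ⟨e, -, rfl⟩ := List.mem_map.1 hy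
    exact hx e
  induction hk : A.card generalizing A i with
  | zero =>
    obtain ⟨π, h1, h2⟩ := h i n hi le_rfl hin
    refine ⟨π, h1, h2, ?_⟩
    rw [Finset.card_eq_zero.1 hk]
    simpa using hsum π
  | succ k ih =>
    obtain ⟨e, he, hmin⟩ := A.exists_min_image (fun e => e.1.1)
      (Finset.card_pos.1 (by omega))
    have helt := e.2
    have heA := hA.1 e he
    obtain ⟨π₁, h1, h1'⟩ := h i e.1.1 hi (by omega) (hiA e he)
    obtain ⟨π₂, h2, h2', h2''⟩ := ih (A.erase e) (hA.subset (Finset.erase_subset _ _))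
      (fun f hf => hpres f (Finset.mem_of_mem_erase hf)) e.1.2 (by omega) (by omega)
      (fun f hf => by
        have hf' := Finset.mem_of_mem_erase hf
        have hne : f ≠ e := Finset.ne_of_mem_erase hf
        have h3 := hA.2 hf' he hne
        have h4 := hmin f hf'
        have h5 := f.2
        omega)
      (by rw [Finset.card_erase_of_mem he, hk]; rfl)
    refine ⟨π₁ ++ e :: π₂, h1.append ⟨rfl, h2⟩, ?_, ?_⟩
    · intro f hf
      rcases List.mem_append.1 hf with hf | hf
      · exact h1' f hf
      · rcases List.mem_cons.1 hf with rfl | hf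
        · exact hpres _ he
        · exact h2' f hf
    · rw [← Finset.add_sum_erase A x he]
      simp only [List.map_append, List.map_cons, List.sum_append, List.sum_cons]
      linarith [hsum π₁]

/-! ### Passage times versus chains, and connectivity of the random graph -/

section RandomGraph

variable {Ω : Type*} {α : Edge → Ω → Bool} {v : Edge → Ω → ℝ}

/-- The weight of the edge `e`, set to zero if the edge is absent. -/
def thinnedWeight (α : Edge → Ω → Bool) (v : Edge → Ω → ℝ) (e : Edge) (ω : Ω) : ℝ :=
  if α e ω = true then v e ω else 0

lemma exists_chain_of_lt_passageTime {n : ℕ} {ω : Ω} {c : ℝ}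
    (h : (c : EReal) < passageTime α v 0 n ω) :
    ∃ A ⊆ boxEdges n, IsEdgeChain A ∧ c < ∑ e ∈ A, thinnedWeight α v e ω := by
  simp only [passageTime, lt_iSup_iff, EReal.coe_lt_coe_iff] at h
  obtain ⟨π, hπ, hα, hc⟩ := h
  obtain ⟨A, hA, hchain, hmem, hsum⟩ := hπ.exists_chain fun e => v e ω
  refine ⟨A, hA, hchain, hc.trans_eq (hsum.trans (Finset.sum_congr rfl fun e he => ?_))⟩
  rw [thinnedWeight, if_pos (hα e (hmem e he))]

/-- Absent edges have thinned weight zero, so they can be dropped from the chain, and dropping edges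
keeps the gaps. -/
lemma lt_passageTime_of_separatedChain {n g : ℕ} {ω : Ω} {c : ℝ} {A : Finset Edge} (hgn : g ≤ n)
    (hconn : IsConnectedAtScale n g fun e => α e ω) (hv : ∀ e, 0 ≤ v e ω)
    (hA : IsSeparatedChain n g A) (hc : c < ∑ e ∈ A, thinnedWeight α v e ω) :
    (c : EReal) < passageTime α v 0 n ω := by
  classical
  have hsum : ∑ e ∈ A, thinnedWeight α v e ω = ∑ e ∈ A with α e ω = true, v e ω := by
    rw [Finset.sum_filter]
    rfl
  rw [hsum] at hc
  obtain ⟨π, h1, h2, h3⟩ := hconn.exists_path (fun e => v e ω) hv _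
    (hA.subset (Finset.filter_subset _ _)) (fun e he => (Finset.mem_filter.1 he).2) 0 le_rfl
    (by omega) fun e he => by
      have := hA.1 e (Finset.mem_filter.1 he).1
      omega
  simp only [passageTime, lt_iSup_iff, EReal.coe_lt_coe_iff]
  exact ⟨π, h1, h2, hc.trans_le h3⟩

variable [MeasurableSpace Ω] {P : Measure Ω} {p : ℝ} {μ : Measure ℝ}

/-- Among independent events grouped in disjoint pairs, the probability that no pair occurs. -/
lemma measure_no_pair {ι κ : Type*} [DecidableEq ι] [IsProbabilityMeasure P] {f : ι → Ω → Bool}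
    (hf : iIndepFun f P) (hm : ∀ i, Measurable (f i)) {q : ℝ} (hq : 0 ≤ q)
    (hP : ∀ i, P {ω | f i ω = true} = ENNReal.ofReal q) {e₁ e₂ : κ → ι}
    (h₁ : e₁.Injective) (h₂ : e₂.Injective) (h₁₂ : ∀ m m', e₁ m ≠ e₂ m') (s : Finset κ) :
    P {ω | ∀ m ∈ s, ¬(f (e₁ m) ω = true ∧ f (e₂ m) ω = true)} =
      ENNReal.ofReal (1 - q ^ 2) ^ s.card := by
  classical
  induction s using Finset.induction_on with
  | empty => simp
  | insert m₀ s hm₀ ih =>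
    have hind := indepFun_of_disjoint_coordinates hf hm (s.image e₁ ∪ s.image e₂) {e₁ m₀, e₂ m₀}
      (by
        rw [Finset.disjoint_left]
        intro i hi hi'
        simp only [Finset.mem_union, Finset.mem_image, Finset.mem_insert,
          Finset.mem_singleton] at hi hi'
        rcases hi with ⟨m, hms, rfl⟩ | ⟨m, hms, rfl⟩
        · rcases hi' with h | h
          · exact hm₀ (h₁ h ▸ hms)
          · exact h₁₂ _ _ h
        · rcases hi' with h | h
          · exact h₁₂ _ _ h.symm
          · exact hm₀ (h₂ h ▸ hms))
      (Ψ := fun x (m : s) => (x (e₁ m), x (e₂ m))) (Θ := fun x => (x (e₁ m₀), x (e₂ m₀)))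
      (by fun_prop) (by fun_prop)
      (fun x y hxy => by
        ext1 m
        rw [hxy _ (Finset.mem_union_left _ (Finset.mem_image_of_mem e₁ m.2)),
          hxy _ (Finset.mem_union_right _ (Finset.mem_image_of_mem e₂ m.2))])
      (fun x y hxy => by
        rw [hxy (e₁ m₀) (by simp), hxy (e₂ m₀) (by simp)])
    have hmul := hind.measure_inter_preimage_eq_mul
      {y : s → Bool × Bool | ∀ m, ¬((y m).1 = true ∧ (y m).2 = true)}
      {z : Bool × Bool | ¬(z.1 = true ∧ z.2 = true)}
      (Set.toFinite _).measurableSet (Set.toFinite _).measurableSet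
    have hpair : P {ω | ¬(f (e₁ m₀) ω = true ∧ f (e₂ m₀) ω = true)} =
        ENNReal.ofReal (1 - q ^ 2) := by
      have hind' := (hf.indepFun (h₁₂ m₀ m₀)).measure_inter_preimage_eq_mul {true} {true}
        (measurableSet_singleton _) (measurableSet_singleton _)
      have hmeas : MeasurableSet {ω | f (e₁ m₀) ω = true ∧ f (e₂ m₀) ω = true} :=
        (hm _ (measurableSet_singleton true)).inter (hm _ (measurableSet_singleton true))
      have h3 : P {ω | f (e₁ m₀) ω = true ∧ f (e₂ m₀) ω = true} = ENNReal.ofReal (q ^ 2) := by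
        rw [sq, ENNReal.ofReal_mul hq]
        exact hind'.trans (congr_arg₂ _ (hP _) (hP _))
      have h4 := prob_compl_eq_one_sub (μ := P) hmeas
      rw [h3, ← ENNReal.ofReal_one, ← ENNReal.ofReal_sub _ (sq_nonneg q)] at h4
      exact h4
    rw [Finset.card_insert_of_notMem hm₀, pow_succ, ← ih, ← hpair]
    convert! hmul using 2
    · ext ω
      simp only [Finset.forall_mem_insert, Set.mem_ofPred_eq, Set.mem_inter_iff, Set.mem_preimage,
        Subtype.forall]
      exact and_comm
    · congr 1
      ext ω
      simp only [Set.mem_ofPred_eq, Set.mem_preimage, Subtype.forall]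

namespace IsWeightedRandomGraph

lemma iIndepFun_present (h : IsWeightedRandomGraph P p μ α v) : iIndepFun α P :=
  h.indep_edges.comp (fun _ => Prod.fst) fun _ => measurable_fst

/-- With high probability, any two vertices at distance at least `g` are connected. -/
lemma measureReal_not_isConnectedAtScale_le [IsProbabilityMeasure P]
    (h : IsWeightedRandomGraph P p μ α v) (hp0 : 0 ≤ p) (hp1 : p ≤ 1) (n g : ℕ) (hg : 1 ≤ g) :
    P.real {ω | ¬IsConnectedAtScale n g fun e => α e ω} ≤
      ((n : ℝ) + 1) ^ 2 * (1 - p ^ 2) ^ (g - 1) := by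
  classical
  have hq0 : 0 ≤ 1 - p ^ 2 := by nlinarith
  have hq1 : 1 - p ^ 2 ≤ 1 := by nlinarith
  -- The event that no two-step path `i → m → j` is present. Different `m` use disjoint pairs of
  -- edges, and there are at least `g - 1` of them; a union bound over the pairs `(i, j)` concludes.
  let D : ℤ × ℤ → Set Ω := fun ij => {ω | ∀ m : Set.Ioo ij.1 ij.2,
    ¬(α ⟨(ij.1, m), m.2.1⟩ ω = true ∧ α ⟨(m, ij.2), m.2.2⟩ ω = true)}
  have hD : ∀ ij : ℤ × ℤ, ij.1 + g ≤ ij.2 → P.real (D ij) ≤ (1 - p ^ 2) ^ (g - 1) := by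
    intro ij hij
    have hpair := measure_no_pair h.iIndepFun_present h.measurable_present hp0 h.prob_present
      (e₁ := fun m : Set.Ioo ij.1 ij.2 => ⟨(ij.1, m), m.2.1⟩)
      (e₂ := fun m : Set.Ioo ij.1 ij.2 => ⟨(m, ij.2), m.2.2⟩)
      (fun m m' hmm => Subtype.ext (congr_arg (fun e : Edge => e.1.2) hmm))
      (fun m m' hmm => Subtype.ext (congr_arg (fun e : Edge => e.1.1) hmm))
      (fun m m' hmm => by
        have h1 : ij.1 = m' := congr_arg (fun e : Edge => e.1.1) hmm
        have h2 := m'.2.1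
        omega) Finset.univ
    have hset : D ij = {ω | ∀ m ∈ (Finset.univ : Finset (Set.Ioo ij.1 ij.2)),
        ¬(α ⟨(ij.1, m), m.2.1⟩ ω = true ∧ α ⟨(m, ij.2), m.2.2⟩ ω = true)} := by
      ext ω
      simp only [D, Finset.mem_univ, true_implies]
    rw [measureReal_def, hset, hpair, ENNReal.toReal_pow, ENNReal.toReal_ofReal hq0]
    refine pow_le_pow_of_le_one hq0 hq1 ?_
    rw [Finset.card_univ, ← Set.toFinset_card, Set.toFinset_Ioo, Int.card_Ioo]
    omega
  let I : Finset (ℤ × ℤ) := ((Finset.Icc (0 : ℤ) n) ×ˢ (Finset.Icc (0 : ℤ) n)).filter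
    fun ij => ij.1 + g ≤ ij.2
  have hsub : {ω | ¬IsConnectedAtScale n g fun e => α e ω} ⊆ ⋃ ij ∈ I, D ij := by
    intro ω hω
    by_contra hcon
    refine hω fun i j hi hj hij => ?_
    have hI : (i, j) ∈ I := by
      simp only [I, Finset.mem_filter, Finset.mem_product, Finset.mem_Icc]
      omega
    have hD' : ω ∉ D (i, j) := fun hmem => hcon (Set.mem_biUnion hI hmem)
    simp only [D, Set.mem_ofPred_eq, not_forall, not_not] at hD'
    obtain ⟨m, h1, h2⟩ := hD'
    refine ⟨[⟨(i, m), m.2.1⟩, ⟨(m, j), m.2.2⟩], ⟨rfl, rfl, rfl⟩, ?_⟩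
    intro e he
    simp only [List.mem_cons, List.not_mem_nil, or_false] at he
    rcases he with rfl | rfl
    exacts [h1, h2]
  calc P.real {ω | ¬IsConnectedAtScale n g fun e => α e ω} ≤ P.real (⋃ ij ∈ I, D ij) :=
        measureReal_mono hsub (measure_ne_top _ _)
    _ ≤ ∑ ij ∈ I, P.real (D ij) := measureReal_biUnion_finset_le _ _
    _ ≤ ∑ _ij ∈ I, (1 - p ^ 2) ^ (g - 1) :=
        Finset.sum_le_sum fun ij hij => hD ij (Finset.mem_filter.1 hij).2
    _ = (I.card : ℝ) * (1 - p ^ 2) ^ (g - 1) := by rw [Finset.sum_const, nsmul_eq_mul]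
    _ ≤ ((n : ℝ) + 1) ^ 2 * (1 - p ^ 2) ^ (g - 1) := by
        refine mul_le_mul_of_nonneg_right ?_ (pow_nonneg hq0 _)
        have hI := Finset.card_filter_le ((Finset.Icc (0 : ℤ) n) ×ˢ (Finset.Icc (0 : ℤ) n))
          fun ij => ij.1 + g ≤ ij.2
        rw [Finset.card_product, Int.card_Icc] at hI
        have hI' : I.card ≤ (n + 1) * (n + 1) := by
          refine hI.trans_eq ?_
          congr 1
        rw [sq]
        exact_mod_cast hI'

lemma measurable_thinning : Measurable fun z : Bool × ℝ => if z.1 = true then z.2 else 0 :=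
  Measurable.ite (measurable_fst (measurableSet_singleton true)) measurable_snd measurable_const

lemma aemeasurable_thinnedWeight (h : IsWeightedRandomGraph P p μ α v) (e : Edge) :
    AEMeasurable (thinnedWeight α v e) P :=
  measurable_thinning.comp_aemeasurable
    ((h.measurable_present e).aemeasurable.prodMk (h.law_weight e).aemeasurable)

lemma map_thinnedWeight [IsProbabilityMeasure P] (h : IsWeightedRandomGraph P p μ α v)
    (hp0 : 0 ≤ p) (e : Edge) : P.map (thinnedWeight α v e) = thinnedLaw p μ := by
  have hv := (h.law_weight e).aemeasurable
  have ht : MeasurableSet {ω | α e ω = true} := h.measurable_present e (measurableSet_singleton _)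
  ext B hB
  have hsplit : P {ω | thinnedWeight α v e ω ∈ B} =
      P ({ω | α e ω = true} ∩ v e ⁻¹' B) + P ({ω | α e ω = true}ᶜ ∩ {_ω | (0 : ℝ) ∈ B}) := by
    rw [← measure_inter_add_sdiff _ ht]
    congr 2
    · ext ω
      by_cases hω : α e ω = true <;> simp [thinnedWeight, hω]
    · ext ω
      by_cases hω : α e ω = true <;> simp [thinnedWeight, hω]
  have h1 : P ({ω | α e ω = true} ∩ v e ⁻¹' B) = ENNReal.ofReal p * μ B := by
    have := (h.indep_present_weight e).measure_inter_preimage_eq_mul {true} B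
      (measurableSet_singleton _) hB
    rw [← (h.law_weight e).map_eq, Measure.map_apply_of_aemeasurable hv hB, ← h.prob_present e]
    exact this
  have h2 : P {ω | α e ω = true}ᶜ = ENNReal.ofReal (1 - p) := by
    rw [prob_compl_eq_one_sub ht, h.prob_present e, ENNReal.ofReal_sub _ hp0, ENNReal.ofReal_one]
  rw [Measure.map_apply_of_aemeasurable (h.aemeasurable_thinnedWeight e) hB]
  refine hsplit.trans ?_
  rw [h1, thinnedLaw, Measure.add_apply, Measure.smul_apply, Measure.smul_apply,
    Measure.dirac_apply' _ hB, smul_eq_mul, smul_eq_mul]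
  congr 1
  by_cases h0 : (0 : ℝ) ∈ B <;> simp [h0, h2]

lemma map_thinnedWeight_box [IsProbabilityMeasure P] (h : IsWeightedRandomGraph P p μ α v)
    (hp0 : 0 ≤ p) (n : ℕ) :
    P.map (fun ω (e : boxEdges n) => thinnedWeight α v e ω) =
      Measure.pi fun _ => thinnedLaw p μ := by
  have hind : iIndepFun (thinnedWeight α v) P :=
    h.indep_edges.comp (fun _ z => if z.1 = true then z.2 else 0) fun _ => measurable_thinning
  have hind' : iIndepFun (fun e : boxEdges n => thinnedWeight α v e) P :=
    hind.precomp Subtype.val_injective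
  have := iIndepFun.map_fun_eq_pi_map (f := fun (e : boxEdges n) => thinnedWeight α v e)
    (fun e => h.aemeasurable_thinnedWeight e) hind'
  refine this.trans ?_
  congr 1
  ext1 e
  exact h.map_thinnedWeight hp0 e

end IsWeightedRandomGraph

end RandomGraph

/-! ### Small weights along a chain -/

section SmallWeights

/-- The total weight of the edges of weight at most `δ` which are short compared to their weight. -/
noncomputable def shortWeight (n : ℕ) (σ δ : ℝ) (x : Edge → ℝ) : ℝ :=
  ∑ e ∈ boxEdges n,
    if x e ≤ δ ∧ ((e.1.2 - e.1.1 : ℤ) : ℝ) ≤ n * x e ^ σ then x e else 0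

/-- Along a chain, long edges of small weight contribute little because their lengths add up to at
most `n`. -/
lemma IsEdgeChain.sum_small_le {n : ℕ} (hn : 0 < n) {A : Finset Edge} (hA : IsEdgeChain A)
    (hbox : A ⊆ boxEdges n) {x : Edge → ℝ} (hx : ∀ e, 0 ≤ x e) {σ δ : ℝ}
    (hσ1 : σ < 1) (hδ : 0 < δ) :
    ∑ e ∈ A with x e ≤ δ, x e ≤ δ ^ (1 - σ) + shortWeight n σ δ x := by
  have hn' : (0 : ℝ) < n := by exact_mod_cast hn
  have hδσ : 0 ≤ δ ^ (1 - σ) := Real.rpow_nonneg hδ.le _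
  -- An edge that is not short has `x ^ σ` below its relative length, so `x = x ^ (1 - σ) * x ^ σ`
  -- is at most `δ ^ (1 - σ)` times that length; relative lengths sum to at most `1` along the
  -- chain.
  have hpt : ∀ e : Edge, (if x e ≤ δ then x e else 0) ≤
      δ ^ (1 - σ) * (((e.1.2 - e.1.1 : ℤ) : ℝ) / n) +
        if x e ≤ δ ∧ ((e.1.2 - e.1.1 : ℤ) : ℝ) ≤ n * x e ^ σ then x e else 0 := by
    intro e
    have hlen : (0 : ℝ) ≤ ((e.1.2 - e.1.1 : ℤ) : ℝ) := by
      have := e.2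
      exact_mod_cast (by omega : 0 ≤ e.1.2 - e.1.1)
    have h0 : 0 ≤ δ ^ (1 - σ) * (((e.1.2 - e.1.1 : ℤ) : ℝ) / n) := by positivity
    by_cases h1 : x e ≤ δ
    · by_cases h2 : ((e.1.2 - e.1.1 : ℤ) : ℝ) ≤ n * x e ^ σ
      · simp only [h1, h2, and_self, if_true]
        linarith
      · simp only [h1, h2, and_false, if_true, if_false, add_zero]
        have h3 : x e ^ σ ≤ ((e.1.2 - e.1.1 : ℤ) : ℝ) / n := by
          rw [le_div_iff₀ hn', mul_comm]
          exact (not_le.1 h2).le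
        have h4 : x e = x e ^ (1 - σ) * x e ^ σ := by
          rw [← Real.rpow_add' (hx e) (by simp)]
          simp
        calc x e = x e ^ (1 - σ) * x e ^ σ := h4
          _ ≤ δ ^ (1 - σ) * (((e.1.2 - e.1.1 : ℤ) : ℝ) / n) :=
            mul_le_mul (Real.rpow_le_rpow (hx e) h1 (by linarith)) h3
              (Real.rpow_nonneg (hx e) _) hδσ
    · simp only [h1, false_and, if_false, add_zero]
      exact h0
  have hlen : (∑ e ∈ A, ((e.1.2 - e.1.1 : ℤ) : ℝ)) ≤ n := by
    exact_mod_cast hA.sum_length_le hbox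
  calc ∑ e ∈ A with x e ≤ δ, x e = ∑ e ∈ A, if x e ≤ δ then x e else 0 := Finset.sum_filter _ _
    _ ≤ ∑ e ∈ A, (δ ^ (1 - σ) * (((e.1.2 - e.1.1 : ℤ) : ℝ) / n) +
        if x e ≤ δ ∧ ((e.1.2 - e.1.1 : ℤ) : ℝ) ≤ n * x e ^ σ then x e else 0) :=
      Finset.sum_le_sum fun e _ => hpt e
    _ = δ ^ (1 - σ) * ((∑ e ∈ A, ((e.1.2 - e.1.1 : ℤ) : ℝ)) / n) +
        ∑ e ∈ A, if x e ≤ δ ∧ ((e.1.2 - e.1.1 : ℤ) : ℝ) ≤ n * x e ^ σ then x e else 0 := by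
      rw [Finset.sum_add_distrib, Finset.sum_div, Finset.mul_sum]
    _ ≤ δ ^ (1 - σ) * 1 + shortWeight n σ δ x := by
      refine add_le_add (mul_le_mul_of_nonneg_left ((div_le_one hn').2 hlen) hδσ) ?_
      refine Finset.sum_le_sum_of_subset_of_nonneg hbox fun e _ _ => ?_
      split_ifs
      exacts [hx e, le_rfl]
    _ = _ := by rw [mul_one]

lemma card_short_le (n : ℕ) {L : ℝ} (hL : 0 ≤ L) :
    (((boxEdges n).filter fun e => ((e.1.2 - e.1.1 : ℤ) : ℝ) ≤ L).card : ℝ) ≤ n * L := by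
  have hcard : ((boxEdges n).filter fun e => ((e.1.2 - e.1.1 : ℤ) : ℝ) ≤ L).card ≤
      (Finset.Ico (0 : ℤ) n ×ˢ Finset.Icc (1 : ℤ) ⌊L⌋).card := by
    refine Finset.card_le_card_of_injOn (fun e => (e.1.1, e.1.2 - e.1.1)) (fun e he => ?_) ?_
    · obtain ⟨h1, h2⟩ := Finset.mem_filter.1 he
      have h3 := mem_boxEdges.1 h1
      have h4 := Int.le_floor.2 h2
      have h5 := e.2
      simp only [Finset.coe_product, Finset.coe_Ico, Finset.coe_Icc, Set.mem_prod, Set.mem_Ico,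
        Set.mem_Icc]
      omega
    · intro e _ f _ hef
      simp only [Prod.mk.injEq] at hef
      exact Subtype.ext (Prod.ext hef.1 (by omega))
  rw [Finset.card_product, Int.card_Ico, Int.card_Icc] at hcard
  have hfl : ((⌊L⌋ + 1 - 1).toNat : ℝ) ≤ L := by
    rw [add_sub_cancel_right]
    have h1 : ((⌊L⌋.toNat : ℤ) : ℝ) = (⌊L⌋ : ℝ) := by
      rw [Int.toNat_of_nonneg (Int.floor_nonneg.2 hL)]
    have h2 : (⌊L⌋.toNat : ℝ) = (⌊L⌋ : ℝ) := by exact_mod_cast h1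
    rw [h2]
    exact Int.floor_le L
  calc (((boxEdges n).filter fun e => ((e.1.2 - e.1.1 : ℤ) : ℝ) ≤ L).card : ℝ)
      ≤ (((n : ℤ) - 0).toNat * (⌊L⌋ + 1 - 1).toNat : ℕ) := by exact_mod_cast hcard
    _ = n * ((⌊L⌋ + 1 - 1).toNat : ℝ) := by
      push_cast
      simp
    _ ≤ n * L := by gcongr

/-- About `n * (n * y ^ σ)` edges are short for the weight `y`. A common `y` suffices because all
weights have the same law, so in expectation the sum over edges can be moved inside the integral. -/
lemma sum_short_le (n : ℕ) {σ δ y : ℝ} (hσ : 0 < σ) (hδ : 0 < δ) (hy : 0 ≤ y) :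
    (∑ e ∈ boxEdges n, if y ≤ δ ∧ ((e.1.2 - e.1.1 : ℤ) : ℝ) ≤ n * y ^ σ then y else 0) ≤
      (n : ℝ) ^ 2 * min y δ ^ (1 + σ) := by
  by_cases h : y ≤ δ
  · simp only [h, true_and, min_eq_left]
    rw [← Finset.sum_filter, Finset.sum_const, nsmul_eq_mul]
    have hys : 0 ≤ y ^ σ := Real.rpow_nonneg hy _
    have := mul_le_mul_of_nonneg_right (card_short_le n (L := n * y ^ σ) (by positivity)) hy
    refine this.trans_eq ?_
    rw [Real.rpow_add' hy (by linarith), Real.rpow_one]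
    ring
  · simp only [h, false_and, if_false, Finset.sum_const_zero]
    have : 0 ≤ min y δ := le_min hy hδ.le
    positivity

lemma lintegral_rpow_neg_Ioc {σ δ : ℝ} (hσ1 : σ < 1) (hδ : 0 < δ) :
    ∫⁻ t in Set.Ioc 0 δ, ENNReal.ofReal (t ^ (-σ)) = ENNReal.ofReal (δ ^ (1 - σ) / (1 - σ)) := by
  have hint : IntegrableOn (fun t : ℝ => t ^ (-σ)) (Set.Ioc 0 δ) :=
    (intervalIntegrable_iff_integrableOn_Ioc_of_le hδ.le).1
      (intervalIntegral.intervalIntegrable_rpow' (by linarith))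
  rw [← ofReal_integral_eq_lintegral_ofReal hint
    (ae_restrict_of_forall_mem measurableSet_Ioc fun t ht => Real.rpow_nonneg ht.1.le _),
    ← intervalIntegral.integral_of_le hδ.le, integral_rpow (Or.inl (by linarith))]
  rw [Real.zero_rpow (by linarith), sub_zero, neg_add_eq_sub]

/-- The truncated moment of order `1 + σ` of a law whose rescaled tail is bounded by
`C * t ^ (-2 σ)`. -/
lemma lintegral_min_rpow_le {ρ : Measure ℝ} [IsProbabilityMeasure ρ] (h0 : ρ (Set.Iio 0) = 0)
    {N C b σ δ : ℝ} (hN : 0 ≤ N) (hC : 0 ≤ C) (hb : 0 < b) (hσ : 0 < σ) (hσ1 : σ < 1)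
    (hδ : 0 < δ) (hδ1 : δ ≤ 1)
    (htail : ∀ x, 0 < x → x ≤ 1 → N * tail ρ (x * b) ≤ C * x ^ (-(2 * σ))) :
    ∫⁻ y, ENNReal.ofReal (N * min (y / b) δ ^ (1 + σ)) ∂ρ ≤
      ENNReal.ofReal ((1 + σ) * C / (1 - σ) * δ ^ (1 - σ)) := by
  have hnn : ∀ᵐ y ∂ρ, 0 ≤ min (y / b) δ := by
    have : ∀ᵐ y ∂ρ, y ∉ Set.Iio (0 : ℝ) := measure_eq_zero_iff_ae_notMem.1 h0
    filter_upwards [this] with y hy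
    exact le_min (div_nonneg (by simpa using hy) hb.le) hδ.le
  have hm : Measurable fun y : ℝ => min (y / b) δ := by fun_prop
  simp_rw [ENNReal.ofReal_mul hN]
  rw [lintegral_const_mul _ (by fun_prop),
    lintegral_rpow_eq_lintegral_meas_lt_mul ρ hnn hm.aemeasurable (by linarith : 0 < 1 + σ)]
  -- In the layer-cake formula the weight `t ^ σ` meets a tail of order `t ^ (-2 σ)`, leaving `t ^
  -- (-σ)`, which is integrable at `0` since `σ < 1`.
  have hpt : ∀ t ∈ Set.Ioi (0 : ℝ), ENNReal.ofReal N * (ρ {y | t < min (y / b) δ} *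
      ENNReal.ofReal (t ^ (1 + σ - 1))) ≤
      (Set.Ioc 0 δ).indicator (fun t => ENNReal.ofReal C * ENNReal.ofReal (t ^ (-σ))) t := by
    intro t ht
    have ht0 : 0 < t := ht
    by_cases htδ : t ≤ δ
    · rw [Set.indicator_of_mem (show t ∈ Set.Ioc 0 δ from ⟨ht0, htδ⟩)]
      have h1 : ρ {y | t < min (y / b) δ} ≤ ENNReal.ofReal (tail ρ (t * b)) := by
        rw [tail_eq_measureReal, ofReal_measureReal]
        refine measure_mono fun y hy => ?_
        have hy' : t < min (y / b) δ := hy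
        exact (lt_div_iff₀ hb).1 (hy'.trans_le (min_le_left _ _))
      have hts : 0 ≤ t ^ (1 + σ - 1) := Real.rpow_nonneg ht0.le _
      calc ENNReal.ofReal N * (ρ {y | t < min (y / b) δ} * ENNReal.ofReal (t ^ (1 + σ - 1)))
          ≤ ENNReal.ofReal N * (ENNReal.ofReal (tail ρ (t * b)) *
            ENNReal.ofReal (t ^ (1 + σ - 1))) := by gcongr
        _ = ENNReal.ofReal (N * tail ρ (t * b) * t ^ (1 + σ - 1)) := by
          rw [← mul_assoc, ← ENNReal.ofReal_mul hN,
            ← ENNReal.ofReal_mul (mul_nonneg hN (tail_nonneg _ _))]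
        _ ≤ ENNReal.ofReal (C * t ^ (-(2 * σ)) * t ^ (1 + σ - 1)) := by
          refine ENNReal.ofReal_le_ofReal (mul_le_mul_of_nonneg_right ?_ hts)
          exact htail t ht0 (htδ.trans hδ1)
        _ = ENNReal.ofReal C * ENNReal.ofReal (t ^ (-σ)) := by
          rw [mul_assoc, ← Real.rpow_add ht0, ENNReal.ofReal_mul hC]
          congr 3
          ring
    · have : {y | t < min (y / b) δ} = ∅ := by
        ext y
        simp only [Set.mem_ofPred_eq, Set.mem_empty_iff_false, iff_false, not_lt]
        exact (min_le_right _ _).trans (not_le.1 htδ).le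
      rw [this]
      simp
  have hmt : Measurable fun t => ρ {y | t < min (y / b) δ} := by
    have : Antitone fun t => ρ {y | t < min (y / b) δ} := fun t t' htt =>
      measure_mono fun y hy => lt_of_le_of_lt htt hy
    exact this.measurable
  calc ENNReal.ofReal N * (ENNReal.ofReal (1 + σ) * ∫⁻ t in Set.Ioi 0,
        ρ {y | t < min (y / b) δ} * ENNReal.ofReal (t ^ (1 + σ - 1)))
      = ENNReal.ofReal (1 + σ) * ∫⁻ t in Set.Ioi 0, ENNReal.ofReal N *
        (ρ {y | t < min (y / b) δ} * ENNReal.ofReal (t ^ (1 + σ - 1))) := by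
        have hmp : Measurable fun t : ℝ => ENNReal.ofReal (t ^ (1 + σ - 1)) := by fun_prop
        have hmm : Measurable fun t => ρ {y | t < min (y / b) δ} *
            ENNReal.ofReal (t ^ (1 + σ - 1)) := hmt.mul hmp
        rw [lintegral_const_mul _ hmm]
        ring
    _ ≤ ENNReal.ofReal (1 + σ) * ∫⁻ t in Set.Ioi 0,
        (Set.Ioc 0 δ).indicator (fun t => ENNReal.ofReal C * ENNReal.ofReal (t ^ (-σ))) t := by
        gcongr 1
        exact setLIntegral_mono' measurableSet_Ioi hpt
    _ ≤ ENNReal.ofReal (1 + σ) * ∫⁻ t,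
        (Set.Ioc 0 δ).indicator (fun t => ENNReal.ofReal C * ENNReal.ofReal (t ^ (-σ))) t := by
        gcongr 1
        exact setLIntegral_le_lintegral _ _
    _ = ENNReal.ofReal ((1 + σ) * C / (1 - σ) * δ ^ (1 - σ)) := by
        rw [lintegral_indicator measurableSet_Ioc, lintegral_const_mul _ (by fun_prop),
          lintegral_rpow_neg_Ioc hσ1 hδ, ← ENNReal.ofReal_mul hC,
          ← ENNReal.ofReal_mul (by linarith)]
        congr 1
        ring

lemma lintegral_shortWeight_le {Ω : Type*} [MeasurableSpace Ω] {P : Measure Ω} {ρ : Measure ℝ}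
    [IsProbabilityMeasure ρ] (h0 : ρ (Set.Iio 0) = 0) {n : ℕ} {X : Edge → Ω → ℝ}
    (hX : ∀ e, Measurable (X e)) (hXρ : ∀ e ∈ boxEdges n, P.map (X e) = ρ)
    {C b σ δ : ℝ} (hC : 0 ≤ C) (hb : 0 < b) (hσ : 0 < σ) (hσ1 : σ < 1) (hδ : 0 < δ) (hδ1 : δ ≤ 1)
    (hXnn : ∀ e ω, 0 ≤ X e ω)
    (htail : ∀ x, 0 < x → x ≤ 1 → (n : ℝ) ^ 2 * tail ρ (x * b) ≤ C * x ^ (-(2 * σ))) :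
    ∫⁻ ω, ENNReal.ofReal (shortWeight n σ δ fun e => X e ω / b) ∂P ≤
      ENNReal.ofReal ((1 + σ) * C / (1 - σ) * δ ^ (1 - σ)) := by
  refine le_trans ?_ (lintegral_min_rpow_le h0 (sq_nonneg (n : ℝ)) hC hb hσ hσ1 hδ hδ1 htail)
  let φ : Edge → ℝ → ℝ := fun e y =>
    if y / b ≤ δ ∧ ((e.1.2 - e.1.1 : ℤ) : ℝ) ≤ n * (y / b) ^ σ then y / b else 0
  have hφ : ∀ e, Measurable (φ e) := fun e => by
    have hm1 : Measurable fun y : ℝ => y / b := by fun_prop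
    have hm2 : Measurable fun y : ℝ => (n : ℝ) * (y / b) ^ σ := by fun_prop
    exact Measurable.ite ((measurableSet_le hm1 measurable_const).inter
      (measurableSet_le measurable_const hm2)) hm1 measurable_const
  have h1 : ∀ ω, ENNReal.ofReal (shortWeight n σ δ fun e => X e ω / b) =
      ∑ e ∈ boxEdges n, ENNReal.ofReal (φ e (X e ω)) := fun ω => by
    refine ENNReal.ofReal_sum_of_nonneg fun e _ => ?_
    split_ifs
    exacts [div_nonneg (hXnn e ω) hb.le, le_rfl]
  simp_rw [h1]
  have hφX : ∀ e, Measurable fun ω => ENNReal.ofReal (φ e (X e ω)) := fun e =>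
    ((hφ e).comp (hX e)).ennreal_ofReal
  rw [lintegral_finsetSum _ fun e _ => hφX e]
  have h2 : ∀ e ∈ boxEdges n, ∫⁻ ω, ENNReal.ofReal (φ e (X e ω)) ∂P =
      ∫⁻ y, ENNReal.ofReal (φ e y) ∂ρ := fun e he => by
    rw [← hXρ e he, lintegral_map (hφ e).ennreal_ofReal (hX e)]
  rw [Finset.sum_congr rfl h2, ← lintegral_finsetSum _ fun e _ => (hφ e).ennreal_ofReal]
  refine lintegral_mono_ae ?_
  have : ∀ᵐ y ∂ρ, y ∉ Set.Iio (0 : ℝ) := measure_eq_zero_iff_ae_notMem.1 h0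
  filter_upwards [this] with y hy
  have hy0 : 0 ≤ y / b := div_nonneg (by simpa using hy) hb.le
  rw [← ENNReal.ofReal_sum_of_nonneg]
  · exact ENNReal.ofReal_le_ofReal (sum_short_le n hσ hδ hy0)
  · intro e _
    simp only [φ]
    split_ifs
    exacts [hy0, le_rfl]

end SmallWeights

/-! ### Chains of the coupled models versus compatible sets -/

lemma eventually_floor_ne {x y : ℝ} (h : x ≠ y) :
    ∀ᶠ n : ℕ in atTop, ⌊((n : ℝ) + 1) * x⌋ ≠ ⌊((n : ℝ) + 1) * y⌋ := by
  have hlim : Tendsto (fun n : ℕ => ((n : ℝ) + 1) * |x - y|) atTop atTop :=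
    (tendsto_atTop_add_const_right _ 1 tendsto_natCast_atTop_atTop).atTop_mul_const
      (abs_pos.2 (sub_ne_zero.2 h))
  filter_upwards [hlim.eventually_ge_atTop 1] with n hn heq
  have h1 := Int.abs_sub_lt_one_of_floor_eq_floor heq
  rw [← mul_sub, abs_mul, abs_of_nonneg (by positivity)] at h1
  linarith

lemma floor_add_le_floor {x y η : ℝ} {g : ℤ} (hxy : x + η ≤ y) (hg : (g : ℝ) ≤ η) :
    ⌊x⌋ + g ≤ ⌊y⌋ := by
  rw [Int.le_floor]
  push_cast
  linarith [Int.floor_le x]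

lemma eventually_add_le {a b : ℝ} (h : a < b) : ∀ᶠ η in 𝓝[>] (0 : ℝ), a + η ≤ b := by
  have : ∀ᶠ η in 𝓝[>] (0 : ℝ), η < b - a :=
    nhdsWithin_le_nhds (eventually_lt_nhds (sub_pos.2 h))
  filter_upwards [this] with η hη
  linarith

section CoupledChains

variable {Ω : Type*} {W U V : ℕ → Ω → ℝ}

/-- All the endpoints of the edges of the continuous model are different. -/
def HasDistinctEndpoints (U V : ℕ → Ω → ℝ) (ω : Ω) : Prop :=
  Function.Injective fun k => Sum.elim U V k ω

lemma HasDistinctEndpoints.contEdge_lt {ω : Ω} (h : HasDistinctEndpoints U V ω) (i : ℕ) :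
    (contEdge U V i ω).1 < (contEdge U V i ω).2 := by
  have : U i ω ≠ V i ω := fun heq => by
    have := h (a₁ := Sum.inl i) (a₂ := Sum.inr i) heq
    simp at this
  exact min_lt_max.2 this

lemma exists_eq_endpoint_fst (U V : ℕ → Ω → ℝ) (i : ℕ) (ω : Ω) :
    (contEdge U V i ω).1 = Sum.elim U V (.inl i) ω ∨
      (contEdge U V i ω).1 = Sum.elim U V (.inr i) ω := min_choice _ _

lemma exists_eq_endpoint_snd (U V : ℕ → Ω → ℝ) (i : ℕ) (ω : Ω) :
    (contEdge U V i ω).2 = Sum.elim U V (.inl i) ω ∨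
      (contEdge U V i ω).2 = Sum.elim U V (.inr i) ω := max_choice _ _

lemma HasDistinctEndpoints.snd_ne_fst {ω : Ω} (h : HasDistinctEndpoints U V ω) {i j : ℕ}
    (hij : i ≠ j) : (contEdge U V i ω).2 ≠ (contEdge U V j ω).1 := by
  intro heq
  rcases exists_eq_endpoint_snd U V i ω with h1 | h1 <;>
  rcases exists_eq_endpoint_fst U V j ω with h2 | h2 <;>
  · rw [h1, h2] at heq
    have := h heq
    simp [hij] at this

lemma cellOf_eq (n i : ℕ) (ω : Ω) : cellOf n (U i ω) (V i ω) =
    (⌊((n : ℝ) + 1) * (contEdge U V i ω).1⌋, ⌊((n : ℝ) + 1) * (contEdge U V i ω).2⌋) := rfl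

namespace IsRegularModel

variable [MeasurableSpace Ω] {P : Measure Ω}

lemma contEdge_mem (h : IsRegularModel P W U V) (i : ℕ) (ω : Ω) :
    0 < (contEdge U V i ω).1 ∧ (contEdge U V i ω).2 < 1 :=
  ⟨lt_min (h.U_mem i ω).1 (h.V_mem i ω).1, max_lt (h.U_mem i ω).2 (h.V_mem i ω).2⟩

lemma ae_hasDistinctEndpoints (h : IsRegularModel P W U V) :
    ∀ᵐ ω ∂P, HasDistinctEndpoints U V ω := by
  have := h.isProbabilityMeasure
  have hm : ∀ k, Measurable (Sum.elim U V k) := by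
    rintro (k | k)
    exacts [h.measurable_U k, h.measurable_V k]
  have hlaw : ∀ k, P.map (Sum.elim U V k) = unif := by
    rintro (k | k)
    exacts [(h.law_U k).map_eq, (h.law_V k).map_eq]
  have hpair : ∀ k l : ℕ ⊕ ℕ, k ≠ l → ∀ᵐ ω ∂P, Sum.elim U V k ω ≠ Sum.elim U V l ω := by
    intro k l hkl
    have hind : IndepFun (Sum.elim U V k) (Sum.elim U V l) P :=
      h.indep.indepFun (i := Sum.inr k) (j := Sum.inr l) (by simpa using hkl)
    have hmap := (indepFun_iff_map_prod_eq_prod_map_map (hm k).aemeasurable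
      (hm l).aemeasurable).1 hind
    rw [hlaw, hlaw] at hmap
    have hdiag : MeasurableSet {z : ℝ × ℝ | z.1 = z.2} :=
      measurableSet_eq_fun measurable_fst measurable_snd
    have hnull : (unif.prod unif) {z : ℝ × ℝ | z.1 = z.2} = 0 := by
      rw [Measure.measure_prod_null hdiag]
      refine ae_of_all _ fun x => ?_
      have : Prod.mk x ⁻¹' {z : ℝ × ℝ | z.1 = z.2} = {x} := by
        ext y
        simp [eq_comm]
      simp [this]
    rw [← hmap, Measure.map_apply ((hm k).prodMk (hm l)) hdiag] at hnull
    exact measure_eq_zero_iff_ae_notMem.1 hnull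
  have hall : ∀ᵐ ω ∂P, ∀ k l : ℕ ⊕ ℕ, k ≠ l → Sum.elim U V k ω ≠ Sum.elim U V l ω := by
    rw [ae_all_iff]
    intro k
    rw [ae_all_iff]
    intro l
    by_cases hkl : k = l
    · simp [hkl]
    · filter_upwards [hpair k l hkl] with ω hω _
      exact hω
  filter_upwards [hall] with ω hω k l hkl
  by_contra hne
  exact hω k l hne hkl

/-- A finite compatible set of edges of the continuous model gives rise to separated chains of the
same asymptotic weight in the coupled discrete models. -/
lemma exists_separatedChain (h : IsRegularModel P W U V) {ρ : Measure ℝ} [IsProbabilityMeasure ρ]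
    {b : ℕ → ℝ} {s : ℝ} (hρ : IsTailScaling ρ b s) (hs : 0 < s) {ω : Ω}
    (hω : HasDistinctEndpoints U V ω) {B : Finset ℕ} (hB : (B : Set ℕ) ∈ admissible U V ω) {c : ℝ}
    (hc : c < ∑ i ∈ B, contWeight s W i ω) :
    ∃ j : ℕ, ∀ᶠ n : ℕ in atTop, ∃ A, IsSeparatedChain n (n / (j + 1)) A ∧
      c * b n < ∑ e ∈ A, coupledWeight ρ W U V n e ω := by
  classical
  -- As all end points differ and lie strictly inside the unit interval, the finitely many
  -- inequalities are strict and leave a common slack `η`. The gap is then `n / (j + 1)` with `1 /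
  -- (j + 1) < η`.
  have hη : ∀ᶠ η in 𝓝[>] (0 : ℝ), 0 < η ∧ (∀ i ∈ B, 0 + η ≤ (contEdge U V i ω).1 ∧
      (contEdge U V i ω).2 + η ≤ 1 ∧ (contEdge U V i ω).1 + η ≤ (contEdge U V i ω).2) ∧
      ∀ i ∈ B, ∀ k ∈ B, i ≠ k → (contEdge U V i ω).2 + η ≤ (contEdge U V k ω).1 ∨
        (contEdge U V k ω).2 + η ≤ (contEdge U V i ω).1 := by
    have hpos : ∀ᶠ η in 𝓝[>] (0 : ℝ), 0 < η := self_mem_nhdsWithin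
    refine hpos.and (Filter.Eventually.and ?_ ?_)
    · exact (Filter.eventually_all_finset B).2 fun i _ =>
        (eventually_add_le (h.contEdge_mem i ω).1).and
        ((eventually_add_le (h.contEdge_mem i ω).2).and (eventually_add_le (hω.contEdge_lt i)))
    · refine (Filter.eventually_all_finset B).2 fun i hi =>
        (Filter.eventually_all_finset B).2 fun k hk => ?_
      by_cases hik : i = k
      · exact Eventually.of_forall fun _ hcon => absurd hik hcon
      · rcases hB hi hk hik with hcomp | hcomp
        · filter_upwards [eventually_add_le (hcomp.lt_of_ne (hω.snd_ne_fst hik))] with η hη _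
          exact Or.inl hη
        · filter_upwards [eventually_add_le (hcomp.lt_of_ne (hω.snd_ne_fst (Ne.symm hik)))]
            with η hη _
          exact Or.inr hη
  obtain ⟨η, hη0, hη1, hη2⟩ := hη.exists
  obtain ⟨j, hj⟩ := exists_nat_one_div_lt hη0
  refine ⟨j, ?_⟩
  have hlim : Tendsto (fun n : ℕ => ∑ i ∈ B,
      quantile ρ (Real.exp (-(2 / ((n : ℝ) + 1) ^ 2 * arrival W i ω))) / b n) atTop
      (𝓝 (∑ i ∈ B, contWeight s W i ω)) :=
    tendsto_finsetSum _ fun i _ => hρ.tendsto_quantile hs (h.arrival_pos i ω)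
  have hNη : Tendsto (fun n : ℕ => ((n : ℝ) + 1) * η) atTop atTop :=
    (tendsto_atTop_add_const_right _ 1 tendsto_natCast_atTop_atTop).atTop_mul_const hη0
  filter_upwards [hlim.eventually (eventually_gt_nhds hc), hρ.tendsto_atTop.eventually_gt_atTop 0,
    hNη.eventually_ge_atTop 1] with n hn hbn hN
  have hN0 : (0 : ℝ) ≤ (n : ℝ) + 1 := by positivity
  set g : ℕ := n / (j + 1) with hg
  have hgn : ((g : ℤ) : ℝ) ≤ n * η := by
    have h1 : (g : ℝ) ≤ n / ((j + 1 : ℕ) : ℝ) := Nat.cast_div_le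
    have h2 : (n : ℝ) / ((j + 1 : ℕ) : ℝ) = n * (1 / ((j : ℝ) + 1)) := by
      push_cast
      ring
    rw [h2] at h1
    rw [Int.cast_natCast]
    exact h1.trans (mul_le_mul_of_nonneg_left hj.le (Nat.cast_nonneg n))
  have hgN : ((g : ℤ) : ℝ) ≤ ((n : ℝ) + 1) * η := by
    linarith [hgn, (show 0 < η from hη0), add_mul (n : ℝ) 1 η]
  clear_value g
  have hscale : ∀ {x y : ℝ}, x + η ≤ y →
      ((n : ℝ) + 1) * x + ((n : ℝ) + 1) * η ≤ ((n : ℝ) + 1) * y := fun hxy => by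
    rw [← mul_add]
    exact mul_le_mul_of_nonneg_left hxy hN0
  have hcell : ∀ i ∈ B, (cellOf n (U i ω) (V i ω)).1 < (cellOf n (U i ω) (V i ω)).2 := by
    intro i hi
    rw [cellOf_eq]
    have := floor_add_le_floor (g := 1) (hscale (hη1 i hi).2.2) (by exact_mod_cast hN)
    dsimp only
    omega
  let E : ℕ → Edge := fun i =>
    if hi : (cellOf n (U i ω) (V i ω)).1 < (cellOf n (U i ω) (V i ω)).2 then ⟨_, hi⟩
    else ⟨(0, 1), one_pos⟩
  have hE : ∀ i ∈ B, (E i).1 = cellOf n (U i ω) (V i ω) := fun i hi => by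
    simp only [E, dif_pos (hcell i hi)]
  have hsep : ∀ i ∈ B, ∀ k ∈ B, i ≠ k → (E i).1.2 + g ≤ (E k).1.1 ∨ (E k).1.2 + g ≤ (E i).1.1 := by
    intro i hi k hk hik
    rw [hE i hi, hE k hk, cellOf_eq, cellOf_eq]
    exact (hη2 i hi k hk hik).imp (fun h => floor_add_le_floor (hscale h) hgN)
      (fun h => floor_add_le_floor (hscale h) hgN)
  have hinj : Set.InjOn E B := by
    intro i hi k hk hik
    by_contra hne
    have h1 := hsep i hi k hk hne
    have h2 := (E k).2
    rw [hik] at h1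
    omega
  refine ⟨B.image E, ⟨?_, ?_⟩, ?_⟩
  · intro e he
    obtain ⟨i, hi, rfl⟩ := Finset.mem_image.1 he
    rw [hE i hi, cellOf_eq]
    obtain ⟨h1, h2, -⟩ := hη1 i hi
    constructor
    · have := floor_add_le_floor (hscale h1) hgN
      simpa using this
    · have h3 := hscale h2
      -- The bound `g ≤ n * η`, rather than `(n + 1) * η`, makes this strict, so that the right gap
      -- ends at `n` and not at `n + 1`.
      have h4 : ((⌊((n : ℝ) + 1) * (contEdge U V i ω).2⌋ + g : ℤ) : ℝ) < ((n + 1 : ℤ) : ℝ) := by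
        push_cast at hgn ⊢
        have h5 := Int.floor_le (((n : ℝ) + 1) * (contEdge U V i ω).2)
        have h6 : 0 < η := hη0
        linarith [add_mul (n : ℝ) 1 η]
      have h5 : ⌊((n : ℝ) + 1) * (contEdge U V i ω).2⌋ + g < n + 1 := by exact_mod_cast h4
      dsimp only
      omega
  · intro e he f hf hne
    obtain ⟨i, hi, rfl⟩ := Finset.mem_image.1 he
    obtain ⟨k, hk, rfl⟩ := Finset.mem_image.1 hf
    exact hsep i hi k hk fun hik => hne (congr_arg E hik)
  · rw [Finset.sum_image hinj]
    rw [← Finset.sum_div, lt_div_iff₀ hbn] at hn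
    refine hn.trans_le (Finset.sum_le_sum fun i hi => ?_)
    -- An earlier point in the same cell could only increase the mark, so an inequality is enough.
    have hmark := h.le_mark (hE i hi).symm
    have hmem := h.exp_arrival_mem n i ω
    exact quantile_monotoneOn ρ hmem ⟨hmem.1.trans_le hmark, h.mark_lt_one n _ ω⟩ hmark

/-- The large weights in a chain of the coupled discrete model are asymptotically dominated by a
finite compatible set of edges of the continuous model. -/
lemma exists_compatible_of_chain (h : IsRegularModel P W U V) {ρ : Measure ℝ}
    [IsProbabilityMeasure ρ] {b : ℕ → ℝ} {s : ℝ} (hρ : IsTailScaling ρ b s) (hs : 0 < s) {ω : Ω}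
    (hω : HasDistinctEndpoints U V ω) (harr : Tendsto (fun k => arrival W k ω) atTop atTop)
    {δ : ℝ} (hδ : 0 < δ) :
    ∃ k : ℕ, ∀ ε > 0, ∀ᶠ n : ℕ in atTop, ∀ A : Finset Edge, IsEdgeChain A →
      ∃ B ⊆ Finset.range k, (B : Set ℕ) ∈ admissible U V ω ∧
        ∑ e ∈ A with δ < coupledWeight ρ W U V n e ω / b n, coupledWeight ρ W U V n e ω / b n ≤
          ∑ i ∈ B, contWeight s W i ω + ε := by
  classical
  have hlim : ∀ i, Tendsto (fun n : ℕ =>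
      quantile ρ (Real.exp (-(2 / ((n : ℝ) + 1) ^ 2 * arrival W i ω))) / b n) atTop
      (𝓝 (contWeight s W i ω)) := fun i => hρ.tendsto_quantile hs (h.arrival_pos i ω)
  have hM : Tendsto (fun k => contWeight s W k ω) atTop (𝓝 0) :=
    (tendsto_rpow_neg_atTop (one_div_pos.2 hs)).comp harr
  -- Once the `k`-th limiting weight is below `δ`, monotonicity makes all later points give weights
  -- below `δ` for large `n`. So large weights come from the first `k` points, with `k` independent
  -- of `ε`.
  obtain ⟨k, hk⟩ := (hM.eventually (eventually_lt_nhds hδ)).exists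
  refine ⟨k, fun ε hε => ?_⟩
  have hε' : 0 < ε / (k + 1) := by positivity
  have hclose : ∀ᶠ n : ℕ in atTop, ∀ i ∈ Finset.range k,
      quantile ρ (Real.exp (-(2 / ((n : ℝ) + 1) ^ 2 * arrival W i ω))) / b n ≤
        contWeight s W i ω + ε / (k + 1) :=
    (Filter.eventually_all_finset _).2 fun i _ =>
      (hlim i).eventually (eventually_le_nhds (by linarith))
  -- Compatibility of cells gives an inequality between floors, which implies that between the
  -- points unless the floors coincide; for large `n` they do not.
  have hfloor : ∀ᶠ n : ℕ in atTop, ∀ i ∈ Finset.range k, ∀ l ∈ Finset.range k, i ≠ l →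
      ⌊((n : ℝ) + 1) * (contEdge U V i ω).2⌋ ≠ ⌊((n : ℝ) + 1) * (contEdge U V l ω).1⌋ :=
    (Filter.eventually_all_finset _).2 fun i _ => (Filter.eventually_all_finset _).2 fun l _ => by
      by_cases hil : i = l
      · exact Eventually.of_forall fun _ hcon => absurd hil hcon
      · filter_upwards [eventually_floor_ne (hω.snd_ne_fst hil)] with n hn _
        exact hn
  filter_upwards [(hlim k).eventually (eventually_lt_nhds hk), hclose, hfloor,
    hρ.tendsto_atTop.eventually_gt_atTop 0] with n hn1 hn2 hn3 hbn A hA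
  set A' := A.filter fun e => δ < coupledWeight ρ W U V n e ω / b n with hA'
  have hex : ∀ e, e ∈ A' → ∃ i < k, cellOf n (U i ω) (V i ω) = e.1 ∧ coupledWeight ρ W U V n e ω =
      quantile ρ (Real.exp (-(2 / ((n : ℝ) + 1) ^ 2 * arrival W i ω))) := by
    intro e he
    have hlarge := (Finset.mem_filter.1 he).2
    have hpos : 0 < mark W U V n e ω := by
      refine (mark_nonneg W U V n e ω).lt_of_ne fun h0 => ?_
      -- A cell without points has mark `0`, and the default value of the quantile gives it weight
      -- `0`, which is not large.
      rw [coupledWeight, ← h0, quantile, if_neg (by simp), zero_div] at hlarge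
      exact absurd hδ (not_lt.2 hlarge.le)
    obtain ⟨i, hi1, hi2⟩ := h.exists_mark_eq hpos
    refine ⟨i, ?_, hi1, by rw [coupledWeight, hi2]⟩
    by_contra hik
    have h1 := quantile_monotoneOn ρ (h.exp_arrival_mem n i ω) (h.exp_arrival_mem n k ω)
      (h.exp_arrival_antitone n ω (not_lt.1 hik))
    rw [coupledWeight, hi2] at hlarge
    have h2 := (div_le_div_iff_of_pos_right hbn).2 h1
    linarith
  choose! idx hidx1 hidx2 hidx3 using hex
  have hinj : Set.InjOn idx A' := fun e he f hf hef => by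
    have h1 := hidx2 e he
    rw [hef, hidx2 f hf] at h1
    exact Subtype.ext h1.symm
  have hsub : A'.image idx ⊆ Finset.range k := fun i hi => by
    obtain ⟨e, he, rfl⟩ := Finset.mem_image.1 hi
    exact Finset.mem_range.2 (hidx1 e he)
  refine ⟨A'.image idx, hsub, ?_, ?_⟩
  · have hcomp : ∀ i ∈ A'.image idx, ∀ l ∈ A'.image idx, i ≠ l →
        ⌊((n : ℝ) + 1) * (contEdge U V i ω).2⌋ ≤ ⌊((n : ℝ) + 1) * (contEdge U V l ω).1⌋ →
        (contEdge U V i ω).2 ≤ (contEdge U V l ω).1 := by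
      intro i hi l hl hil hle
      by_contra hlt
      have h1 : ⌊((n : ℝ) + 1) * (contEdge U V l ω).1⌋ ≤ ⌊((n : ℝ) + 1) * (contEdge U V i ω).2⌋ :=
        Int.floor_le_floor (mul_le_mul_of_nonneg_left (not_le.1 hlt).le (by positivity))
      exact hn3 i (hsub hi) l (hsub hl) hil (le_antisymm hle h1)
    intro i hi l hl hil
    obtain ⟨e, he, hei⟩ := Finset.mem_image.1 hi
    obtain ⟨f, hf, hfl⟩ := Finset.mem_image.1 hl
    have hef : e ≠ f := fun hef => hil (by rw [← hei, ← hfl, hef])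
    have hce := hidx2 e he
    have hcf := hidx2 f hf
    rw [hei, cellOf_eq] at hce
    rw [hfl, cellOf_eq] at hcf
    have hchain : e.1.2 ≤ f.1.1 ∨ f.1.2 ≤ e.1.1 := hA (Finset.mem_filter.1 he).1 (Finset.mem_filter.1 hf).1 hef
    rw [← hce, ← hcf] at hchain
    exact hchain.imp (hcomp i hi l hl hil) (hcomp l hl i hi (Ne.symm hil))
  · rw [Finset.sum_image hinj]
    calc ∑ e ∈ A', coupledWeight ρ W U V n e ω / b n
        ≤ ∑ e ∈ A', (contWeight s W (idx e) ω + ε / (k + 1)) :=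
          Finset.sum_le_sum fun e he => by
            rw [hidx3 e he]
            exact hn2 _ (Finset.mem_range.2 (hidx1 e he))
      _ = ∑ e ∈ A', contWeight s W (idx e) ω + A'.card * (ε / (k + 1)) := by
          rw [Finset.sum_add_distrib, Finset.sum_const, nsmul_eq_mul]
      _ ≤ ∑ e ∈ A', contWeight s W (idx e) ω + ε := by
          gcongr
          have hcard : A'.card ≤ k := by
            rw [← Finset.card_image_of_injOn hinj]
            exact (Finset.card_le_card hsub).trans_eq (Finset.card_range k)
          have hcard' : (A'.card : ℝ) ≤ k + 1 := by
            have : (A'.card : ℝ) ≤ k := by exact_mod_cast hcard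
            linarith
          calc (A'.card : ℝ) * (ε / (k + 1)) ≤ (k + 1) * (ε / (k + 1)) := by gcongr
            _ = ε := by field_simp

end IsRegularModel

end CoupledChains

/-! ### The continuous passage time: finite approximation, measurability and finiteness -/

lemma IsSeparatedChain.isEdgeChain {n g : ℕ} {A : Finset Edge} (h : IsSeparatedChain n g A) :
    IsEdgeChain A :=
  h.2.imp fun e f hef => by omega

/-- Subsets of admissible sets are admissible and the terms are nonnegative. The supremum becomes
countable, which gives measurability. -/
lemma contPassageTime_eq_iSup_finset {Ω : Type*} (s : ℝ) (W U V : ℕ → Ω → ℝ) (ω : Ω) :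
    contPassageTime s W U V ω =
      ⨆ (B : Finset ℕ) (_ : (B : Set ℕ) ∈ admissible U V ω),
        ∑ i ∈ B, ENNReal.ofReal (contWeight s W i ω) := by
  refine le_antisymm (iSup₂_le fun A hA => ?_) (iSup₂_le fun B hB => ?_)
  · rw [ENNReal.tsum_eq_iSup_sum]
    refine iSup_le fun t => ?_
    have hsub : ((t.map (Function.Embedding.subtype _) : Finset ℕ) : Set ℕ) ⊆ A := by
      intro i hi
      obtain ⟨j, -, rfl⟩ := Finset.mem_map.1 (Finset.mem_coe.1 hi)
      exact j.2
    refine le_trans (le_of_eq ?_) (le_iSup₂ (t.map (Function.Embedding.subtype _))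
      (Set.Pairwise.mono hsub hA))
    rw [Finset.sum_map]
    rfl
  · refine le_trans (le_of_eq ?_) (le_iSup₂ (B : Set ℕ) hB)
    exact (Finset.tsum_subtype B fun i => ENNReal.ofReal (contWeight s W i ω)).symm

namespace IsRegularModel

variable {Ω : Type*} [MeasurableSpace Ω] {P : Measure Ω} {W U V : ℕ → Ω → ℝ}

lemma contWeight_nonneg (h : IsRegularModel P W U V) (s : ℝ) (k : ℕ) (ω : Ω) :
    0 ≤ contWeight s W k ω :=
  Real.rpow_nonneg (h.arrival_pos k ω).le _

lemma measurable_contWeight (h : IsRegularModel P W U V) (s : ℝ) (k : ℕ) :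
    Measurable (contWeight s W k) :=
  (h.measurable_arrival k).pow_const _

lemma coe_sum_ofReal_contWeight (h : IsRegularModel P W U V) (s : ℝ) (B : Finset ℕ) (ω : Ω) :
    ((∑ i ∈ B, ENNReal.ofReal (contWeight s W i ω) : ℝ≥0∞) : EReal) =
      ((∑ i ∈ B, contWeight s W i ω : ℝ) : EReal) := by
  rw [← ENNReal.ofReal_sum_of_nonneg fun i _ => h.contWeight_nonneg s i ω,
    EReal.coe_ennreal_ofReal, max_eq_left]
  exact Finset.sum_nonneg fun i _ => h.contWeight_nonneg s i ω

lemma sum_contWeight_le_contPassageTime (h : IsRegularModel P W U V) (s : ℝ) {B : Finset ℕ} {ω : Ω}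
    (hB : (B : Set ℕ) ∈ admissible U V ω) :
    ((∑ i ∈ B, contWeight s W i ω : ℝ) : EReal) ≤ contPassageTime s W U V ω := by
  rw [← h.coe_sum_ofReal_contWeight, EReal.coe_ennreal_le_coe_ennreal_iff,
    contPassageTime_eq_iSup_finset]
  exact le_iSup₂ (f := fun (B : Finset ℕ) (_ : (B : Set ℕ) ∈ admissible U V ω) =>
    ∑ i ∈ B, ENNReal.ofReal (contWeight s W i ω)) B hB

lemma exists_lt_sum_contWeight (h : IsRegularModel P W U V) {s x : ℝ} {ω : Ω}
    (hx : (x : EReal) < contPassageTime s W U V ω) :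
    ∃ B : Finset ℕ, (B : Set ℕ) ∈ admissible U V ω ∧ x < ∑ i ∈ B, contWeight s W i ω := by
  rcases lt_or_ge x 0 with hx0 | hx0
  · exact ⟨∅, by simp [admissible], by simpa using hx0⟩
  have hx' : ENNReal.ofReal x < contPassageTime s W U V ω := by
    rwa [← EReal.coe_ennreal_lt_coe_ennreal_iff, EReal.coe_ennreal_ofReal, max_eq_left hx0]
  rw [contPassageTime_eq_iSup_finset] at hx'
  simp only [lt_iSup_iff] at hx'
  obtain ⟨B, hB, hlt⟩ := hx'
  refine ⟨B, hB, ?_⟩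
  rw [← EReal.coe_ennreal_lt_coe_ennreal_iff, EReal.coe_ennreal_ofReal, max_eq_left hx0,
    h.coe_sum_ofReal_contWeight] at hlt
  exact_mod_cast hlt

lemma measurableSet_admissible (h : IsRegularModel P W U V) (B : Finset ℕ) :
    MeasurableSet {ω | (B : Set ℕ) ∈ admissible U V ω} := by
  have hmin : ∀ i, Measurable fun ω => (contEdge U V i ω).1 := fun i =>
    (h.measurable_U i).min (h.measurable_V i)
  have hmax : ∀ i, Measurable fun ω => (contEdge U V i ω).2 := fun i =>
    (h.measurable_U i).max (h.measurable_V i)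
  have hset : {ω | (B : Set ℕ) ∈ admissible U V ω} =
      ⋂ (i) (_ : i ∈ B) (j) (_ : j ∈ B) (_ : i ≠ j),
        ({ω | (contEdge U V i ω).2 ≤ (contEdge U V j ω).1} ∪
          {ω | (contEdge U V j ω).2 ≤ (contEdge U V i ω).1}) := by
    ext ω
    simp only [Set.mem_iInter]
    exact Iff.rfl
  rw [hset]
  exact MeasurableSet.iInter fun i => MeasurableSet.iInter fun _ => MeasurableSet.iInter fun j =>
    MeasurableSet.iInter fun _ => MeasurableSet.iInter fun _ =>
      (measurableSet_le (hmax i) (hmin j)).union (measurableSet_le (hmax j) (hmin i))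

lemma measurable_contPassageTime (h : IsRegularModel P W U V) (s : ℝ) :
    Measurable (contPassageTime s W U V) := by
  have hfun : contPassageTime s W U V = fun ω => ⨆ B : Finset ℕ,
      Set.indicator {ω | (B : Set ℕ) ∈ admissible U V ω}
        (fun ω => ∑ i ∈ B, ENNReal.ofReal (contWeight s W i ω)) ω := by
    funext ω
    rw [contPassageTime_eq_iSup_finset]
    refine iSup_congr fun B => ?_
    by_cases hB : (B : Set ℕ) ∈ admissible U V ω
    · rw [Set.indicator_of_mem (by exact hB), iSup_pos hB]
    · rw [Set.indicator_of_notMem (by exact hB), iSup_neg hB]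
      rfl
  rw [hfun]
  exact Measurable.iSup fun B => Measurable.indicator
    (Finset.measurable_sum _ fun i _ => (h.measurable_contWeight s i).ennreal_ofReal)
    (h.measurableSet_admissible B)

lemma map_coupledWeight_apply (h : IsRegularModel P W U V) (ρ : Measure ℝ) [IsProbabilityMeasure ρ]
    {n : ℕ} {e : Edge} (he : e ∈ boxEdges n) : P.map (coupledWeight ρ W U V n e) = ρ := by
  have h1 := (measurePreserving_eval (fun _ : boxEdges n => ρ) ⟨e, he⟩).map_eq
  rw [← h.map_coupledWeight ρ n, Measure.map_map (measurable_pi_apply (⟨e, he⟩ : boxEdges n))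
    (measurable_pi_lambda _ fun e => h.measurable_coupledWeight ρ n e)] at h1
  exact h1

lemma measurable_shortWeight_coupledWeight (h : IsRegularModel P W U V) (ρ : Measure ℝ)
    [IsProbabilityMeasure ρ] (n : ℕ) (σ δ b : ℝ) :
    Measurable fun ω => shortWeight n σ δ fun e => coupledWeight ρ W U V n e ω / b := by
  refine Finset.measurable_sum _ fun e _ => ?_
  have hm := (h.measurable_coupledWeight ρ n e).div_const b
  exact Measurable.ite ((measurableSet_le hm measurable_const).inter
    (measurableSet_le measurable_const ((hm.pow_const σ).const_mul _))) hm measurable_const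

/-- The expected contribution of the short edges of weight at most `δ` vanishes as `δ → 0`,
uniformly in `n`. -/
lemma exists_lintegral_shortWeight_le (h : IsRegularModel P W U V) {ρ : Measure ℝ}
    [IsProbabilityMeasure ρ] {b : ℕ → ℝ} {s : ℝ} (hρ : IsTailScaling ρ b s) (hs0 : 0 < s)
    (hs2 : s < 2) :
    ∃ σ C : ℝ, σ < 1 ∧ ∀ᶠ n : ℕ in atTop, ∀ δ, 0 < δ → δ ≤ 1 →
      ∫⁻ ω, ENNReal.ofReal (shortWeight n σ δ fun e => coupledWeight ρ W U V n e ω / b n) ∂P ≤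
        ENNReal.ofReal (C * δ ^ (1 - σ)) := by
  -- The exponent `σ` is the midpoint of `s / 2` and `1`: Potter's bound needs `s < 2 * σ` and
  -- integrability needs `σ < 1`. Both hold because `s < 2`.
  obtain ⟨C, hC, hev⟩ := hρ.potter (2 * ((s / 2 + 1) / 2)) (by linarith)
  refine ⟨(s / 2 + 1) / 2, (1 + (s / 2 + 1) / 2) * C / (1 - (s / 2 + 1) / 2), by linarith, ?_⟩
  filter_upwards [hev, hρ.tendsto_atTop.eventually_gt_atTop 0] with n hn hbn δ hδ hδ1
  exact lintegral_shortWeight_le hρ.neg_null (h.measurable_coupledWeight ρ n)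
    (fun e he => h.map_coupledWeight_apply ρ he) hC hbn (by linarith) (by linarith) hδ hδ1
    (fun e ω => quantile_nonneg hρ.neg_null _) hn

/-- By Fatou, for infinitely many `n` the short edges of weight at most `1` contribute less than
some `r`. If `w` were infinite, a heavy finite compatible set would give discrete chains heavier
than their large and small weights allow. -/
lemma ae_contPassageTime_lt_top_of_tailScaling (h : IsRegularModel P W U V) {ρ : Measure ℝ}
    [IsProbabilityMeasure ρ] {b : ℕ → ℝ} {s : ℝ} (hρ : IsTailScaling ρ b s) (hs0 : 0 < s)
    (hs2 : s < 2) : ∀ᵐ ω ∂P, contPassageTime s W U V ω < ∞ := by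
  obtain ⟨σ, C, hσ1, hev⟩ := h.exists_lintegral_shortWeight_le hρ hs0 hs2
  let T : ℕ → Ω → ℝ := fun n ω => shortWeight n σ 1 fun e => coupledWeight ρ W U V n e ω / b n
  have hT : ∀ n, Measurable fun ω => ENNReal.ofReal (T n ω) := fun n =>
    (h.measurable_shortWeight_coupledWeight ρ n σ 1 (b n)).ennreal_ofReal
  have hfatou : ∫⁻ ω, liminf (fun n => ENNReal.ofReal (T n ω)) atTop ∂P < ∞ := by
    refine (lintegral_liminf_le hT).trans_lt (lt_of_le_of_lt (b := ENNReal.ofReal C) ?_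
      ENNReal.ofReal_lt_top)
    refine liminf_le_of_frequently_le' (Eventually.frequently ?_)
    filter_upwards [hev] with n hn
    simpa using hn 1 one_pos le_rfl
  have hfin := ae_lt_top (Measurable.liminf hT) hfatou.ne
  filter_upwards [hfin, h.ae_hasDistinctEndpoints, h.tendsto_arrival] with ω h1 h2 h3
  by_contra htop
  have htop' : contPassageTime s W U V ω = ∞ := not_lt_top_iff.1 htop
  obtain ⟨r, hr⟩ := ENNReal.lt_iff_exists_nnreal_btwn.1 h1
  have hfreq : ∃ᶠ n in atTop, ENNReal.ofReal (T n ω) < r := frequently_lt_of_liminf_lt (h := hr.1)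
  obtain ⟨k, hk⟩ := h.exists_compatible_of_chain hρ hs0 h2 h3 one_pos
  -- The summands bound the limits of the large weights, their approximation error, the long edges
  -- (`δ ^ (1 - σ)` with `δ = 1`), and the short edges.
  obtain ⟨B, hB, hBc⟩ := h.exists_lt_sum_contWeight (s := s) (ω := ω)
    (x := ∑ i ∈ Finset.range k, contWeight s W i ω + 1 + 1 + r) (by rw [htop']; exact EReal.coe_lt_top _)
  obtain ⟨j, hj⟩ := h.exists_separatedChain hρ hs0 h2 hB hBc
  obtain ⟨n, hTn, hkn, ⟨A, hA, hAc⟩, hbn, hn⟩ := (hfreq.and_eventually ((hk 1 one_pos).and (hj.and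
    ((hρ.tendsto_atTop.eventually_gt_atTop 0).and (eventually_gt_atTop 0))))).exists
  obtain ⟨B', hB', -, hlarge⟩ := hkn A hA.isEdgeChain
  have hsmall := hA.isEdgeChain.sum_small_le hn hA.subset_boxEdges
    (x := fun e => coupledWeight ρ W U V n e ω / b n) (δ := 1) (σ := σ)
    (fun e => div_nonneg (quantile_nonneg hρ.neg_null _) hbn.le) hσ1 one_pos
  rw [Real.one_rpow] at hsmall
  have hTr : T n ω < r := by
    rw [← ENNReal.ofReal_coe_nnreal] at hTn
    exact (ENNReal.ofReal_lt_ofReal_iff'.1 hTn).1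
  have hB'' : ∑ i ∈ B', contWeight s W i ω ≤ ∑ i ∈ Finset.range k, contWeight s W i ω :=
    Finset.sum_le_sum_of_subset_of_nonneg hB' fun i _ _ => h.contWeight_nonneg s i ω
  have hsplit := Finset.sum_filter_add_sum_filter_not A
    (fun e => coupledWeight ρ W U V n e ω / b n ≤ 1) fun e => coupledWeight ρ W U V n e ω / b n
  simp only [not_le] at hsplit
  rw [← lt_div_iff₀ hbn, Finset.sum_div, ← hsplit] at hAc
  have : T n ω = shortWeight n σ 1 fun e => coupledWeight ρ W U V n e ω / b n := rfl
  linarith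

end IsRegularModel

/-! ### Reduction to measurable driving variables in open ranges -/

lemma expMeasure_ae_pos : ∀ᵐ x ∂expMeasure 1, 0 < x := by
  have := isProbabilityMeasure_expMeasure one_pos
  have h0 : expMeasure 1 (Set.Iic 0) = 0 := by
    rw [← ofReal_cdf, cdf_expMeasure_eq one_pos]
    simp
  filter_upwards [measure_eq_zero_iff_ae_notMem.1 h0] with x hx
  simpa using hx

lemma unif_ae_mem_Ioo : ∀ᵐ x ∂unif, x ∈ Set.Ioo (0 : ℝ) 1 := by
  rw [unif, restrict_Ioo_eq_restrict_Icc.symm]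
  exact ae_restrict_mem measurableSet_Ioo

/-- A random variable with values almost surely in `S` has a measurable modification with values
in `S`. -/
lemma exists_measurable_modification {Ω : Type*} [MeasurableSpace Ω] {P : Measure Ω} {ν : Measure ℝ}
    {X : Ω → ℝ} (hX : HasLaw X ν P) {S : Set ℝ} (hne : S.Nonempty)
    (hν : ∀ᵐ x ∂ν, x ∈ S) :
    ∃ Y : Ω → ℝ, Measurable Y ∧ (∀ ω, Y ω ∈ S) ∧ X =ᵐ[P] Y := by
  have hXS : ∀ᵐ ω ∂P, X ω ∈ S := by
    rw [← hX.map_eq] at hν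
    exact ae_of_ae_map hX.aemeasurable hν
  obtain ⟨Y, h1, h2, h3⟩ := hX.aemeasurable.exists_ae_eq_range_subset hXS hne
  exact ⟨Y, h1, fun ω => h2 ⟨ω, rfl⟩, h3⟩

/-- Countably many variables are modified, each on a null set, so laws, independence and the passage
time up to a null set are preserved. -/
lemma IsContinuousModel.exists_regular {Ω : Type*} [MeasurableSpace Ω] {P : Measure Ω}
    {W U V : ℕ → Ω → ℝ} (h : IsContinuousModel P W U V) :
    ∃ W' U' V' : ℕ → Ω → ℝ, IsRegularModel P W' U' V' ∧
      ∀ s, contPassageTime s W' U' V' =ᵐ[P] contPassageTime s W U V := by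
  choose W' hW1 hW2 hW3 using fun k => exists_measurable_modification (h.law_W k)
    ⟨1, Set.mem_Ioi.2 one_pos⟩ expMeasure_ae_pos
  choose U' hU1 hU2 hU3 using fun k => exists_measurable_modification (h.law_U k)
    ⟨1 / 2, by norm_num⟩ unif_ae_mem_Ioo
  choose V' hV1 hV2 hV3 using fun k => exists_measurable_modification (h.law_V k)
    ⟨1 / 2, by norm_num⟩ unif_ae_mem_Ioo
  refine ⟨W', U', V', ⟨⟨fun k => (h.law_W k).congr (hW3 k).symm, fun k => (h.law_U k).congr (hU3 k).symm,
    fun k => (h.law_V k).congr (hV3 k).symm, ?_⟩, hW1, hU1, hV1, hW2, hU2, hV2⟩, fun s => ?_⟩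
  · refine h.indep.congr ?_
    rintro (k | k | k)
    exacts [hW3 k, hU3 k, hV3 k]
  · filter_upwards [ae_all_iff.2 hW3, ae_all_iff.2 hU3, ae_all_iff.2 hV3] with ω h1 h2 h3
    simp only [contPassageTime, admissible, contEdge, contWeight, h1, h2, h3]

/-! ### Transfer of the bounds to the random graph -/

lemma coe_lt_mul_div_iff {q c : ℝ} (hq : 0 < q) (hc : 0 < c) (x : ℝ) (y : EReal) :
    (x : EReal) < (q : EReal) * y / (c : EReal) ↔ ((x * (q⁻¹ * c) : ℝ) : EReal) < y := by
  rw [EReal.div_eq_inv_mul, ← EReal.coe_inv]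
  have hc' : 0 < c⁻¹ := inv_pos.2 hc
  induction y with
  | bot => simp [EReal.coe_mul_bot_of_pos hq, EReal.coe_mul_bot_of_pos hc']
  | top =>
    rw [EReal.coe_mul_top_of_pos hq, EReal.coe_mul_top_of_pos hc']
    exact iff_of_true (EReal.coe_lt_top _) (EReal.coe_lt_top _)
  | coe y =>
    rw [← EReal.coe_mul, ← EReal.coe_mul, EReal.coe_lt_coe_iff, EReal.coe_lt_coe_iff,
      ← div_lt_iff₀' hc', ← div_lt_iff₀' hq]
    rw [show x / c⁻¹ / q = x * (q⁻¹ * c) by field_simp]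

lemma tendsto_sq_mul_pow_div {q : ℝ} (hq0 : 0 ≤ q) (hq1 : q < 1) (j : ℕ) :
    Tendsto (fun n : ℕ => ((n : ℝ) + 1) ^ 2 * q ^ (n / (j + 1) - 1)) atTop (𝓝 0) := by
  have habs : |q| < 1 := by rwa [abs_of_nonneg hq0]
  have h1 : Tendsto (fun k : ℕ => ((j : ℝ) + 1) ^ 2 * (((k : ℝ) + 2) ^ 2 * q ^ k)) atTop (𝓝 0) := by
    have h := ((tendsto_pow_const_mul_const_pow_of_abs_lt_one 2 habs).add
      ((tendsto_pow_const_mul_const_pow_of_abs_lt_one 1 habs).const_mul 4)).add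
      ((tendsto_pow_const_mul_const_pow_of_abs_lt_one 0 habs).const_mul 4)
    have h' := h.const_mul (((j : ℝ) + 1) ^ 2)
    simp only [mul_zero, add_zero] at h'
    refine h'.congr fun k => ?_
    ring
  have h2 : Tendsto (fun n : ℕ => n / (j + 1) - 1) atTop atTop :=
    (tendsto_sub_atTop_nat 1).comp (Nat.tendsto_div_const_atTop (Nat.succ_ne_zero j))
  refine squeeze_zero' (Eventually.of_forall fun n => by positivity) ?_ (h1.comp h2)
  filter_upwards [h2.eventually_ge_atTop 1] with n hn
  -- With `k = n / (j + 1) - 1` this bounds the polynomial factor by a polynomial in `k`, which the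
  -- geometric factor `q ^ k` beats.
  have hn1 : n + 1 ≤ (j + 1) * ((n / (j + 1) - 1) + 2) := by
    have h3 := Nat.div_add_mod n (j + 1)
    have h4 := Nat.mod_lt n (show j + 1 > 0 by omega)
    have h5 : n / (j + 1) - 1 + 2 = n / (j + 1) + 1 := by omega
    rw [h5, Nat.mul_succ]
    omega
  have hn2 : (n : ℝ) + 1 ≤ ((j : ℝ) + 1) * (((n / (j + 1) - 1 : ℕ) : ℝ) + 2) := by
    exact_mod_cast hn1
  simp only [Function.comp_apply]
  rw [← mul_assoc, ← mul_pow]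
  gcongr

/-- The probability that some set of edges in a family has large weight depends only on the joint
law of the weights in the box. -/
lemma measureReal_exists_lt_sum_eq {Ω Ω' : Type*} [MeasurableSpace Ω] [MeasurableSpace Ω']
    {P : Measure Ω} {P' : Measure Ω'} {n : ℕ} {X : Edge → Ω → ℝ} {X' : Edge → Ω' → ℝ}
    (hX : ∀ e, AEMeasurable (X e) P) (hX' : ∀ e, AEMeasurable (X' e) P')
    (hlaw : P.map (fun ω (e : boxEdges n) => X e ω) = P'.map fun ω (e : boxEdges n) => X' e ω)
    (p : Finset Edge → Prop) (c : ℝ) :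
    P.real {ω | ∃ A ⊆ boxEdges n, p A ∧ c < ∑ e ∈ A, X e ω} =
      P'.real {ω | ∃ A ⊆ boxEdges n, p A ∧ c < ∑ e ∈ A, X' e ω} := by
  let S : Set (boxEdges n → ℝ) := ⋃ (A : Finset Edge) (_ : A ⊆ boxEdges n) (_ : p A),
    {y | c < ∑ e : boxEdges n, if (e : Edge) ∈ A then y e else 0}
  have hS : MeasurableSet S := by
    refine MeasurableSet.iUnion fun A => MeasurableSet.iUnion fun _ => MeasurableSet.iUnion fun _ =>
      measurableSet_lt measurable_const (Finset.measurable_sum _ fun e _ => ?_)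
    split_ifs
    exacts [measurable_pi_apply e, measurable_const]
  have hsum : ∀ (x : Edge → ℝ) {A : Finset Edge}, A ⊆ boxEdges n →
      ∑ e ∈ A, x e = ∑ e : boxEdges n, if (e : Edge) ∈ A then x e else 0 := fun x A hA => by
    rw [Finset.sum_coe_sort (boxEdges n) fun e => if e ∈ A then x e else 0, Finset.sum_ite_mem,
      Finset.inter_eq_right.2 hA]
  have hmem : ∀ x : Edge → ℝ, (∃ A ⊆ boxEdges n, p A ∧ c < ∑ e ∈ A, x e) ↔
      (fun e : boxEdges n => x e) ∈ S := fun x => by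
    simp only [S, Set.mem_iUnion, exists_prop]
    refine exists_congr fun A => and_congr_right fun hA => ?_
    rw [hsum x hA]
    rfl
  simp only [hmem, measureReal_def]
  have h1 := Measure.map_apply_of_aemeasurable (μ := P)
    (aemeasurable_pi_lambda (fun ω (e : boxEdges n) => X e ω) fun e => hX e) hS
  have h2 := Measure.map_apply_of_aemeasurable (μ := P')
    (aemeasurable_pi_lambda (fun ω (e : boxEdges n) => X' e ω) fun e => hX' e) hS
  rw [hlaw, h2] at h1
  exact congrArg ENNReal.toReal h1.symm

section Passage

variable {Ω Ω' : Type*} [MeasurableSpace Ω] [MeasurableSpace Ω'] {P : Measure Ω} {P' : Measure Ω'}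
  {p s : ℝ} {μ : Measure ℝ}
  {α : Edge → Ω → Bool} {v : Edge → Ω → ℝ} {W U V : ℕ → Ω' → ℝ}

lemma measurable_passageTime (hα : ∀ e, Measurable (α e)) (hv : ∀ e, Measurable (v e)) (i j : ℤ) :
    Measurable (passageTime α v i j) := by
  classical
  have hfun : passageTime α v i j = fun ω => ⨆ π : List Edge, if IsPath i j π then
      (if ω ∈ {ω | ∀ e ∈ π, α e ω = true} then (((π.map fun e => v e ω).sum : ℝ) : EReal) else ⊥)
      else ⊥ := by
    funext ω
    refine iSup_congr fun π => ?_
    by_cases h1 : IsPath i j π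
    · by_cases h2 : ∀ e ∈ π, α e ω = true
      · rw [iSup_pos h1, iSup_pos h2, if_pos h1, if_pos (by exact h2)]
      · rw [iSup_pos h1, iSup_neg h2, if_pos h1, if_neg (by exact h2)]
    · rw [iSup_neg h1, if_neg h1]
  have hsum : ∀ π : List Edge, Measurable fun ω => (π.map fun e => v e ω).sum := fun π => by
    induction π with
    | nil => simp
    | cons e π ih =>
      simp only [List.map_cons, List.sum_cons]
      exact (hv e).add ih
  rw [hfun]
  refine Measurable.iSup fun π => ?_
  split_ifs
  · refine Measurable.ite ?_ (Measurable.coe_real_ereal ?_) measurable_const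
    · have hset : {ω | ∀ e ∈ π, α e ω = true} = ⋂ (e) (_ : e ∈ π), α e ⁻¹' {true} := by
        ext ω
        simp
      rw [hset]
      exact MeasurableSet.iInter fun e => MeasurableSet.iInter fun _ =>
        hα e (measurableSet_singleton true)
    · exact hsum π
  · exact measurable_const

lemma IsWeightedRandomGraph.aemeasurable_passageTime (h : IsWeightedRandomGraph P p μ α v)
    (i j : ℤ) : AEMeasurable (passageTime α v i j) P := by
  have hv := fun e => (h.law_weight e).aemeasurable
  refine ⟨passageTime α (fun e => (hv e).mk (v e)) i j,
    measurable_passageTime h.measurable_present (fun e => (hv e).measurable_mk) i j, ?_⟩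
  filter_upwards [ae_all_iff.2 fun e => (hv e).ae_eq_mk] with ω hω
  simp only [passageTime, hω]

lemma IsWeightedRandomGraph.ae_weight_nonneg (h : IsWeightedRandomGraph P p μ α v)
    (hμpos : ∀ᵐ x ∂μ, 0 < x) : ∀ᵐ ω ∂P, ∀ e, 0 ≤ v e ω := by
  refine ae_all_iff.2 fun e => ?_
  rw [← (h.law_weight e).map_eq] at hμpos
  filter_upwards [ae_of_ae_map (h.law_weight e).aemeasurable hμpos] with ω hω
  exact hω.le

lemma measureReal_exists_lt_sum_coupledWeight [IsProbabilityMeasure P] [IsProbabilityMeasure μ]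
    (hG : IsWeightedRandomGraph P p μ α v) (hp0 : 0 ≤ p) (hp1 : p ≤ 1)
    (h : IsRegularModel P' W U V) (n : ℕ) (q : Finset Edge → Prop) (c : ℝ) :
    P'.real {ω | ∃ A ⊆ boxEdges n, q A ∧ c < ∑ e ∈ A, coupledWeight (thinnedLaw p μ) W U V n e ω} =
      P.real {ω | ∃ A ⊆ boxEdges n, q A ∧ c < ∑ e ∈ A, thinnedWeight α v e ω} := by
  have := isProbabilityMeasure_thinnedLaw hp0 hp1 μ
  exact measureReal_exists_lt_sum_eq (fun e => (h.measurable_coupledWeight _ n e).aemeasurable)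
    hG.aemeasurable_thinnedWeight
    ((h.map_coupledWeight _ n).trans (hG.map_thinnedWeight_box hp0 n).symm) q c

/-- The lower bound in the convergence in distribution. -/
lemma eventually_measureReal_lt_passageTime_ge [IsProbabilityMeasure P] [IsProbabilityMeasure μ]
    (hG : IsWeightedRandomGraph P p μ α v) (hp0 : 0 < p) (hp1 : p ≤ 1) (hs0 : 0 < s)
    (hμpos : ∀ᵐ x ∂μ, 0 < x) (h : IsRegularModel P' W U V) {b : ℕ → ℝ}
    (hρ : IsTailScaling (thinnedLaw p μ) b s) (x : ℝ) {ε : ℝ} (hε : 0 < ε) :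
    ∀ᶠ n : ℕ in atTop, P'.real {ω | (x : EReal) < contPassageTime s W U V ω} - ε ≤
      P.real {ω | ((x * b n : ℝ) : EReal) < passageTime α v 0 n ω} := by
  have := isProbabilityMeasure_thinnedLaw hp0.le hp1 μ
  have := h.isProbabilityMeasure
  -- A larger `j` asks for smaller gaps, so the events increase with `j`, and one `j` serves up to
  -- probability `ε / 2`. The other `ε / 2` covers the failure of connectivity.
  let E : ℕ → ℕ → Set Ω' := fun j n => {ω | ∃ A ⊆ boxEdges n, IsSeparatedChain n (n / (j + 1)) A ∧
    x * b n < ∑ e ∈ A, coupledWeight (thinnedLaw p μ) W U V n e ω}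
  have hmono : ∀ n, Monotone fun j => E j n := by
    rintro n j j' hj ω ⟨A, h1, h2, h3⟩
    exact ⟨A, h1, h2.mono (Nat.div_le_div_left (by omega) (Nat.succ_pos j)), h3⟩
  obtain ⟨j, hj⟩ := exists_eventually_measureReal_ge (P := P')
    (C := {ω | (x : EReal) < contPassageTime s W U V ω}) hmono (by
      filter_upwards [h.ae_hasDistinctEndpoints] with ω hω hωC
      obtain ⟨B, hB, hBx⟩ := h.exists_lt_sum_contWeight hωC
      obtain ⟨j, hj⟩ := h.exists_separatedChain hρ hs0 hω hB hBx
      refine ⟨j, hj.mono ?_⟩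
      rintro n ⟨A, hA, hAx⟩
      exact ⟨A, hA.subset_boxEdges, hA, hAx⟩) (half_pos hε)
  have hgap := tendsto_sq_mul_pow_div (q := 1 - p ^ 2) (by nlinarith) (by nlinarith) j
  have hdiv : Tendsto (fun n : ℕ => n / (j + 1)) atTop atTop :=
    Nat.tendsto_div_const_atTop (Nat.succ_ne_zero j)
  filter_upwards [hj, hgap.eventually (eventually_le_nhds (half_pos hε)),
    hdiv.eventually_ge_atTop 1] with n hn hsmall hone
  have hconn := (hG.measureReal_not_isConnectedAtScale_le hp0.le hp1 n _ hone).trans hsmall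
  have hnull : P.real {ω | ¬∀ e, 0 ≤ v e ω} = 0 := by
    rw [measureReal_def, ae_iff.1 (hG.ae_weight_nonneg hμpos), ENNReal.toReal_zero]
  rw [measureReal_exists_lt_sum_coupledWeight hG hp0.le hp1 h] at hn
  have hsub : {ω | ∃ A ⊆ boxEdges n, IsSeparatedChain n (n / (j + 1)) A ∧
      x * b n < ∑ e ∈ A, thinnedWeight α v e ω} ⊆
      {ω | ((x * b n : ℝ) : EReal) < passageTime α v 0 n ω} ∪
        ({ω | ¬IsConnectedAtScale n (n / (j + 1)) fun e => α e ω} ∪ {ω | ¬∀ e, 0 ≤ v e ω}) := by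
    rintro ω ⟨A, -, hA, hAx⟩
    by_contra hcon
    simp only [Set.mem_union, Set.mem_ofPred_eq, not_or, not_not] at hcon
    exact hcon.1 (lt_passageTime_of_separatedChain (Nat.div_le_self _ _) hcon.2.1 hcon.2.2 hA hAx)
  have h1 := (measureReal_mono (μ := P) hsub).trans (measureReal_union_le _ _)
  have h2 := measureReal_union_le (μ := P)
    {ω | ¬IsConnectedAtScale n (n / (j + 1)) fun e => α e ω} {ω | ¬∀ e, 0 ≤ v e ω}
  linarith

/-- Continuity from above provides the slack in the threshold that the upper bound spends. -/
lemma exists_measureReal_contPassageTime_ge_le (h : IsRegularModel P' W U V) (s x : ℝ) {ε : ℝ}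
    (hε : 0 < ε) : ∃ η : ℝ, 0 < η ∧
      P'.real {ω | ((x - η : ℝ) : EReal) ≤ contPassageTime s W U V ω} ≤
        P'.real {ω | (x : EReal) ≤ contPassageTime s W U V ω} + ε := by
  have hw : Measurable fun ω => (contPassageTime s W U V ω : EReal) :=
    (h.measurable_contPassageTime s).coe_ereal_ennreal
  have := h.isProbabilityMeasure
  let C : ℕ → Set Ω' := fun m =>
    {ω | ((x - 1 / ((m : ℝ) + 1) : ℝ) : EReal) ≤ contPassageTime s W U V ω}
  have hanti : Antitone C := fun m m' hm ω hω => by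
    refine le_trans (EReal.coe_le_coe_iff.2 ?_) hω
    have hm' : (m : ℝ) ≤ m' := by exact_mod_cast hm
    gcongr
  have hinter : ⋂ m, C m = {ω | (x : EReal) ≤ contPassageTime s W U V ω} := by
    ext ω
    simp only [C, Set.mem_iInter, Set.mem_ofPred_eq]
    constructor
    · intro hω
      have hlim : Tendsto (fun m : ℕ => ((x - 1 / ((m : ℝ) + 1) : ℝ) : EReal)) atTop
          (𝓝 (x : EReal)) := by
        refine (continuous_coe_real_ereal.tendsto x).comp ?_
        simpa using tendsto_one_div_add_atTop_nhds_zero_nat.const_sub x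
      exact le_of_tendsto' hlim hω
    · intro hω m
      refine le_trans (EReal.coe_le_coe_iff.2 ?_) hω
      have : 0 < 1 / ((m : ℝ) + 1) := by positivity
      linarith
  have hlim : Tendsto (fun m => P'.real (C m)) atTop (𝓝 (P'.real (⋂ m, C m))) :=
    (ENNReal.tendsto_toReal (measure_ne_top _ _)).comp (tendsto_measure_iInter_atTop
      (fun m => (measurableSet_le measurable_const hw).nullMeasurableSet) hanti
      ⟨0, measure_ne_top _ _⟩)
  rw [hinter] at hlim
  obtain ⟨m, hm⟩ := (hlim.eventually (eventually_le_nhds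
    (b := P'.real {ω | (x : EReal) ≤ contPassageTime s W U V ω} + ε) (by linarith))).exists
  exact ⟨1 / ((m : ℝ) + 1), by positivity, hm⟩

/-- The upper bound in the convergence in distribution. -/
lemma eventually_measureReal_passageTime_le [IsProbabilityMeasure P] [IsProbabilityMeasure μ]
    (hG : IsWeightedRandomGraph P p μ α v) (hp0 : 0 < p) (hp1 : p ≤ 1) (hs0 : 0 < s) (hs2 : s < 2)
    (h : IsRegularModel P' W U V) {b : ℕ → ℝ}
    (hρ : IsTailScaling (thinnedLaw p μ) b s) (x : ℝ) {ε : ℝ} (hε : 0 < ε) :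
    ∀ᶠ n : ℕ in atTop,
      P.real {ω | ∀ z < x, ((z * b n : ℝ) : EReal) < passageTime α v 0 n ω} ≤
        P'.real {ω | (x : EReal) ≤ contPassageTime s W U V ω} + ε := by
  classical
  have := isProbabilityMeasure_thinnedLaw hp0.le hp1 μ
  have := h.isProbabilityMeasure
  obtain ⟨η', hη', hηx⟩ := exists_measureReal_contPassageTime_ge_le h s x
    (show 0 < ε / 3 by linarith)
  -- The four shares of `η` pay for the strict threshold `x - η`, the long edges of small weight,
  -- the short edges of small weight, and the approximation of the large weights. The three shares
  -- of `ε` pay for this slack, Markov's inequality, and the limit along `D n`.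
  obtain ⟨η, rfl⟩ : ∃ η, η' = 4 * η := ⟨η' / 4, by ring⟩
  have hη : 0 < η := by linarith
  obtain ⟨σ, C, hσ1, hshort⟩ := h.exists_lintegral_shortWeight_le hρ hs0 hs2
  obtain ⟨δ, ⟨hδ1, hδη, hδC⟩, hδ⟩ : ∃ δ : ℝ, (δ ≤ 1 ∧ δ ^ (1 - σ) ≤ η ∧
      C * δ ^ (1 - σ) ≤ η * (ε / 3)) ∧ 0 < δ := by
    have hpow : Tendsto (fun δ : ℝ => δ ^ (1 - σ)) (𝓝[>] 0) (𝓝 0) := by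
      have hcont := (Real.continuousAt_rpow_const 0 (1 - σ) (Or.inr (by linarith))).tendsto
      rw [Real.zero_rpow (by linarith)] at hcont
      exact hcont.mono_left nhdsWithin_le_nhds
    have hpowC := hpow.const_mul C
    rw [mul_zero] at hpowC
    have hid : Tendsto (fun δ : ℝ => δ) (𝓝[>] 0) (𝓝 0) := nhdsWithin_le_nhds
    exact (((hid.eventually (eventually_le_nhds one_pos)).and
      ((hpow.eventually (eventually_le_nhds hη)).and
        (hpowC.eventually (eventually_le_nhds (by positivity))))).and
      (self_mem_nhdsWithin : ∀ᶠ δ : ℝ in 𝓝[>] 0, 0 < δ)).exists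
  let X : ℕ → Edge → Ω' → ℝ := fun n e ω => coupledWeight (thinnedLaw p μ) W U V n e ω / b n
  have hX : ∀ n e, Measurable (X n e) := fun n e =>
    (h.measurable_coupledWeight _ n e).div_const _
  let D : ℕ → Set Ω' := fun n => {ω | ∃ A ⊆ boxEdges n, IsEdgeChain A ∧
    x - 3 * η < ∑ e ∈ A with δ < X n e ω, X n e ω}
  have hDm : ∀ n, MeasurableSet (D n) := fun n => by
    have hset : D n = ⋃ (A : Finset Edge) (_ : A ⊆ boxEdges n) (_ : IsEdgeChain A),
        {ω | x - 3 * η < ∑ e ∈ A, if δ < X n e ω then X n e ω else 0} := by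
      ext ω
      simp only [D, Set.mem_iUnion, Set.mem_ofPred_eq, exists_prop, Finset.sum_filter]
    rw [hset]
    exact MeasurableSet.iUnion fun A => MeasurableSet.iUnion fun _ => MeasurableSet.iUnion fun _ =>
      measurableSet_lt measurable_const (Finset.measurable_sum _ fun e _ =>
        Measurable.ite (measurableSet_lt measurable_const (hX n e)) (hX n e) measurable_const)
  have hD := eventually_measureReal_le (P := P') (D := D)
    (C := {ω | ((x - 4 * η : ℝ) : EReal) ≤ contPassageTime s W U V ω})
    (fun n => (hDm n).nullMeasurableSet) (by
      filter_upwards [h.ae_hasDistinctEndpoints, h.tendsto_arrival] with ω h1 h2 hfreq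
      obtain ⟨k, hk⟩ := h.exists_compatible_of_chain hρ hs0 h1 h2 hδ
      obtain ⟨n, ⟨A, -, hA, hAx⟩, hn⟩ := (hfreq.and_eventually (hk η hη)).exists
      obtain ⟨B, -, hB, hle⟩ := hn A hA
      refine le_trans (EReal.coe_le_coe_iff.2 ?_) (h.sum_contWeight_le_contPassageTime s hB)
      linarith [hAx.trans_le hle]) (show 0 < ε / 3 by linarith)
  filter_upwards [hD, hshort, hρ.tendsto_atTop.eventually_gt_atTop 0, eventually_gt_atTop 0]
    with n hDn hshort_n hbn hn
  have hXnn : ∀ e ω, 0 ≤ X n e ω := fun e ω =>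
    div_nonneg (quantile_nonneg hρ.neg_null _) hbn.le
  have hmarkov : P'.real {ω | η ≤ shortWeight n σ δ fun e => X n e ω} ≤ ε / 3 := by
    refine ENNReal.toReal_le_of_le_ofReal (by linarith) ?_
    have hm := meas_ge_le_lintegral_div (μ := P')
      (h.measurable_shortWeight_coupledWeight (thinnedLaw p μ) n σ δ
        (b n)).ennreal_ofReal.aemeasurable (ENNReal.ofReal_pos.2 hη).ne' ENNReal.ofReal_ne_top
    refine (measure_mono fun ω hω => ENNReal.ofReal_le_ofReal hω).trans (hm.trans ?_)
    refine ENNReal.div_le_of_le_mul' ((hshort_n δ hδ hδ1).trans ?_)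
    rw [← ENNReal.ofReal_mul hη.le]
    exact ENNReal.ofReal_le_ofReal hδC
  have hsub1 : {ω | ∀ z < x, ((z * b n : ℝ) : EReal) < passageTime α v 0 n ω} ⊆
      {ω | ∃ A ⊆ boxEdges n, IsEdgeChain A ∧ (x - η) * b n < ∑ e ∈ A, thinnedWeight α v e ω} :=
    fun ω hω => exists_chain_of_lt_passageTime (hω (x - η) (by linarith))
  have hsub2 : {ω | ∃ A ⊆ boxEdges n, IsEdgeChain A ∧
      (x - η) * b n < ∑ e ∈ A, coupledWeight (thinnedLaw p μ) W U V n e ω} ⊆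
      {ω | η ≤ shortWeight n σ δ fun e => X n e ω} ∪ D n := by
    rintro ω ⟨A, hAbox, hA, hAx⟩
    by_contra hcon
    simp only [Set.mem_union, Set.mem_ofPred_eq, not_or, not_le] at hcon
    refine hcon.2 ⟨A, hAbox, hA, ?_⟩
    have hsmall := hA.sum_small_le hn hAbox (x := fun e => X n e ω) (fun e => hXnn e ω) hσ1 hδ
    have hsplit := Finset.sum_filter_add_sum_filter_not A (fun e => X n e ω ≤ δ) fun e => X n e ω
    simp only [not_le] at hsplit
    rw [← lt_div_iff₀ hbn, Finset.sum_div] at hAx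
    have hAx' : x - η < ∑ e ∈ A, X n e ω := hAx
    linarith [hcon.1]
  have h1 := measureReal_mono (μ := P) hsub1
  rw [← measureReal_exists_lt_sum_coupledWeight hG hp0.le hp1 h] at h1
  have h2 := (measureReal_mono (μ := P') hsub2).trans (measureReal_union_le _ _)
  linarith

end Passage

end LongRangeLPP

theorem theorem5 {Ω Ω' : Type*} [MeasurableSpace Ω] [MeasurableSpace Ω']
    (P : Measure Ω) [IsProbabilityMeasure P] (P' : Measure Ω') [IsProbabilityMeasure P']
    (p s : ℝ) (hp0 : 0 < p) (hp1 : p ≤ 1) (hs0 : 0 < s) (hs2 : s < 2)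
    (μ : Measure ℝ) [IsProbabilityMeasure μ] (hμpos : ∀ᵐ x ∂μ, 0 < x)
    (hF : LongRangeLPP.RegularlyVaryingTail μ s)
    (α : LongRangeLPP.Edge → Ω → Bool) (v : LongRangeLPP.Edge → Ω → ℝ)
    (hG : LongRangeLPP.IsWeightedRandomGraph P p μ α v)
    (W U V : ℕ → Ω' → ℝ) (hC : LongRangeLPP.IsContinuousModel P' W U V) :
    (∀ᵐ ω ∂P', LongRangeLPP.contPassageTime s W U V ω < ∞) ∧
    TendstoInDistribution
      (fun (n : ℕ) (ω : Ω) =>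
        ((p ^ (-(1 / s)) : ℝ) : EReal) * LongRangeLPP.passageTime α v 0 (n : ℤ) ω /
          (LongRangeLPP.scaling μ n : EReal))
      atTop
      (fun ω => (LongRangeLPP.contPassageTime s W U V ω : EReal))
      (fun _ => P) P' := by
  have := LongRangeLPP.isProbabilityMeasure_thinnedLaw hp0.le hp1 μ
  have hρ := LongRangeLPP.isTailScaling_thinnedLaw hp0 hp1 hs0 μ hμpos hF
  obtain ⟨W', U', V', h, hw⟩ := hC.exists_regular
  refine ⟨?_, ?_⟩
  · filter_upwards [h.ae_contPassageTime_lt_top_of_tailScaling hρ hs0 hs2, hw s] with ω h1 h2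
    rwa [← h2]
  have hZ : Measurable fun ω => (LongRangeLPP.contPassageTime s W' U' V' ω : EReal) :=
    (h.measurable_contPassageTime s).coe_ereal_ennreal
  have hR : ∀ n : ℕ, AEMeasurable (fun ω : Ω =>
      ((p ^ (-(1 / s)) : ℝ) : EReal) * LongRangeLPP.passageTime α v 0 (n : ℤ) ω /
        (LongRangeLPP.scaling μ n : EReal)) P := fun n => by
    simp only [div_eq_mul_inv]
    exact ((hG.aemeasurable_passageTime 0 n).const_mul _).mul_const _
  have hb := hF.tendsto_scaling.eventually_gt_atTop 0
  have hq : 0 < p ^ (-(1 / s)) := Real.rpow_pos_of_pos hp0 _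
  -- This identifies the normalization of the theorem with the scaling constants `p ^ (1 / s) *
  -- scaling μ n` of the thinned law.
  have hqinv : (p ^ (-(1 / s)))⁻¹ = p ^ (1 / s) := by rw [Real.rpow_neg hp0.le, inv_inv]
  have hregular : TendstoInDistribution
      (fun (n : ℕ) (ω : Ω) =>
        ((p ^ (-(1 / s)) : ℝ) : EReal) * LongRangeLPP.passageTime α v 0 (n : ℤ) ω /
          (LongRangeLPP.scaling μ n : EReal))
      atTop (fun ω => (LongRangeLPP.contPassageTime s W' U' V' ω : EReal)) (fun _ => P) P' := by
    refine ⟨hR, hZ.aemeasurable, LongRangeLPP.tendsto_probabilityMeasure_ereal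
      (fun x ε hε => ?_) fun x ε hε => ?_⟩
    · filter_upwards [hb, LongRangeLPP.eventually_measureReal_lt_passageTime_ge hG hp0 hp1 hs0 hμpos
        h hρ x hε] with n hbn hn
      refine (le_of_eq ?_).trans (hn.trans (le_of_eq ?_))
      · exact congrArg (· - ε) (map_measureReal_apply hZ measurableSet_Ioi)
      · refine Eq.trans ?_ (map_measureReal_apply_of_aemeasurable (hR n) measurableSet_Ioi).symm
        congr 1
        ext ω
        rw [← hqinv]
        exact (LongRangeLPP.coe_lt_mul_div_iff hq hbn x _).symm
    · filter_upwards [hb, LongRangeLPP.eventually_measureReal_passageTime_le hG hp0 hp1 hs0 hs2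
        h hρ x hε] with n hbn hn
      refine le_trans ?_ (hn.trans (le_of_eq ?_))
      -- The closed ray is contained in all open rays with `z < x`, the form in which a path
      -- witnessing the bound can be extracted from the supremum.
      · refine (map_measureReal_apply_of_aemeasurable (hR n) measurableSet_Ici).trans_le
          (measureReal_mono fun ω hω z hz => ?_)
        rw [← hqinv]
        exact (LongRangeLPP.coe_lt_mul_div_iff hq hbn z _).1
          ((EReal.coe_lt_coe_iff.2 hz).trans_le hω)
      · exact congrArg (· + ε) (map_measureReal_apply hZ measurableSet_Ici).symm
  refine hregular.congr (fun _ => EventuallyEq.rfl) ?_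
  filter_upwards [hw s] with ω hω
  rw [hω]
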